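/- Let $V=\{1,\dots,n\}$, $n\ge 1$, and let $(V,E)$ be a tree whose edges are oriented toward a root $r$, so that every node $i\neq r$ has exactly one outgoing edge $(i,j)\in E$. Let $w_{ij}\ge 0$ for $(i,j)\in E$, and let $f_i:\mathbb R\to\mathbb R$ ($i\in V$) be continuous piecewise-linear, possibly non-convex, functions with at most $K$ breakpoints each. Assume that $$f(x)=\sum_{i\in V} f_i(x_i)+\sum_{(i,j)\in E} w_{ij}\,|x_j-x_i|,\qquad x\in\mathbb R^n,$$ attains its minimum over $\mathbb R^n$. (The pairwise terms are the truncated TV terms $\min\{w_{ij}|z|,C_{ij}\}$ with $C_{ij}=+\infty$.) The computational model is a real RAM: unit-cost operations $+,-,\times,/$ and comparisons on reals, unit-cost $+,-,\times$ and comparisons on integers, and memories for integers and for reals that are addressed through integer registers, with no conversion of reals to integers. A computation uses space at most $s$ if all integers that it stores (in particular all addresses) are less than $s$ and only memory cells with addresses less than $s$ are used. The input consists of $n$, the parent of every node, the weights $w_{ij}$ and, for every $i\in V$, the number $t$ of breakpoints of $f_i$ and the sequence $(s_0,\lambda_1,s_1,\dots,\lambda_t,s_t)$ of its breakpoints $\lambda_1\le\dots\le\lambda_t$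 and the slopes of its linear segments (which determine $f_i$ up to an additive constant). Then there is one real-RAM program such that for every $K$ there is a constant $c=c(K)$ for which the following holds. On every input as above the program halts after at most $c\,n^2$ steps, uses space at most $c\,n^2$, and outputs an exact minimizer $x$ of $f$. Moreover $x$ is a result of dynamic programming with piecewise-linear messages: there are functions $\widehat M_i:\mathbb R\to\mathbb R$ ($i\in V$) and $M_{ij}:\mathbb R\to\mathbb R$ ($(i,j)\in E$) with $$\widehat M_i(z)=f_i(z)+\sum_{(k,i)\in E}M_{ki}(z),\qquad M_{ij}(y)=\min_{z\in\mathbb R}\big[\widehat M_i(z)+w_{ij}|y-z|\big]$$ for all $y,z\in\mathbb R$ (all minima being attained), such that $\widehat M_i$ and $M_{ij}$ are continuous and piecewise linear with at most $c\,|V_i|$ breakpoints, where $V_i$ is the node set of the subtree rooted at $i$, and such that $x_r$ minimizes $\widehat M_r$ and, for every $(i,j)\in E$, $x_i$ minimizes $z\mapsto\widehat M_i(z)+w_{ij}|x_j-z|$. -/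

import Mathlib

namespace TVTree

/-! ### Rooted trees, with all edges oriented toward the root -/

/-- A tree on the node set `Fin n` in which every edge is oriented toward the root. The edges are the
pairs `(i, parent i)` with `i ≠ root`; by convention `parent root = root`. -/
structure RootedTree (n : ℕ) where
  root : Fin n
  parent : Fin n → Fin n
  parent_root : parent root = root
  reaches_root : ∀ i, ∃ k : ℕ, parent^[k] i = root

namespace RootedTree

variable {n : ℕ} (T : RootedTree n)

/-- The nodes `k` such that `(k, i)` is an edge. -/
def children (i : Fin n) : Finset (Fin n) :=
  Finset.univ.filter fun k => k ≠ T.root ∧ T.parent k = i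

open Classical in
/-- The node set of the subtree rooted at `i`. -/
noncomputable def subtree (i : Fin n) : Finset (Fin n) :=
  Finset.univ.filter fun v => ∃ k : ℕ, T.parent^[k] v = i

end RootedTree

/-! ### Continuous piecewise-linear functions -/

/-- A sequence `(s 0, bp 0, s 1, bp 1, …, bp (t-1), s t)` of slopes and (sorted) breakpoints. -/
structure PLSeq where
  t : ℕ
  bp : Fin t → ℝ
  slope : Fin (t + 1) → ℝ
  mono : Monotone bp

namespace PLSeq

/-- The `p`-th closed segment of the real line cut at the breakpoints: `[bp (p-1), bp p]`, where the
first segment is unbounded to the left and the last one unbounded to the right. -/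
def segment (S : PLSeq) (p : Fin (S.t + 1)) : Set ℝ :=
  {x | ∀ q : Fin S.t, (q.val < p.val → S.bp q ≤ x) ∧ (p.val ≤ q.val → x ≤ S.bp q)}

/-- `f` is the continuous piecewise-linear function (determined up to an additive constant) with the
given breakpoints and slopes. Continuity is implied, because adjacent closed segments overlap. -/
def Represents (S : PLSeq) (f : ℝ → ℝ) : Prop :=
  ∀ p : Fin (S.t + 1), ∀ x ∈ S.segment p, ∀ y ∈ S.segment p, f y - f x = S.slope p * (y - x)

/-- The sequence `s 0, bp 0, s 1, bp 1, …, bp (t-1), s t` as a list of `2 t + 1` reals. -/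
def toList (S : PLSeq) : List ℝ :=
  S.slope 0 :: (List.ofFn fun q : Fin S.t => [S.bp q, S.slope q.succ]).flatten

end PLSeq

/-- `f` is continuous piecewise-linear with at most `m` breakpoints. -/
def IsPLWith (m : ℕ) (f : ℝ → ℝ) : Prop :=
  ∃ S : PLSeq, S.t ≤ m ∧ S.Represents f

/-! ### The objective and the dynamic-programming messages -/

/-- The untruncated TV regularizer `z ↦ w |z|`. -/
noncomputable def tv (w z : ℝ) : ℝ := w * |z|

/-- `∑ i, f i (x i) + ∑ (i, j) ∈ E, w_ij |x j - x i|`; the weight of the edge `(i, parent i)` is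
`w i`, and `w root` plays no role. -/
noncomputable def objective {n : ℕ} (T : RootedTree n) (w : Fin n → ℝ) (f : Fin n → ℝ → ℝ)
    (x : Fin n → ℝ) : ℝ :=
  ∑ i, f i (x i) + ∑ i ∈ Finset.univ.filter (fun i => i ≠ T.root), tv (w i) (x (T.parent i) - x i)

/-- `x` minimizes the objective over `ℝⁿ`. -/
def IsMinimizer {n : ℕ} (T : RootedTree n) (w : Fin n → ℝ) (f : Fin n → ℝ → ℝ)
    (x : Fin n → ℝ) : Prop :=
  ∀ y : Fin n → ℝ, objective T w f x ≤ objective T w f y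

/-- `Mhat i` is the message of the node `i`, and `M i` (for `i ≠ root`) the message of the edge
`(i, parent i)`; the minima in the updates of the latter are attained. -/
structure IsMessages {n : ℕ} (T : RootedTree n) (w : Fin n → ℝ) (f : Fin n → ℝ → ℝ)
    (Mhat M : Fin n → ℝ → ℝ) : Prop where
  node : ∀ i z, Mhat i z = f i z + ∑ k ∈ T.children i, M k z
  edge : ∀ i, i ≠ T.root → ∀ y,
    IsLeast (Set.range fun z => Mhat i z + tv (w i) (y - z)) (M i y)

/-- `x` is a result of the backward pass: its root coordinate minimizes the message of the root, and
every other coordinate attains the minimum in the update of the message of its parent edge. -/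
structure IsBackwardPass {n : ℕ} (T : RootedTree n) (w : Fin n → ℝ)
    (Mhat : Fin n → ℝ → ℝ) (x : Fin n → ℝ) : Prop where
  root : ∀ z, Mhat T.root (x T.root) ≤ Mhat T.root z
  edge : ∀ i, i ≠ T.root → ∀ z,
    Mhat i (x i) + tv (w i) (x (T.parent i) - x i) ≤ Mhat i z + tv (w i) (x (T.parent i) - z)

/-! ### Real RAM

A random access machine with unit-cost exact real arithmetic: integer and real registers (finitely
many of which occur in a program), an integer memory and a real memory, both addressed through
integer registers. Control flow is structured. There is no conversion from reals to integers. -/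

/-- Registers and memories. -/
structure State where
  nreg : ℕ → ℕ
  rreg : ℕ → ℝ
  nmem : ℕ → ℕ
  rmem : ℕ → ℝ

/-- Primitive operations; `d` is the destination register. -/
inductive Op
  | nconst (d : ℕ) (c : ℕ)
  | nmove (d a : ℕ)
  | nadd (d a b : ℕ)
  | nsub (d a b : ℕ)
  | nmul (d a b : ℕ)
  | nload (d a : ℕ)
  | nstore (a b : ℕ)
  | rconst (d : ℕ) (c : ℤ)
  | rmove (d a : ℕ)
  | radd (d a b : ℕ)
  | rsub (d a b : ℕ)
  | rmul (d a b : ℕ)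
  | rdiv (d a b : ℕ)
  | rload (d a : ℕ)
  | rstore (a b : ℕ)

/-- The effect of an operation. Integer subtraction is truncated at `0`; division by `0` gives `0`. -/
noncomputable def Op.apply (o : Op) (σ : State) : State :=
  match o with
  | .nconst d c => { σ with nreg := Function.update σ.nreg d c }
  | .nmove d a => { σ with nreg := Function.update σ.nreg d (σ.nreg a) }
  | .nadd d a b => { σ with nreg := Function.update σ.nreg d (σ.nreg a + σ.nreg b) }
  | .nsub d a b => { σ with nreg := Function.update σ.nreg d (σ.nreg a - σ.nreg b) }
  | .nmul d a b => { σ with nreg := Function.update σ.nreg d (σ.nreg a * σ.nreg b) }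
  | .nload d a => { σ with nreg := Function.update σ.nreg d (σ.nmem (σ.nreg a)) }
  | .nstore a b => { σ with nmem := Function.update σ.nmem (σ.nreg a) (σ.nreg b) }
  | .rconst d c => { σ with rreg := Function.update σ.rreg d (c : ℝ) }
  | .rmove d a => { σ with rreg := Function.update σ.rreg d (σ.rreg a) }
  | .radd d a b => { σ with rreg := Function.update σ.rreg d (σ.rreg a + σ.rreg b) }
  | .rsub d a b => { σ with rreg := Function.update σ.rreg d (σ.rreg a - σ.rreg b) }
  | .rmul d a b => { σ with rreg := Function.update σ.rreg d (σ.rreg a * σ.rreg b) }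
  | .rdiv d a b => { σ with rreg := Function.update σ.rreg d (σ.rreg a / σ.rreg b) }
  | .rload d a => { σ with rreg := Function.update σ.rreg d (σ.rmem (σ.nreg a)) }
  | .rstore a b => { σ with rmem := Function.update σ.rmem (σ.nreg a) (σ.rreg b) }

/-- Comparisons of two integer registers or of two real registers. -/
inductive Test
  | nlt (a b : ℕ)
  | rlt (a b : ℕ)

/-- The truth of a comparison. -/
def Test.Holds (b : Test) (σ : State) : Prop :=
  match b with
  | .nlt a b => σ.nreg a < σ.nreg b
  | .rlt a b => σ.rreg a < σ.rreg b

/-- Programs. -/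
inductive Program
  | skip
  | op (o : Op)
  | seq (P Q : Program)
  | ite (b : Test) (P Q : Program)
  | loop (b : Test) (P : Program)

/-- The state fits in space `s`: every stored integer is less than `s` (so that every address that
can be formed is less than `s`), and all memory cells from address `s` on are blank. -/
structure State.FitsIn (s : ℕ) (σ : State) : Prop where
  nreg_lt : ∀ a, σ.nreg a < s
  nmem_lt : ∀ a, σ.nmem a < s
  nmem_blank : ∀ a, s ≤ a → σ.nmem a = 0
  rmem_blank : ∀ a, s ≤ a → σ.rmem a = 0

/-- `Exec s P σ τ σ'`: started in the state `σ`, the program `P` halts in the state `σ'` after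
exactly `τ` steps, and all states reached by its operations fit in space `s`. Every operation and
every evaluation of a test is one step. -/
inductive Exec (s : ℕ) : Program → State → ℕ → State → Prop
  | skip (σ : State) : Exec s .skip σ 1 σ
  | op (o : Op) (σ : State) (h : (o.apply σ).FitsIn s) : Exec s (.op o) σ 1 (o.apply σ)
  | seq {P Q : Program} {σ σ₁ σ₂ : State} {τ₁ τ₂ : ℕ}
      (h₁ : Exec s P σ τ₁ σ₁) (h₂ : Exec s Q σ₁ τ₂ σ₂) : Exec s (.seq P Q) σ (τ₁ + τ₂) σ₂
  | iteTrue {b : Test} {P Q : Program} {σ σ₁ : State} {τ : ℕ}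
      (hb : b.Holds σ) (h : Exec s P σ τ σ₁) : Exec s (.ite b P Q) σ (τ + 1) σ₁
  | iteFalse {b : Test} {P Q : Program} {σ σ₁ : State} {τ : ℕ}
      (hb : ¬ b.Holds σ) (h : Exec s Q σ τ σ₁) : Exec s (.ite b P Q) σ (τ + 1) σ₁
  | loopTrue {b : Test} {P : Program} {σ σ₁ σ₂ : State} {τ₁ τ₂ : ℕ}
      (hb : b.Holds σ) (h₁ : Exec s P σ τ₁ σ₁) (h₂ : Exec s (.loop b P) σ₁ τ₂ σ₂) :
      Exec s (.loop b P) σ (τ₁ + τ₂ + 1) σ₂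
  | loopFalse {b : Test} {P : Program} {σ : State}
      (hb : ¬ b.Holds σ) : Exec s (.loop b P) σ 1 σ

/-- The initial state: integer register `0` holds `n`, the integer memory holds the `n` parent
pointers followed by the `n` numbers of breakpoints of the unary terms, the real memory holds the
`n` weights followed by the concatenated sequences of the unary terms; all else is `0`. -/
noncomputable def inputState {n : ℕ} (T : RootedTree n) (w : Fin n → ℝ) (S : Fin n → PLSeq) :
    State where
  nreg := Function.update (fun _ => 0) 0 n
  rreg := fun _ => 0
  nmem := fun a =>
    ((List.ofFn fun i => (T.parent i).val) ++ (List.ofFn fun i => (S i).t)).getD a 0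
  rmem := fun a =>
    ((List.ofFn w) ++ (List.ofFn fun i => (S i).toList).flatten).getD a 0

/-- On the given input, `P` halts after at most `τ` steps, uses space at most `s` throughout, and
leaves the vector `x` in the first `n` cells of the real memory. -/
def Computes {n : ℕ} (P : Program) (τ s : ℕ) (T : RootedTree n) (w : Fin n → ℝ)
    (S : Fin n → PLSeq) (x : Fin n → ℝ) : Prop :=
  (inputState T w S).FitsIn s ∧
    ∃ τ' ≤ τ, ∃ σ : State, Exec s P (inputState T w S) τ' σ ∧ ∀ i : Fin n, σ.rmem i.val = x i

end TVTree

/-! Eliminating the nodes from the deepest upwards turns the objective into a function of the root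
coordinate alone. Each elimination replaces a node message by the lower envelope of cones of slope
`w i` with apices on its graph. Two facts about such envelopes carry the theorem.

The first one bounds the breakpoints. A running minimum of a piecewise-linear function has no more
breakpoints than the function: a new breakpoint arises where the function falls below its earlier
minimum, and before that the function must have turned downwards at a breakpoint which the running
minimum skips (`exists_runningMin_aux`). An envelope is a composition of two running minima, one
from each side (`IsAtomic.exists_message`), so the counts merely add up along the tree and the
messages of `i` have at most `K * |V_i|` breakpoints. The infima are attained because the minimum of
the objective bounds every partially eliminated objective from below (`elimination`).

The second one makes the algorithm short: the breakpoints of the messages need not be known. Take as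
grid the origin and the breakpoints of all unary terms. Between neighbouring grid points the unary
terms are affine and the messages stay concave (`CellConcave.message`), since an envelope creates
only concave kinks there. A function that is concave on the cells and attains its minimum attains it
at a grid point (`CellConcave.exists_mem_le`), and this remains true after adding a cone with apex
on the grid. Hence grid values of the messages are determined by grid values alone, and the backward
pass may stay on the grid (`isBackwardPass_of_grid`).

The grid has `N ≤ K * n + 1` cells. The program keeps one row of `N` values per node, sends each
message by two linear sweeps over a row, and picks each coordinate by a linear search; for fixed `K`
this is quadratic in time and space. The program is verified by Hoare triples that carry step
bounds, collected in `tr_minimizeTV`. -/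

namespace TVTree

/-! ### Piecewise-linear functions as sums of hinges -/

/-- The sum of the hinge functions `z ↦ Δ * max (z - a) 0` over the pairs `(a, Δ)` in `l`. -/
noncomputable def hinges (l : List (ℝ × ℝ)) (z : ℝ) : ℝ :=
  (l.map fun p => p.2 * max (z - p.1) 0).sum

@[simp] theorem hinges_nil (z : ℝ) : hinges [] z = 0 := rfl

@[simp] theorem hinges_cons (p : ℝ × ℝ) (l : List (ℝ × ℝ)) (z : ℝ) :
    hinges (p :: l) z = p.2 * max (z - p.1) 0 + hinges l z := by
  simp [hinges]

theorem hinges_append (l l' : List (ℝ × ℝ)) (z : ℝ) :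
    hinges (l ++ l') z = hinges l z + hinges l' z := by
  simp [hinges]

theorem hinges_perm {l l' : List (ℝ × ℝ)} (h : l.Perm l') (z : ℝ) : hinges l z = hinges l' z :=
  (h.map _).sum_eq

theorem hinges_eq_zero {l : List (ℝ × ℝ)} {z : ℝ} (h : ∀ p ∈ l, z ≤ p.1) : hinges l z = 0 := by
  induction l with
  | nil => rfl
  | cons p l ih =>
    have h1 : z - p.1 ≤ 0 := by linarith [h p (by simp)]
    rw [hinges_cons, max_eq_right h1, ih fun q hq => h q (by simp [hq])]
    ring

/-- `f` is an affine function plus at most `m` hinges. -/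
def IsAtomic (m : ℕ) (f : ℝ → ℝ) : Prop :=
  ∃ (c s : ℝ) (l : List (ℝ × ℝ)), l.length ≤ m ∧ ∀ z, f z = c + s * z + hinges l z

namespace IsAtomic

theorem mono {m m' : ℕ} {f : ℝ → ℝ} (h : IsAtomic m f) (hm : m ≤ m') : IsAtomic m' f := by
  obtain ⟨c, s, l, hl, hf⟩ := h
  exact ⟨c, s, l, hl.trans hm, hf⟩

theorem affine (c s : ℝ) : IsAtomic 0 fun z => c + s * z :=
  ⟨c, s, [], by simp, by simp⟩

/-- Hinge lists need not be sorted, so addition is concatenation and the counts add up. For this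
reason the messages are handled through `IsAtomic` and converted to `IsPLWith` only at the end. -/
theorem add {m m' : ℕ} {f g : ℝ → ℝ} (hf : IsAtomic m f) (hg : IsAtomic m' g) :
    IsAtomic (m + m') fun z => f z + g z := by
  obtain ⟨c, s, l, hl, hf⟩ := hf
  obtain ⟨c', s', l', hl', hg⟩ := hg
  refine ⟨c + c', s + s', l ++ l', by simp; omega, fun z => ?_⟩
  simp only [hf, hg, hinges_append]
  ring

theorem sum {ι : Type*} {t : Finset ι} {m : ι → ℕ} {f : ι → ℝ → ℝ}
    (h : ∀ i ∈ t, IsAtomic (m i) (f i)) : IsAtomic (∑ i ∈ t, m i) fun z => ∑ i ∈ t, f i z := by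
  classical
  induction t using Finset.induction_on with
  | empty => simpa using affine 0 0
  | insert a t ha ih =>
    simp only [Finset.sum_insert ha]
    exact (h a (by simp)).add (ih fun i hi => h i (by simp [hi]))

theorem add_linear {m : ℕ} {f : ℝ → ℝ} (hf : IsAtomic m f) (s : ℝ) :
    IsAtomic m fun z => f z + s * z := by
  simpa using hf.add (affine 0 s)

/-- A reflected hinge is a hinge at the reflected point plus an affine function, as `max (-u) 0 =
max u 0 - u`. Reflection reduces minima taken from the right to minima taken from the left. -/
theorem comp_neg {m : ℕ} {f : ℝ → ℝ} (hf : IsAtomic m f) : IsAtomic m fun z => f (-z) := by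
  obtain ⟨c, s, l, hl, hf⟩ := hf
  suffices h : IsAtomic l.length fun z => hinges l (-z) by
    have := (affine c (-s)).add (h.mono hl)
    simp only [zero_add] at this
    convert this using 2 with z
    rw [hf]
    ring
  clear hf hl
  induction l with
  | nil => simpa using affine 0 0
  | cons p l ih =>
    simp only [hinges_cons, List.length_cons]
    rw [add_comm]
    refine add (m := 1) ⟨-p.2 * p.1, -p.2, [(-p.1, p.2)], by simp, fun z => ?_⟩ ih
    simp only [hinges_cons, hinges_nil]
    rcases le_total (-z - p.1) 0 with h | h
    · rw [max_eq_right h, max_eq_left (by linarith)]; ring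
    · rw [max_eq_left h, max_eq_right (by linarith)]; ring

theorem exists_sorted {m : ℕ} {f : ℝ → ℝ} (hf : IsAtomic m f) :
    ∃ (c s : ℝ) (l : List (ℝ × ℝ)), l.length ≤ m ∧ l.Pairwise (fun p q => p.1 ≤ q.1) ∧
      ∀ z, f z = c + s * z + hinges l z := by
  obtain ⟨c, s, l, hl, hf⟩ := hf
  let r : ℝ × ℝ → ℝ × ℝ → Prop := fun p q => p.1 ≤ q.1
  have : Std.Total r := ⟨fun p q => le_total p.1 q.1⟩
  have : IsTrans (ℝ × ℝ) r := ⟨fun p q t h h' => le_trans h h'⟩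
  classical
  refine ⟨c, s, l.insertionSort r, by simpa using hl, List.pairwise_insertionSort r l,
    fun z => ?_⟩
  rw [hf, hinges_perm (List.perm_insertionSort r l)]

end IsAtomic

theorem hinges_ofFn {t : ℕ} (b d : Fin t → ℝ) (z : ℝ) :
    hinges (List.ofFn fun q => (b q, d q)) z = ∑ q, d q * max (z - b q) 0 := by
  simp [hinges, List.map_ofFn, List.sum_ofFn]

/-! ### Breakpoint sequences in hinge form -/

namespace PLSeq

/-- The function represented by `S`, normalized to have the value `0` at `0` if all breakpoints are
nonnegative. -/
noncomputable def eval (S : PLSeq) (z : ℝ) : ℝ :=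
  S.slope 0 * z + ∑ q : Fin S.t, (S.slope q.succ - S.slope q.castSucc) * max (z - S.bp q) 0

theorem slope_eq (S : PLSeq) (p : Fin (S.t + 1)) :
    S.slope p = S.slope 0 + ∑ q : Fin S.t,
      if q.val < p.val then S.slope q.succ - S.slope q.castSucc else 0 := by
  induction p using Fin.induction with
  | zero => simp
  | succ p ih =>
    have h : ∀ q : Fin S.t, (if q.val < p.succ.val then S.slope q.succ - S.slope q.castSucc else 0)
        = (if q.val < p.castSucc.val then S.slope q.succ - S.slope q.castSucc else 0)
          + if q = p then S.slope q.succ - S.slope q.castSucc else 0 := by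
      intro q
      simp only [Fin.val_succ, Fin.val_castSucc, Fin.ext_iff]
      split_ifs <;> first | omega | simp
    rw [Finset.sum_congr rfl fun q _ => h q, Finset.sum_add_distrib, Finset.sum_ite_eq' Finset.univ p]
    simp only [Finset.mem_univ, if_true]
    linarith

theorem represents_eval (S : PLSeq) : S.Represents S.eval := by
  intro p x hx y hy
  rw [S.slope_eq p, eval, eval, add_mul, Finset.sum_mul, add_sub_add_comm,
    ← Finset.sum_sub_distrib, ← mul_sub]
  congr 1
  refine Finset.sum_congr rfl fun q _ => ?_
  split_ifs with h
  · rw [max_eq_left (by linarith [(hy q).1 h]), max_eq_left (by linarith [(hx q).1 h])]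
    ring
  · rw [max_eq_right (by linarith [(hy q).2 (by omega)]),
      max_eq_right (by linarith [(hx q).2 (by omega)])]
    ring

theorem exists_mem_segment (S : PLSeq) (x : ℝ) : ∃ p, x ∈ S.segment p := by
  classical
  -- As the breakpoints are sorted, the number of those not exceeding `x` indexes a segment that
  -- contains `x`.
  let p := (Finset.univ.filter fun q : Fin S.t => S.bp q ≤ x).card
  have hp : p < S.t + 1 := by
    have := Finset.card_le_univ (Finset.univ.filter fun q : Fin S.t => S.bp q ≤ x)
    simp only [Fintype.card_fin] at this
    omega
  refine ⟨⟨p, hp⟩, fun q => ⟨fun h => ?_, fun h => ?_⟩⟩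
  · by_contra hq
    have : (Finset.univ.filter fun q : Fin S.t => S.bp q ≤ x) ⊆ Finset.Iio q := by
      intro r hr
      simp only [Finset.mem_filter, Finset.mem_univ, true_and] at hr
      rw [Finset.mem_Iio]
      by_contra hqr
      exact hq ((S.mono (not_lt.1 hqr)).trans hr)
    have := Finset.card_le_card this
    simp only [Fin.card_Iio] at this
    simp only at h
    omega
  · by_contra hq
    have : Finset.Iic q ⊆ (Finset.univ.filter fun q : Fin S.t => S.bp q ≤ x) := by
      intro r hr
      simp only [Finset.mem_filter, Finset.mem_univ, true_and]
      exact (S.mono (Finset.mem_Iic.1 hr)).trans (not_le.1 hq).le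
    have := Finset.card_le_card this
    simp only [Fin.card_Iic] at this
    simp only at h
    omega

/-- On each segment both functions have the same slope, hence differ by a constant. Neighbouring
closed segments share a breakpoint, which makes these constants equal. -/
theorem Represents.exists_eq_eval {S : PLSeq} {f : ℝ → ℝ} (h : S.Represents f) :
    ∃ c, ∀ z, f z = S.eval z + c := by
  have key : ∀ p : Fin (S.t + 1), ∃ c, ∀ z ∈ S.segment p, f z = S.eval z + c := by
    intro p
    by_cases hne : (S.segment p).Nonempty
    · obtain ⟨x, hx⟩ := hne
      refine ⟨f x - S.eval x, fun z hz => ?_⟩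
      linarith [h p x hx z hz, S.represents_eval p x hx z hz]
    · exact ⟨0, fun z hz => (hne ⟨z, hz⟩).elim⟩
  choose c hc using key
  have step : ∀ p : Fin S.t, c p.succ = c p.castSucc := by
    intro p
    have h1 : S.bp p ∈ S.segment p.succ := fun q =>
      ⟨fun hq => S.mono (by simp at hq; rw [Fin.le_def]; omega),
        fun hq => S.mono (by simp at hq; rw [Fin.le_def]; omega)⟩
    have h2 : S.bp p ∈ S.segment p.castSucc := fun q =>
      ⟨fun hq => S.mono (by simp at hq; rw [Fin.le_def]; omega),
        fun hq => S.mono (by simp at hq; rw [Fin.le_def]; omega)⟩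
    linarith [hc _ _ h1, hc _ _ h2]
  have hall : ∀ p, c p = c 0 := by
    intro p
    induction p using Fin.induction with
    | zero => rfl
    | succ p ih => rw [step, ih]
  refine ⟨c 0, fun z => ?_⟩
  obtain ⟨p, hp⟩ := S.exists_mem_segment z
  rw [hc p z hp, hall]

theorem isAtomic_eval (S : PLSeq) : IsAtomic S.t S.eval :=
  ⟨0, S.slope 0, List.ofFn fun q => (S.bp q, S.slope q.succ - S.slope q.castSucc), by simp,
    fun z => by rw [hinges_ofFn, eval]; ring⟩

theorem Represents.isAtomic {S : PLSeq} {f : ℝ → ℝ} (h : S.Represents f) : IsAtomic S.t f := by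
  obtain ⟨c, hc⟩ := h.exists_eq_eval
  have := S.isAtomic_eval.add (IsAtomic.affine c 0)
  simp only [zero_mul, add_zero, ← hc] at this
  exact this

end PLSeq

/-- Once the hinges are sorted, their coefficients are the jumps of the slope, so the slopes are
partial sums of the coefficients. -/
theorem IsAtomic.isPLWith {m : ℕ} {f : ℝ → ℝ} (hf : IsAtomic m f) : IsPLWith m f := by
  obtain ⟨c, s, l, hl, hsort, hf⟩ := hf.exists_sorted
  let d : ℕ → ℝ := fun q => if h : q < l.length then (l.get ⟨q, h⟩).2 else 0
  let S : PLSeq :=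
    { t := l.length
      bp := fun q => (l.get q).1
      slope := fun p => s + ∑ q ∈ Finset.range p.val, d q
      mono := by
        intro p q hpq
        rcases hpq.eq_or_lt with rfl | h
        · exact le_rfl
        · exact List.pairwise_iff_get.1 hsort p q h }
  refine ⟨S, hl, ?_⟩
  have : ∀ z, f z = S.eval z + c := by
    intro z
    have h1 : hinges l z = ∑ q : Fin l.length, (l.get q).2 * max (z - (l.get q).1) 0 := by
      rw [← hinges_ofFn (fun q => (l.get q).1)]
      congr 1
      simp
    rw [hf, PLSeq.eval, h1]
    have h2 : ∀ q : Fin l.length, S.slope q.succ - S.slope q.castSucc = (l.get q).2 := by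
      intro q
      simp [S, Finset.sum_range_succ, d]
    have h3 : ∑ q : Fin S.t, (S.slope q.succ - S.slope q.castSucc) * max (z - S.bp q) 0
        = ∑ q : Fin l.length, (l.get q).2 * max (z - (l.get q).1) 0 :=
      Finset.sum_congr rfl fun q _ => by rw [h2 q]
    rw [h3]
    simp [S]
    ring
  intro p x hx y hy
  rw [this, this]
  linarith [S.represents_eval p x hx y hy]

/-! ### Running minima and messages -/

/-- A linear function on an interval is smallest at an endpoint, and its value `0` at `a` does not
beat `-h`. -/
theorem isLeast_runningMin_linear {g h a y : ℝ} {F : ℝ → ℝ} (hh : 0 ≤ h) (hy : a ≤ y)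
    (hF : ∀ z, a ≤ z → z ≤ y → F z = g * (z - a)) :
    IsLeast (insert (-h) (F '' Set.Icc a y)) (min (-h) (g * (y - a))) := by
  constructor
  · rcases min_choice (-h) (g * (y - a)) with h1 | h1 <;> rw [h1]
    · exact Or.inl rfl
    · exact Or.inr ⟨y, ⟨hy, le_rfl⟩, hF y hy le_rfl⟩
  · rintro _ (rfl | ⟨z, ⟨hz, hz'⟩, rfl⟩)
    · exact min_le_left _ _
    · rw [hF z hz hz']
      rcases le_total 0 g with hg | hg
      · exact (min_le_left _ _).trans (by nlinarith)
      · exact (min_le_right _ _).trans (by nlinarith)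

/-- The running minimum, from the height `-h` on, of a function with sorted hinges; the function is
followed if `h = 0` and it decreases, and a hinge may be added only if it decreases while `h > 0`. -/
theorem exists_runningMin_aux (l : List (ℝ × ℝ)) (hl : l.Pairwise fun p q => p.1 ≤ q.1) :
    ∀ a g h : ℝ, 0 ≤ h → (∀ p ∈ l, a ≤ p.1) → ∃ l' : List (ℝ × ℝ), (∀ p ∈ l', a ≤ p.1) ∧
      l'.length ≤ l.length + (if 0 < h ∧ g < 0 then 1 else 0) ∧
      ∀ y, a ≤ y → IsLeast (insert (-h) ((fun z => g * (z - a) + hinges l z) '' Set.Icc a y))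
        (-h + (if h = 0 then min g 0 else 0) * (y - a) + hinges l' y) := by
  induction l with
  | nil =>
    intro a g h hh _
    have base : ∀ y, a ≤ y → IsLeast (insert (-h)
        ((fun z => g * (z - a) + hinges [] z) '' Set.Icc a y)) (min (-h) (g * (y - a))) :=
      fun y hy => isLeast_runningMin_linear hh hy fun z _ _ => by simp
    by_cases hc : 0 < h ∧ g < 0
    -- The line of slope `g` reaches the height `-h` at `a - h / g`; from there on the minimum
    -- follows it.
    · refine ⟨[(a - h / g, g)], ?_, by simp [hc], fun y hy => ?_⟩
      · have : h / g ≤ 0 := div_nonpos_of_nonneg_of_nonpos hc.1.le hc.2.le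
        simp; linarith
      · convert base y hy using 1
        have e : g * (y - (a - h / g)) = g * (y - a) + h := by field_simp [hc.2.ne]; ring
        simp only [hc.1.ne', if_false, hinges_cons, hinges_nil]
        rcases le_total (y - (a - h / g)) 0 with h1 | h1
        · rw [max_eq_right h1, min_eq_left (by nlinarith)]; ring
        · rw [max_eq_left h1, min_eq_right (by nlinarith)]; linarith
    · refine ⟨[], by simp, by simp, fun y hy => ?_⟩
      convert base y hy using 1
      by_cases h0 : h = 0
      · subst h0
        simp only [if_true, hinges_nil]
        rcases le_total g 0 with h1 | h1
        · rw [min_eq_left h1, min_eq_right (by nlinarith)]; ring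
        · rw [min_eq_right h1, min_eq_left (by nlinarith)]; ring
      · have hg : 0 ≤ g := by
          by_contra hg
          exact hc ⟨lt_of_le_of_ne hh (Ne.symm h0), not_le.1 hg⟩
        simp only [h0, if_false, hinges_nil]
        rw [min_eq_left (by nlinarith)]; ring
  | cons p l ih =>
    obtain ⟨b, Δ⟩ := p
    intro a g h hh ha
    rw [List.pairwise_cons] at hl
    have hab : a ≤ b := ha (b, Δ) (by simp)
    have hb : ∀ p ∈ l, b ≤ p.1 := hl.1
    -- `h₂` is the height of the function above its running minimum at `b`, the datum with which the
    -- induction hypothesis restarts there.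
    set h₂ := g * (b - a) - min (-h) (g * (b - a)) with hh₂
    have h₂0 : 0 ≤ h₂ := by linarith [min_le_right (-h) (g * (b - a))]
    obtain ⟨l₂, hl₂, hlen, hleast⟩ := ih hl.2 b (g + Δ) h₂ h₂0 hb
    have F1 : ∀ z, a ≤ z → z ≤ b → g * (z - a) + hinges ((b, Δ) :: l) z = g * (z - a) := by
      intro z _ hz
      rw [hinges_eq_zero, add_zero]
      intro p hp
      rcases List.mem_cons.1 hp with rfl | hp
      · exact hz
      · exact hz.trans (hb p hp)
    have F2 : ∀ z, b ≤ z → g * (z - a) + hinges ((b, Δ) :: l) z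
        = g * (b - a) + ((g + Δ) * (z - b) + hinges l z) := by
      intro z hz
      rw [hinges_cons, max_eq_left (by simpa using hz)]
      ring
    set s₂ := (if h₂ = 0 then min (g + Δ) 0 else 0) with hs₂
    have zero₂ : ∀ y, y ≤ b → hinges l₂ y = 0 := fun y hy =>
      hinges_eq_zero fun p hp => hy.trans (hl₂ p hp)
    -- Only the hinges in `[a, b]` remain to be chosen: left of `b` the minimum is that of a line,
    -- right of `b` it is the one supplied by the induction.
    suffices H : ∃ l' : List (ℝ × ℝ), (∀ p ∈ l', a ≤ p.1) ∧
        l'.length ≤ ((b, Δ) :: l).length + (if 0 < h ∧ g < 0 then 1 else 0) ∧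
        (∀ y, a ≤ y → y ≤ b → -h + (if h = 0 then min g 0 else 0) * (y - a) + hinges l' y
          = min (-h) (g * (y - a))) ∧
        ∀ y, b ≤ y → -h + (if h = 0 then min g 0 else 0) * (y - a) + hinges l' y
          = g * (b - a) + (-h₂ + s₂ * (y - b) + hinges l₂ y) by
      obtain ⟨l', h1, h2, h3, h4⟩ := H
      refine ⟨l', h1, h2, fun y hy => ?_⟩
      rcases le_total y b with hyb | hyb
      · rw [h3 y hy hyb]
        exact isLeast_runningMin_linear hh hy fun z hz hz' => F1 z hz (hz'.trans hyb)
      · rw [h4 y hyb]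
        have L := hleast y hyb
        have L1 := isLeast_runningMin_linear (F := fun z => g * (z - a) + hinges ((b, Δ) :: l) z)
          hh hab F1
        constructor
        · rcases L.1 with e | ⟨z, ⟨hz, hz'⟩, e⟩
          · rw [e]
            have : g * (b - a) + -h₂ = min (-h) (g * (b - a)) := by rw [hh₂]; ring
            rw [this]
            exact Set.insert_subset_insert (Set.image_mono (Set.Icc_subset_Icc_right hyb)) L1.1
          · refine Or.inr ⟨z, ⟨hab.trans hz, hz'⟩, ?_⟩
            simp only at e ⊢
            rw [F2 z hz, e]
        · have hm : -h₂ + s₂ * (y - b) + hinges l₂ y ≤ -h₂ := L.2 (Or.inl rfl)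
          rintro _ (rfl | ⟨z, ⟨hz, hz'⟩, rfl⟩)
          · linarith [min_le_left (-h) (g * (b - a))]
          · rcases le_total z b with hzb | hzb
            · have := L1.2 (Or.inr ⟨z, ⟨hz, hzb⟩, rfl⟩)
              linarith
            · have := L.2 (Or.inr ⟨z, ⟨hzb, hz'⟩, rfl⟩)
              simp only at this ⊢
              rw [F2 z hzb]
              linarith
    have len₂ : h₂ = 0 → l₂.length ≤ l.length := fun e => by simpa [e] using hlen
    by_cases c1 : h = 0 ∧ g ≤ 0
    · obtain ⟨rfl, hg⟩ := c1
      have e : h₂ = 0 := by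
        rw [hh₂, min_eq_right (by nlinarith)]; ring
      refine ⟨(b, s₂ - g) :: l₂, ?_, ?_, fun y hy hyb => ?_, fun y hyb => ?_⟩
      · rintro p hp
        rcases List.mem_cons.1 hp with rfl | hp
        · exact hab
        · exact hab.trans (hl₂ p hp)
      · have := len₂ e
        simp only [List.length_cons]; omega
      · rw [hinges_cons, zero₂ y hyb, max_eq_right (by simpa using hyb), if_pos rfl,
          min_eq_left hg, min_eq_right (by nlinarith)]
        ring
      · rw [hinges_cons, max_eq_left (by simpa using hyb), if_pos rfl, min_eq_left hg, e]
        simp only; ring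
    have hs' : (if h = 0 then min g 0 else 0) = 0 := by
      split_ifs with h0
      · exact min_eq_right (le_of_lt (not_le.1 fun hg => c1 ⟨h0, hg⟩))
      · rfl
    rw [hs']
    by_cases c2 : 0 ≤ h + g * (b - a)
    · have e : h₂ = h + g * (b - a) := by
        rw [hh₂, min_eq_left (by linarith)]; ring
      have low : ∀ y, a ≤ y → y ≤ b → min (-h) (g * (y - a)) = -h := by
        intro y hy hyb
        refine min_eq_left ?_
        rcases le_total 0 g with hg | hg <;> nlinarith
      by_cases c3 : h₂ = 0
      · refine ⟨(b, s₂) :: l₂, ?_, ?_, fun y hy hyb => ?_, fun y hyb => ?_⟩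
        · rintro p hp
          rcases List.mem_cons.1 hp with rfl | hp
          · exact hab
          · exact hab.trans (hl₂ p hp)
        · have := len₂ c3
          simp only [List.length_cons]; omega
        · rw [hinges_cons, zero₂ y hyb, max_eq_right (by simpa using hyb), low y hy hyb]
          ring
        · rw [hinges_cons, max_eq_left (by simpa using hyb)]
          simp only
          linarith
      · have s0 : s₂ = 0 := by rw [hs₂, if_neg c3]
        -- The function is still above its running minimum at `b`, so the hinge at `b` is dropped;
        -- this pays for the extra hinge that `l₂` may contain.
        refine ⟨l₂, fun p hp => hab.trans (hl₂ p hp), ?_, fun y hy hyb => ?_, fun y hyb => ?_⟩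
        · have : (if 0 < h₂ ∧ g + Δ < 0 then 1 else 0) ≤ 1 := by split_ifs <;> simp
          simp only [List.length_cons]; omega
        · rw [zero₂ y hyb, low y hy hyb]; ring
        · rw [s0, e]; ring
    · have hg : g < 0 := by
        by_contra hg
        exact c2 (by nlinarith)
      have h0 : 0 < h := lt_of_le_of_ne hh fun e => c1 ⟨e.symm, hg.le⟩
      have e : h₂ = 0 := by
        rw [hh₂, min_eq_right (by linarith)]; ring
      have hx : g * (h / g) = h := by field_simp [hg.ne]
      have hxb : a - h / g ≤ b := by
        by_contra hlt
        nlinarith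
      have hax : a ≤ a - h / g := by
        have : h / g ≤ 0 := div_nonpos_of_nonneg_of_nonpos h0.le hg.le
        linarith
      -- The function undercuts `-h` before `b`. The additional hinge at the crossing is covered by
      -- the allowance for `0 < h ∧ g < 0`, and because `h₂ = 0` the list `l₂` uses no allowance of
      -- its own.
      refine ⟨(a - h / g, g) :: (b, s₂ - g) :: l₂, ?_, ?_, fun y hy hyb => ?_, fun y hyb => ?_⟩
      · rintro p hp
        rcases List.mem_cons.1 hp with rfl | hp
        · exact hax
        rcases List.mem_cons.1 hp with rfl | hp
        · exact hab
        · exact hab.trans (hl₂ p hp)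
      · have := len₂ e
        simp only [List.length_cons, h0, hg, and_self, if_true]; omega
      · rw [hinges_cons, hinges_cons, zero₂ y hyb, max_eq_right (a := y - (b, s₂ - g).1)
          (by simpa using hyb)]
        simp only
        rcases le_total (y - (a - h / g)) 0 with h1 | h1
        · rw [max_eq_right h1, min_eq_left (by nlinarith)]; ring
        · rw [max_eq_left h1, min_eq_right (by nlinarith)]; linarith
      · rw [hinges_cons, hinges_cons, max_eq_left (a := y - (b, s₂ - g).1) (by simpa using hyb),
          max_eq_left (by simp only; linarith), e]
        simp only
        linarith

/-- The bound on the left half-line forces the leftmost slope to be nonpositive, so the function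
equals its running minimum up to the first hinge. From there `exists_runningMin_aux` applies with
height `0`, where it allows no extra hinge. -/
theorem IsAtomic.exists_runningMin {m : ℕ} {F : ℝ → ℝ} (hF : IsAtomic m F) {x₀ B : ℝ}
    (hB : ∀ z ≤ x₀, B ≤ F z) :
    ∃ N : ℝ → ℝ, IsAtomic m N ∧ ∀ y, IsLeast (F '' Set.Iic y) (N y) := by
  obtain ⟨c, s, l, hlm, hsort, hF⟩ := hF.exists_sorted
  have neg : ∀ b : ℝ, (∀ z ≤ b, F z = c + s * z) → s ≤ 0 := by
    intro b hb
    by_contra hs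
    push Not at hs
    -- With `s` positive, the value `c + s * z` at this point is at most `B - s`, below the bound.
    set z := min (min x₀ b) ((B - c) / s - 1)
    have h1 := hB z ((min_le_left _ _).trans (min_le_left _ _))
    rw [hb z ((min_le_left _ _).trans (min_le_right _ _))] at h1
    have h2 : z ≤ (B - c) / s - 1 := min_le_right _ _
    have h3 : s * ((B - c) / s) = B - c := by field_simp
    nlinarith
  have anti : ∀ b y : ℝ, (∀ z ≤ b, F z = c + s * z) → y ≤ b →
      IsLeast (F '' Set.Iic y) (c + s * y) := by
    intro b y hb hy
    have hs := neg b hb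
    refine ⟨⟨y, Set.mem_Iic.2 le_rfl, hb y hy⟩, ?_⟩
    rintro _ ⟨z, hz, rfl⟩
    rw [hb z (le_trans hz hy)]
    have : z ≤ y := hz
    nlinarith
  cases l with
  | nil =>
    refine ⟨fun z => c + s * z, ⟨c, s, [], by simp, by simp⟩, fun y => ?_⟩
    exact anti y y (fun z _ => by simp [hF]) le_rfl
  | cons p l =>
    obtain ⟨b, Δ⟩ := p
    rw [List.pairwise_cons] at hsort
    have F1 : ∀ z ≤ b, F z = c + s * z := by
      intro z hz
      rw [hF, hinges_eq_zero, add_zero]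
      intro p hp
      rcases List.mem_cons.1 hp with rfl | hp
      · exact hz
      · exact hz.trans (hsort.1 p hp)
    have hs := neg b F1
    have F2 : ∀ z, b ≤ z → F z = c + s * b + ((s + Δ) * (z - b) + hinges l z) := by
      intro z hz
      rw [hF, hinges_cons, max_eq_left (by simpa using hz)]
      ring
    obtain ⟨l', hl', hlen, hleast⟩ :=
      exists_runningMin_aux l hsort.2 b (s + Δ) 0 le_rfl hsort.1
    set s' := min (s + Δ) 0
    simp only [lt_irrefl, false_and, if_false, if_true, neg_zero, zero_add, add_zero]
      at hlen hleast
    refine ⟨fun z => c + s * z + hinges ((b, s' - s) :: l') z,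
      ⟨c, s, _, by simp only [List.length_cons] at hlm ⊢; omega, fun z => rfl⟩, fun y => ?_⟩
    simp only
    rcases le_total y b with hy | hy
    · rw [hinges_eq_zero, add_zero]
      · exact anti b y F1 hy
      · intro p hp
        rcases List.mem_cons.1 hp with rfl | hp
        · exact hy
        · exact hy.trans (hl' p hp)
    · have L := hleast y hy
      have L1 := anti b b F1 le_rfl
      have e : c + s * y + hinges ((b, s' - s) :: l') y
          = c + s * b + (s' * (y - b) + hinges l' y) := by
        rw [hinges_cons, max_eq_left (by simpa using hy)]
        ring
      rw [e]
      constructor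
      · rcases L.1 with e | ⟨z, ⟨hz, hz'⟩, e⟩
        · rw [e, add_zero]
          exact Set.image_mono (Set.Iic_subset_Iic.2 hy) L1.1
        · refine ⟨z, hz', ?_⟩
          simp only at e
          rw [F2 z hz, e]
      · have hm := L.2 (Or.inl rfl)
        rintro _ ⟨z, hz, rfl⟩
        rcases le_total z b with hzb | hzb
        · have := L1.2 ⟨z, hzb, rfl⟩
          linarith
        · have := L.2 (Or.inr ⟨z, ⟨hzb, hz⟩, rfl⟩)
          simp only at this
          rw [F2 z hzb]
          linarith

/-- The lower envelope of the cones of slope `w` with apices on the graph of a piecewise-linear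
function is piecewise linear with no more breakpoints. -/
theorem IsAtomic.exists_message {m : ℕ} {F : ℝ → ℝ} (hF : IsAtomic m F) {w : ℝ} (hw : 0 ≤ w)
    {y₀ B : ℝ} (hB : ∀ z, B ≤ F z + tv w (y₀ - z)) :
    ∃ M : ℝ → ℝ, IsAtomic m M ∧ ∀ y, IsLeast (Set.range fun z => F z + tv w (y - z)) (M y) := by
  -- `N y + w * y` is the minimum of `F z + w * (y - z)` over `z ≤ y`.
  obtain ⟨N, hN, hNl⟩ := (hF.add_linear (-w)).exists_runningMin (x₀ := y₀) (B := B - w * y₀) (by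
    intro z hz
    have := hB z
    rw [tv, abs_of_nonneg (by linarith)] at this
    linarith)
  -- One `w` undoes the first tilt, the other tilts for the minimum from the right. That minimum is
  -- taken of the result of the first one: a pointwise minimum of the two one-sided envelopes could
  -- need more breakpoints, whereas going from `z` to `y` through an intermediate point never costs
  -- less than `w * |y - z|`.
  have hN' := (hN.add_linear (2 * w)).comp_neg
  obtain ⟨R, hR, hRl⟩ := hN'.exists_runningMin (x₀ := -y₀) (B := B + w * y₀) (by
    intro z hz
    obtain ⟨u, hu, e⟩ := (hNl (-z)).1
    have hu' : u ≤ -z := hu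
    simp only at e ⊢
    have h1 := hB u
    rw [tv] at h1
    rw [← e]
    rcases le_total 0 (y₀ - u) with h2 | h2
    · rw [abs_of_nonneg h2] at h1; nlinarith
    · rw [abs_of_nonpos h2] at h1; nlinarith)
  refine ⟨fun y => R (-y) + -w * y, hR.comp_neg.add_linear (-w), fun y => ?_⟩
  have lower : ∀ z, R (-y) + -w * y ≤ F z + tv w (y - z) := by
    intro z
    rw [tv]
    rcases le_total z y with h | h
    · rw [abs_of_nonneg (by linarith)]
      have h1 := (hRl (-y)).2 ⟨-y, Set.mem_Iic.2 le_rfl, rfl⟩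
      have h2 := (hNl y).2 ⟨z, h, rfl⟩
      simp only [neg_neg] at h1 h2
      linarith
    · rw [abs_of_nonpos (by linarith)]
      have h1 := (hRl (-y)).2 ⟨-z, (by simpa using h), rfl⟩
      have h2 := (hNl z).2 ⟨z, Set.mem_Iic.2 le_rfl, rfl⟩
      simp only [neg_neg] at h1 h2
      linarith
  refine ⟨?_, fun _ ⟨z, e⟩ => e ▸ lower z⟩
  obtain ⟨z, hz, e⟩ := (hRl (-y)).1
  obtain ⟨u, hu, e'⟩ := (hNl (-z)).1
  refine ⟨u, le_antisymm ?_ (lower u)⟩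
  have hz' : z ≤ -y := hz
  have hu' : u ≤ -z := hu
  simp only [tv] at e e' ⊢
  rcases le_total u y with h | h
  · rw [abs_of_nonneg (by linarith)]; nlinarith
  · rw [abs_of_nonpos (by linarith)]; nlinarith

/-- A piecewise-linear function that is bounded below attains its minimum. -/
theorem IsAtomic.exists_forall_le {m : ℕ} {F : ℝ → ℝ} (hF : IsAtomic m F) {B : ℝ}
    (hB : ∀ z, B ≤ F z) : ∃ x, ∀ z, F x ≤ F z := by
  -- With weight `0` the envelope is the constant minimum of `F`.
  obtain ⟨M, -, hM⟩ := hF.exists_message (w := 0) le_rfl (y₀ := 0) (B := B) (by simpa [tv] using hB)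
  obtain ⟨⟨x, hx⟩, h⟩ := hM 0
  refine ⟨x, fun z => ?_⟩
  have := h ⟨z, rfl⟩
  simp only [tv, zero_mul, add_zero] at hx this
  rwa [hx]

/-! ### Concavity between the points of a grid -/

/-- `F` is concave on every interval with no point of `L` in its interior. -/
def CellConcave (L : Set ℝ) (F : ℝ → ℝ) : Prop :=
  ∀ a b, (∀ x ∈ L, ¬(a < x ∧ x < b)) → ConcaveOn ℝ (Set.Icc a b) F

namespace CellConcave

variable {L : Set ℝ}

theorem add {F G : ℝ → ℝ} (hF : CellConcave L F) (hG : CellConcave L G) :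
    CellConcave L fun z => F z + G z :=
  fun a b h => (hF a b h).add (hG a b h)

theorem affine (c s : ℝ) : CellConcave L fun z => c + s * z := fun a b _ =>
  ⟨convex_Icc a b, fun x _ y _ p q _ _ hpq => by
    simp only [smul_eq_mul]
    have : p * c + q * c = c := by rw [← add_mul, hpq, one_mul]
    linarith⟩

theorem sum {ι : Type*} {t : Finset ι} {F : ι → ℝ → ℝ} (h : ∀ i ∈ t, CellConcave L (F i)) :
    CellConcave L fun z => ∑ i ∈ t, F i z := by
  classical
  induction t using Finset.induction_on with
  | empty => simpa using affine 0 0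
  | insert a t ha ih =>
    simp only [Finset.sum_insert ha]
    exact (h a (by simp)).add (ih fun i hi => h i (by simp [hi]))

theorem congr_on {F : ℝ → ℝ} (h : ∀ a b, (∀ x ∈ L, ¬(a < x ∧ x < b)) →
    ∃ c s : ℝ, ∀ x ∈ Set.Icc a b, F x = c + s * x) : CellConcave L F := by
  intro a b hab
  obtain ⟨c, s, e⟩ := h a b hab
  exact (affine c s a b hab).congr fun x hx => (e x hx).symm

theorem hinge {b : ℝ} (hb : b ∈ L) (d : ℝ) : CellConcave L fun z => d * max (z - b) 0 := by
  refine congr_on fun a a' h => ?_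
  rcases le_or_gt b a with hba | hba
  · refine ⟨-(d * b), d, fun x hx => ?_⟩
    rw [max_eq_left (by linarith [hx.1])]; ring
  · have : a' ≤ b := not_lt.1 fun hlt => h b hb ⟨hba, hlt⟩
    refine ⟨0, 0, fun x hx => ?_⟩
    rw [max_eq_right (by linarith [hx.2])]; ring

theorem tv_of_mem {y : ℝ} (hy : y ∈ L) (w : ℝ) : CellConcave L fun z => tv w (y - z) := by
  refine congr_on fun a a' h => ?_
  rcases le_or_gt y a with hba | hba
  · refine ⟨-(w * y), w, fun x hx => ?_⟩
    rw [tv, abs_of_nonpos (by linarith [hx.1])]; ring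
  · have : a' ≤ y := not_lt.1 fun hlt => h y hy ⟨hba, hlt⟩
    refine ⟨w * y, -w, fun x hx => ?_⟩
    rw [tv, abs_of_nonneg (by linarith [hx.2])]; ring

theorem eval (S : PLSeq) (hS : ∀ q, S.bp q ∈ L) : CellConcave L S.eval := by
  have h : CellConcave L fun z => S.slope 0 * z := by simpa using affine 0 (S.slope 0)
  exact h.add (sum fun q _ => hinge (hS q) _)

/-- On a cell `[a, b]` the envelope is the minimum of `F` and the two lines of slopes `w` and `-w`
through its own values at `a` and `b`, hence concave. Indeed an apex outside the cell acts through
an endpoint, and for an apex inside the cell concavity moves it to `y` or to an endpoint. -/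
theorem message {F M : ℝ → ℝ} (hF : CellConcave L F) {w : ℝ} (hw : 0 ≤ w)
    (hM : ∀ y, IsLeast (Set.range fun z => F z + tv w (y - z)) (M y)) : CellConcave L M := by
  intro a b hab
  have lip : ∀ x y, M y ≤ M x + w * |y - x| := by
    intro x y
    obtain ⟨⟨z, e⟩, -⟩ := hM x
    have h1 := (hM y).2 ⟨z, rfl⟩
    simp only [tv] at e h1
    have h2 := abs_sub_le y x z
    nlinarith
  have aff : ∀ c s : ℝ, ConcaveOn ℝ (Set.Icc a b) fun z => c + s * z := fun c s => affine c s a b hab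
  have key := ((hF a b hab).inf (aff (M a - w * a) w)).inf (aff (M b + w * b) (-w))
  refine key.congr fun y hy => ?_
  obtain ⟨hay, hyb⟩ := hy
  simp only [Pi.inf_apply]
  apply le_antisymm
  · obtain ⟨⟨z, e⟩, -⟩ := hM y
    simp only [tv] at e
    -- A concave function plus a linear one is, between `u` and `v`, at least the smaller of its two
    -- end values.
    have interior : ∀ u v s : ℝ, a ≤ u → v ≤ b → u ≤ z → z ≤ v →
        min (F u + s * u) (F v + s * v) ≤ F z + s * z := by
      intro u v s h1 h2 h3 h4
      have hc : ConcaveOn ℝ (Set.Icc u v) fun z => F z + (0 + s * z) :=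
        ((hF u v fun x hx h => hab x hx ⟨by linarith, by linarith⟩).add
          (affine 0 s u v fun x hx h => hab x hx ⟨by linarith, by linarith⟩))
      have := hc.min_le_of_mem_Icc (Set.left_mem_Icc.2 (h3.trans h4))
        (Set.right_mem_Icc.2 (h3.trans h4)) ⟨h3, h4⟩
      simpa using this
    rw [← e]
    rcases le_total z y with hzy | hzy
    · rw [abs_of_nonneg (by linarith)]
      rcases le_total a z with haz | haz
      · have h1 := interior a y (-w) le_rfl hyb haz hzy
        have h2 := (hM a).2 ⟨a, rfl⟩
        simp only [tv, sub_self, abs_zero, mul_zero, add_zero] at h2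
        rcases min_le_iff.1 h1 with h3 | h3
        · exact ((min_le_left _ _).trans (min_le_right _ _)).trans (by linarith)
        · exact ((min_le_left _ _).trans (min_le_left _ _)).trans (by linarith)
      · have h2 := (hM a).2 ⟨z, rfl⟩
        simp only [tv] at h2
        rw [abs_of_nonneg (by linarith)] at h2
        exact ((min_le_left _ _).trans (min_le_right _ _)).trans (by linarith)
    · rw [abs_of_nonpos (by linarith)]
      rcases le_total z b with hzb | hzb
      · have h1 := interior y b w hay le_rfl hzy hzb
        have h2 := (hM b).2 ⟨b, rfl⟩
        simp only [tv, sub_self, abs_zero, mul_zero, add_zero] at h2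
        rcases min_le_iff.1 h1 with h3 | h3
        · exact ((min_le_left _ _).trans (min_le_left _ _)).trans (by linarith)
        · exact (min_le_right _ _).trans (by linarith)
      · have h2 := (hM b).2 ⟨z, rfl⟩
        simp only [tv] at h2
        rw [abs_of_nonpos (by linarith)] at h2
        exact (min_le_right _ _).trans (by linarith)
  · refine le_min (le_min ?_ ?_) ?_
    · have := (hM y).2 ⟨y, rfl⟩
      simpa [tv] using this
    · have := lip a y
      rw [abs_of_nonneg (by linarith)] at this
      linarith
    · have := lip b y
      rw [abs_of_nonpos (by linarith)] at this
      linarith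

/-- The minimum over the line is attained on the grid. -/
theorem exists_mem_le {Λ : Finset ℝ} (hne : Λ.Nonempty) {G : ℝ → ℝ}
    (hG : CellConcave (Λ : Set ℝ) G) {z : ℝ} (hz : ∀ u, G z ≤ G u) : ∃ x ∈ Λ, ∀ u, G x ≤ G u := by
  obtain ⟨x, hx, hmin⟩ := Λ.exists_min_image (fun x => |x - z|) hne
  refine ⟨x, hx, fun u => le_trans ?_ (hz u)⟩
  set d := |x - z| with hd
  -- No grid point is closer to `z` than `d`, so `G` is concave on this interval. Its midpoint is a
  -- global minimizer, hence both ends are minimizers too, and one of them is `x`. This treats the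
  -- unbounded cells as well.
  have hc := hG (z - d) (z + d) (by
    rintro y hy ⟨h1, h2⟩
    have h3 : d ≤ |y - z| := hmin y hy
    have : |y - z| < d := abs_lt.2 ⟨by linarith, by linarith⟩
    linarith)
  have hd0 : 0 ≤ d := abs_nonneg _
  have := hc.2 (Set.left_mem_Icc.2 (by linarith)) (Set.right_mem_Icc.2 (by linarith))
    (show (0 : ℝ) ≤ 1 / 2 by norm_num) (show (0 : ℝ) ≤ 1 / 2 by norm_num) (by norm_num)
  simp only [smul_eq_mul] at this
  rw [show 1 / 2 * (z - d) + 1 / 2 * (z + d) = z by ring] at this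
  have h1 := hz (z - d)
  have h2 := hz (z + d)
  rcases le_total 0 (x - z) with h | h
  · rw [abs_of_nonneg h] at hd
    rw [show x = z + d by linarith]
    linarith
  · rw [abs_of_nonpos h] at hd
    rw [show x = z - d by linarith]
    linarith

end CellConcave

/-! ### Depths and subtrees of a rooted tree -/

namespace RootedTree

variable {n : ℕ} (T : RootedTree n)

theorem iterate_parent_root (k : ℕ) : T.parent^[k] T.root = T.root :=
  Function.iterate_fixed T.parent_root k

theorem parent_eq_self_iff {i : Fin n} : T.parent i = i ↔ i = T.root := by
  refine ⟨fun h => ?_, fun h => by rw [h, T.parent_root]⟩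
  obtain ⟨k, hk⟩ := T.reaches_root i
  rwa [Function.iterate_fixed h] at hk

/-- The nodes on the path up to the first visit of the root are distinct, so there are at most `n`
of them; afterwards the iteration stays at the root. -/
theorem iterate_parent_pred (i : Fin n) : T.parent^[n - 1] i = T.root := by
  classical
  let d := Nat.find (T.reaches_root i)
  have hd : T.parent^[d] i = T.root := Nat.find_spec (T.reaches_root i)
  have hinj : Function.Injective fun k : Fin (d + 1) => T.parent^[k.val] i := by
    have aux : ∀ a b : ℕ, a < b → b ≤ d → T.parent^[a] i ≠ T.parent^[b] i := by
      intro a b hab hb e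
      have h1 : T.parent^[(d - b) + a] i = T.root := by
        rw [Function.iterate_add_apply, e, ← Function.iterate_add_apply, Nat.sub_add_cancel hb, hd]
      exact Nat.find_min (T.reaches_root i) (m := (d - b) + a) (by omega) h1
    intro a b e
    rcases lt_trichotomy a.val b.val with h | h | h
    · exact (aux _ _ h (by omega) e).elim
    · exact Fin.ext h
    · exact (aux _ _ h (by omega) e.symm).elim
  have := Fintype.card_le_of_injective _ hinj
  simp only [Fintype.card_fin] at this
  have h : T.parent^[(n - 1 - d) + d] i = T.root := by
    rw [Function.iterate_add_apply, hd, T.iterate_parent_root]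
  rwa [Nat.sub_add_cancel (by omega)] at h

theorem iterate_parent_card (i : Fin n) : T.parent^[n] i = T.root := by
  have h : T.parent^[n - 1 + 1] i = T.root := by
    rw [Function.iterate_succ_apply', T.iterate_parent_pred, T.parent_root]
  rwa [Nat.sub_add_cancel i.pos] at h

/-- The number of edges on the path from `i` to the root. -/
def depth (i : Fin n) : ℕ :=
  ((Finset.range n).filter fun k => T.parent^[k] i ≠ T.parent^[k + 1] i).card

theorem depth_root : T.depth T.root = 0 := by
  rw [depth, Finset.card_eq_zero, Finset.filter_eq_empty_iff]
  intro k _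
  simp only [T.iterate_parent_root, ne_eq, not_true, not_false_eq_true]

theorem depth_le (i : Fin n) : T.depth i ≤ n := by
  exact (Finset.card_filter_le (Finset.range n) _).trans_eq (Finset.card_range n)

theorem depth_lt (i : Fin n) : T.depth i < n := by
  have h : T.depth i ≤ (Finset.range (n - 1)).card := by
    refine Finset.card_le_card fun k hk => ?_
    rw [Finset.mem_filter, Finset.mem_range] at hk
    rw [Finset.mem_range]
    by_contra hlt
    have e : k = n - 1 := by omega
    rw [e, Function.iterate_succ_apply', T.iterate_parent_pred, T.parent_root] at hk
    exact hk.2 rfl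
  rw [Finset.card_range] at h
  have := i.pos
  omega

theorem depth_eq {i : Fin n} (hi : i ≠ T.root) : T.depth i = T.depth (T.parent i) + 1 := by
  obtain ⟨m, rfl⟩ : ∃ m, n = m + 1 := ⟨n - 1, by have := i.isLt; omega⟩
  -- The path from the parent is the path from `i` shifted by one. The first step is split off from
  -- the count for `i`, and the last step from the count for the parent, where it is `0` because the
  -- root has been reached.
  rw [depth, depth, Finset.card_filter, Finset.card_filter, Finset.sum_range_succ',
    Finset.sum_range_succ _ m]
  have h1 : T.parent^[m] (T.parent i) = T.root := T.iterate_parent_card i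
  have h2 : T.parent^[m + 1] (T.parent i) = T.root := T.iterate_parent_card _
  have h3 : T.parent^[0] i ≠ T.parent^[0 + 1] i := fun e => hi (T.parent_eq_self_iff.1 e.symm)
  simp only [h1, h2, h3, ne_eq, not_true, not_false_eq_true, if_true, if_false, add_zero]
  rfl

theorem depth_pos {i : Fin n} (hi : i ≠ T.root) : 0 < T.depth i := by
  rw [T.depth_eq hi]; omega

theorem depth_iterate_le (k : ℕ) (i : Fin n) : T.depth (T.parent^[k] i) ≤ T.depth i := by
  induction k generalizing i with
  | zero => exact le_rfl
  | succ k ih =>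
    rw [Function.iterate_succ_apply]
    refine (ih _).trans ?_
    by_cases hi : i = T.root
    · rw [hi, T.parent_root]
    · rw [T.depth_eq hi]; omega

theorem mem_children {i k : Fin n} : k ∈ T.children i ↔ k ≠ T.root ∧ T.parent k = i := by
  simp [children]

theorem depth_child {i k : Fin n} (h : k ∈ T.children i) : T.depth k = T.depth i + 1 := by
  rw [mem_children] at h
  rw [T.depth_eq h.1, h.2]

theorem induction_children {P : Fin n → Prop} (h : ∀ i, (∀ k ∈ T.children i, P k) → P i) :
    ∀ i, P i := by
  suffices ∀ m i, n - T.depth i ≤ m → P i from fun i => this _ i le_rfl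
  intro m
  induction m with
  | zero =>
    refine fun i hi => h i fun k hk => ?_
    have := T.depth_child hk
    have := T.depth_le k
    omega
  | succ m ih =>
    refine fun i hi => h i fun k hk => ih k ?_
    have := T.depth_child hk
    omega

theorem mem_subtree {i v : Fin n} : v ∈ T.subtree i ↔ ∃ k : ℕ, T.parent^[k] v = i := by
  simp [subtree]

theorem card_subtree (i : Fin n) :
    1 + ∑ k ∈ T.children i, (T.subtree k).card ≤ (T.subtree i).card := by
  classical
  have hdisj : (T.children i : Set (Fin n)).PairwiseDisjoint T.subtree := by
    -- If a path from `v` met two different children of `i`, it would pass through `i` in between,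
    -- so the later child would be no deeper than `i`.
    have aux : ∀ k ∈ T.children i, ∀ k' ∈ T.children i, ∀ v a b, T.parent^[a] v = k →
        T.parent^[b] v = k' → a ≤ b → k = k' := by
      intro k hk k' hk' v a b ha hb hab
      obtain ⟨c, rfl⟩ := Nat.exists_eq_add_of_le hab
      cases c with
      | zero => rw [← ha, ← hb, Nat.add_zero]
      | succ c =>
        exfalso
        rw [show a + (c + 1) = c + 1 + a by omega, Function.iterate_add_apply, ha,
          Function.iterate_succ_apply, (T.mem_children.1 hk).2] at hb
        have := T.depth_iterate_le c i
        rw [hb, T.depth_child hk'] at this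
        omega
    intro k hk k' hk' hne
    rw [Function.onFun, Finset.disjoint_left]
    intro v hv hv'
    obtain ⟨a, ha⟩ := T.mem_subtree.1 hv
    obtain ⟨b, hb⟩ := T.mem_subtree.1 hv'
    rcases le_total a b with h | h
    · exact hne (aux k hk k' hk' v a b ha hb h)
    · exact hne (aux k' hk' k hk v b a hb ha h).symm
  rw [← Finset.card_biUnion hdisj, add_comm, ← Finset.card_insert_of_notMem (a := i)]
  · refine Finset.card_le_card fun v hv => ?_
    rcases Finset.mem_insert.1 hv with rfl | hv
    · exact T.mem_subtree.2 ⟨0, rfl⟩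
    · obtain ⟨k, hk, hv⟩ := Finset.mem_biUnion.1 hv
      obtain ⟨a, ha⟩ := T.mem_subtree.1 hv
      refine T.mem_subtree.2 ⟨a + 1, ?_⟩
      rw [Function.iterate_succ_apply', ha, (T.mem_children.1 hk).2]
  · intro h
    obtain ⟨k, hk, hi⟩ := Finset.mem_biUnion.1 h
    obtain ⟨a, ha⟩ := T.mem_subtree.1 hi
    have := T.depth_iterate_le a i
    rw [ha, T.depth_child hk] at this
    omega

end RootedTree

/-! ### Existence of the messages -/

section Messages

variable {n : ℕ} (T : RootedTree n) (w : Fin n → ℝ) (f : Fin n → ℝ → ℝ)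

/-- The message of the edge from `i` to its parent, as an infimum. -/
noncomputable def edgeMsg (i : Fin n) (y : ℝ) : ℝ :=
  ⨅ z, (f i z + ∑ k ∈ (T.children i).attach, edgeMsg k.1 z) + tv (w i) (y - z)
termination_by n - T.depth i
decreasing_by
  have := T.depth_child k.2
  have := T.depth_le k.1
  omega

/-- The message of the node `i`. -/
noncomputable def nodeMsg (i : Fin n) (z : ℝ) : ℝ := f i z + ∑ k ∈ T.children i, edgeMsg T w f k z

theorem edgeMsg_eq (i : Fin n) (y : ℝ) :
    edgeMsg T w f i y = ⨅ z, nodeMsg T w f i z + tv (w i) (y - z) := by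
  rw [edgeMsg]
  congr 1
  funext z
  rw [nodeMsg, Finset.sum_attach (T.children i) fun k => edgeMsg T w f k z]

/-- A real infimum over a set that is not bounded below has the default value `0`, so `edgeMsg` is
meaningful only where a least element is known to exist. -/
theorem edgeMsg_eq_of_isLeast {i : Fin n} {y m : ℝ}
    (h : IsLeast (Set.range fun z => nodeMsg T w f i z + tv (w i) (y - z)) m) :
    edgeMsg T w f i y = m := by
  rw [edgeMsg_eq, iInf, h.csInf_eq]

/-! ### Elimination of the nodes, deepest first -/

/-- The objective after the elimination of the nodes in `D`. -/
noncomputable def reduced (D : Finset (Fin n)) (x : Fin n → ℝ) : ℝ :=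
  ∑ v ∈ Dᶜ, (f v (x v) + if v = T.root then 0 else tv (w v) (x (T.parent v) - x v)) +
    ∑ k ∈ D, if T.parent k ∈ D then 0 else edgeMsg T w f k (x (T.parent k))

theorem reduced_empty (x : Fin n → ℝ) : reduced T w f ∅ x = objective T w f x := by
  rw [reduced, objective, Finset.sum_empty, add_zero, Finset.compl_empty, Finset.sum_add_distrib,
    Finset.sum_filter]
  congr 1
  refine Finset.sum_congr rfl fun v _ => ?_
  by_cases h : v = T.root <;> simp [h]

theorem reduced_root (x : Fin n → ℝ) :
    reduced T w f (Finset.univ.erase T.root) x = nodeMsg T w f T.root (x T.root) := by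
  have h1 : (Finset.univ.erase T.root)ᶜ = {T.root} := by ext; simp
  rw [reduced, nodeMsg, h1, Finset.sum_singleton, if_pos rfl, add_zero]
  congr 1
  have h2 : T.children T.root = (Finset.univ.erase T.root).filter fun k => T.parent k = T.root := by
    ext k; simp [T.mem_children]
  rw [h2, Finset.sum_filter]
  refine Finset.sum_congr rfl fun k _ => ?_
  by_cases h : T.parent k = T.root <;> simp [h]

/-- The part of the reduced objective that does not involve the next node `i`. -/
noncomputable def reducedRest (D : Finset (Fin n)) (i : Fin n) (x : Fin n → ℝ) : ℝ :=
  ∑ v ∈ (insert i D)ᶜ, (f v (x v) + if v = T.root then 0 else tv (w v) (x (T.parent v) - x v)) +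
    ∑ k ∈ D, if T.parent k ∈ insert i D then 0 else edgeMsg T w f k (x (T.parent k))

variable {T w f} {D : Finset (Fin n)} {i : Fin n}

/-- Once all children of `i` are eliminated, their edges are represented by their messages, which
together with `f i` form the message of the node; only the edge to the parent is left. -/
theorem reduced_eq (hi : i ∉ D) (hir : i ≠ T.root) (hr : T.root ∉ D) (hc : T.children i ⊆ D)
    (x : Fin n → ℝ) :
    reduced T w f D x =
      reducedRest T w f D i x + (nodeMsg T w f i (x i) + tv (w i) (x (T.parent i) - x i)) := by
  have h1 : Dᶜ = insert i (insert i D)ᶜ := by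
    ext v
    simp only [Finset.mem_compl, Finset.mem_insert, not_or]
    by_cases h : v = i
    · simp [h, hi]
    · simp [h]
  have h2 : T.children i = D.filter fun k => T.parent k = i := by
    ext k
    simp only [Finset.mem_filter]
    refine ⟨fun h => ⟨hc h, (T.mem_children.1 h).2⟩, fun h => T.mem_children.2 ⟨?_, h.2⟩⟩
    rintro rfl
    exact hr h.1
  have h3 : ∑ k ∈ D, (if T.parent k ∈ D then 0 else edgeMsg T w f k (x (T.parent k)))
      = ∑ k ∈ D, (if T.parent k ∈ insert i D then 0 else edgeMsg T w f k (x (T.parent k)))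
        + ∑ k ∈ T.children i, edgeMsg T w f k (x i) := by
    rw [h2, Finset.sum_filter, ← Finset.sum_add_distrib]
    refine Finset.sum_congr rfl fun k _ => ?_
    by_cases h : T.parent k = i
    · simp [h, hi]
    · simp [h]
  rw [reduced, reducedRest, h1, Finset.sum_insert (by simp), h3, nodeMsg, if_neg hir]
  ring

theorem reduced_insert (hi : i ∉ D) (hp : T.parent i ∉ insert i D) (x : Fin n → ℝ) :
    reduced T w f (insert i D) x =
      reducedRest T w f D i x + edgeMsg T w f i (x (T.parent i)) := by
  rw [reduced, reducedRest, Finset.sum_insert hi, if_neg hp]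
  ring

theorem reducedRest_congr (hc : T.children i ⊆ D) {x y : Fin n → ℝ} (h : ∀ v, v ≠ i → x v = y v) :
    reducedRest T w f D i x = reducedRest T w f D i y := by
  rw [reducedRest, reducedRest]
  congr 1
  · refine Finset.sum_congr rfl fun v hv => ?_
    simp only [Finset.mem_compl, Finset.mem_insert, not_or] at hv
    rw [h v hv.1]
    by_cases hvr : v = T.root
    · simp [hvr]
    · rw [h (T.parent v) fun e => hv.2 (hc (T.mem_children.2 ⟨hvr, e⟩))]
  · refine Finset.sum_congr rfl fun k _ => ?_
    split_ifs with hk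
    · rfl
    · rw [h _ fun e => hk (by simp [e])]

theorem isAtomic_nodeMsg {K : ℕ} (hf : ∀ i, IsAtomic K (f i))
    (h : ∀ k ∈ T.children i, IsAtomic (K * (T.subtree k).card) (edgeMsg T w f k)) :
    IsAtomic (K * (T.subtree i).card) (nodeMsg T w f i) := by
  refine ((hf i).add (IsAtomic.sum h)).mono ?_
  rw [← Finset.mul_sum]
  calc K + K * ∑ k ∈ T.children i, (T.subtree k).card
      = K * (1 + ∑ k ∈ T.children i, (T.subtree k).card) := by ring
    _ ≤ _ := Nat.mul_le_mul_left _ (T.card_subtree i)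

/-- The claims have to be proved together. A message exists only if its envelope is bounded below,
and the bound comes from points `x'` that realize the reduced objective, built from the messages
that exist already. The last claim says that the reduction is exact when all eliminated coordinates
attain their messages. -/
theorem elimination {K : ℕ} (hw : ∀ i, i ≠ T.root → 0 ≤ w i) (hf : ∀ i, IsAtomic K (f i))
    (hmin : ∃ x, IsMinimizer T w f x) (D : Finset (Fin n)) :
    T.root ∉ D → (∀ i ∈ D, T.children i ⊆ D) →
    (∀ i ∈ D, IsAtomic (K * (T.subtree i).card) (edgeMsg T w f i) ∧
      ∀ y, IsLeast (Set.range fun z => nodeMsg T w f i z + tv (w i) (y - z)) (edgeMsg T w f i y)) ∧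
    (∀ x, ∃ x', (∀ v, v ∉ D → x' v = x v) ∧ objective T w f x' = reduced T w f D x) ∧
    (∀ x, reduced T w f D x ≤ objective T w f x) ∧
    (∀ x, (∀ i ∈ D, edgeMsg T w f i (x (T.parent i)) =
        nodeMsg T w f i (x i) + tv (w i) (x (T.parent i) - x i)) →
      objective T w f x = reduced T w f D x) := by
  classical
  obtain ⟨xmin, hxmin⟩ := hmin
  induction D using Finset.induction_on_min_value T.depth with
  | empty =>
    intro _ _
    refine ⟨by simp, fun x => ⟨x, fun _ _ => rfl, (reduced_empty T w f x).symm⟩,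
      fun x => (reduced_empty T w f x).le, fun x _ => (reduced_empty T w f x).symm⟩
  | insert i D hi hmin ih =>
    intro hr hc
    have hir : i ≠ T.root := fun e => hr (by simp [e])
    have hrD : T.root ∉ D := fun h => hr (by simp [h])
    have hcD : ∀ k ∈ D, T.children k ⊆ D := by
      intro k hk v hv
      rcases Finset.mem_insert.1 (hc k (by simp [hk]) hv) with rfl | h
      · have := T.depth_child hv
        have := hmin k hk
        omega
      · exact h
    have hci : T.children i ⊆ D := by
      intro v hv
      rcases Finset.mem_insert.1 (hc i (by simp) hv) with rfl | h
      · have := T.depth_child hv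
        omega
      · exact h
    have hp : T.parent i ∉ insert i D := by
      intro h
      have hd := T.depth_eq hir
      rcases Finset.mem_insert.1 h with h | h
      · rw [h] at hd; omega
      · have := hmin _ h; omega
    have hpi : T.parent i ≠ i := fun h => hp (by simp [h])
    obtain ⟨h1, h2, h3, h4⟩ := ih hrD hcD
    have hnode : IsAtomic (K * (T.subtree i).card) (nodeMsg T w f i) :=
      isAtomic_nodeMsg hf fun k hk => (h1 k (hci hk)).1
    -- All coordinates other than `i` that remain are fixed at `0`, the parent's included, whence
    -- `y₀ = 0`. Subtracting the part that does not involve `i` from the minimum of the objective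
    -- leaves the lower bound.
    obtain ⟨M, hMa, hMl⟩ := hnode.exists_message (hw i hir) (y₀ := 0)
      (B := objective T w f xmin - reducedRest T w f D i fun _ => 0) (by
        intro z
        obtain ⟨x', -, hx'⟩ := h2 (Function.update (fun _ => 0) i z)
        have h5 := hxmin x'
        rw [hx', reduced_eq hi hir hrD hci, Function.update_self, Function.update_of_ne hpi,
          reducedRest_congr hci (y := fun _ => 0) fun v hv => Function.update_of_ne hv _ _] at h5
        linarith)
    have hMe : edgeMsg T w f i = M := funext fun y => edgeMsg_eq_of_isLeast T w f (hMl y)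
    refine ⟨?_, fun x => ?_, fun x => ?_, fun x hx => ?_⟩
    · intro k hk
      rcases Finset.mem_insert.1 hk with rfl | hk
      · rw [hMe]; exact ⟨hMa, hMl⟩
      · exact h1 k hk
    · obtain ⟨⟨z, hz⟩, -⟩ := hMl (x (T.parent i))
      obtain ⟨x', hx'1, hx'2⟩ := h2 (Function.update x i z)
      refine ⟨x', fun v hv => ?_, ?_⟩
      · simp only [Finset.mem_insert, not_or] at hv
        rw [hx'1 v hv.2, Function.update_of_ne hv.1]
      · rw [hx'2, reduced_eq hi hir hrD hci, reduced_insert hi hp, Function.update_self,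
          Function.update_of_ne hpi, hMe, ← hz,
          reducedRest_congr hci (y := x) fun v hv => Function.update_of_ne hv _ _]
    · refine le_trans ?_ (h3 x)
      rw [reduced_eq hi hir hrD hci, reduced_insert hi hp, hMe]
      have := (hMl (x (T.parent i))).2 ⟨x i, rfl⟩
      simp only at this
      linarith
    · rw [h4 x fun k hk => hx k (by simp [hk]), reduced_eq hi hir hrD hci,
        reduced_insert hi hp, hx i (by simp)]

variable {K : ℕ}

theorem edgeMsg_spec (hw : ∀ i, i ≠ T.root → 0 ≤ w i) (hf : ∀ i, IsAtomic K (f i))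
    (hmin : ∃ x, IsMinimizer T w f x) (hi : i ≠ T.root) :
    IsAtomic (K * (T.subtree i).card) (edgeMsg T w f i) ∧
      ∀ y, IsLeast (Set.range fun z => nodeMsg T w f i z + tv (w i) (y - z))
        (edgeMsg T w f i y) :=
  (elimination hw hf hmin (Finset.univ.erase T.root) (by simp)
    (fun _ _ k hk => by simpa using (T.mem_children.1 hk).1)).1 i (by simpa using hi)

theorem isMessages (hw : ∀ i, i ≠ T.root → 0 ≤ w i) (hf : ∀ i, IsAtomic K (f i))
    (hmin : ∃ x, IsMinimizer T w f x) :
    IsMessages T w f (nodeMsg T w f) (edgeMsg T w f) :=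
  ⟨fun _ _ => rfl, fun _ hi => (edgeMsg_spec hw hf hmin hi).2⟩

theorem isAtomic_nodeMsg' (hw : ∀ i, i ≠ T.root → 0 ≤ w i) (hf : ∀ i, IsAtomic K (f i))
    (hmin : ∃ x, IsMinimizer T w f x) (i : Fin n) :
    IsAtomic (K * (T.subtree i).card) (nodeMsg T w f i) :=
  isAtomic_nodeMsg hf fun _ hk => (edgeMsg_spec hw hf hmin (T.mem_children.1 hk).1).1

theorem exists_root_min (hw : ∀ i, i ≠ T.root → 0 ≤ w i) (hf : ∀ i, IsAtomic K (f i))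
    (hmin : ∃ x, IsMinimizer T w f x) :
    ∃ x, ∀ z, nodeMsg T w f T.root x ≤ nodeMsg T w f T.root z := by
  obtain ⟨-, h2, -, -⟩ := elimination hw hf hmin (Finset.univ.erase T.root) (by simp)
    (fun _ _ k hk => by simpa using (T.mem_children.1 hk).1)
  obtain ⟨xmin, hxmin⟩ := hmin
  refine (isAtomic_nodeMsg' hw hf ⟨xmin, hxmin⟩ T.root).exists_forall_le
    (B := objective T w f xmin) fun z => ?_
  obtain ⟨x', -, hx'⟩ := h2 fun _ => z
  rw [reduced_root] at hx'
  rw [← hx']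
  exact hxmin x'

/-- Along a backward pass every elimination is tight, so the objective equals the least value of the
root message, which bounds the objective from below everywhere. -/
theorem IsBackwardPass.isMinimizer (hw : ∀ i, i ≠ T.root → 0 ≤ w i)
    (hf : ∀ i, IsAtomic K (f i)) (hmin : ∃ x, IsMinimizer T w f x) {x : Fin n → ℝ}
    (hx : IsBackwardPass T w (nodeMsg T w f) x) : IsMinimizer T w f x := by
  obtain ⟨h1, h2, h3, h4⟩ := elimination hw hf hmin (Finset.univ.erase T.root) (by simp)
    (fun _ _ k hk => by simpa using (T.mem_children.1 hk).1)
  intro y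
  rw [h4 x, reduced_root]
  · have := h3 y
    rw [reduced_root] at this
    exact (hx.root _).trans this
  · intro i hi
    refine edgeMsg_eq_of_isLeast T w f ⟨⟨x i, rfl⟩, ?_⟩
    rintro _ ⟨z, rfl⟩
    exact hx.edge i (by simpa using hi) z

/-- One grid serves all nodes, although the breakpoints of the messages need not lie on it: those
inside a cell are concave kinks. -/
theorem cellConcave_nodeMsg {L : Set ℝ} (hw : ∀ i, i ≠ T.root → 0 ≤ w i)
    (hf : ∀ i, IsAtomic K (f i)) (hmin : ∃ x, IsMinimizer T w f x)
    (hL : ∀ i, CellConcave L (f i)) : ∀ i, CellConcave L (nodeMsg T w f i) := by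
  refine T.induction_children fun i ih => (hL i).add (CellConcave.sum fun k hk => ?_)
  have hk' := (T.mem_children.1 hk).1
  exact (ih k hk).message (hw k hk') (edgeMsg_spec hw hf hmin hk').2

/-- The minimum in the update of a message is attained on the grid. -/
theorem exists_mem_edgeMsg_eq {Λ : Finset ℝ} (hw : ∀ i, i ≠ T.root → 0 ≤ w i)
    (hf : ∀ i, IsAtomic K (f i)) (hmin : ∃ x, IsMinimizer T w f x)
    (hL : ∀ i, CellConcave (Λ : Set ℝ) (f i)) (hi : i ≠ T.root) {y : ℝ} (hy : y ∈ Λ) :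
    ∃ z ∈ Λ, edgeMsg T w f i y = nodeMsg T w f i z + tv (w i) (y - z) := by
  obtain ⟨⟨z₀, e⟩, h⟩ := (edgeMsg_spec hw hf hmin hi).2 y
  simp only at e
  obtain ⟨z, hz, hmin'⟩ := CellConcave.exists_mem_le ⟨y, hy⟩
    ((cellConcave_nodeMsg hw hf hmin hL i).add (CellConcave.tv_of_mem hy (w i))) (z := z₀)
    fun u => by rw [e]; exact h ⟨u, rfl⟩
  refine ⟨z, hz, le_antisymm (h ⟨z, rfl⟩) ?_⟩
  rw [← e]
  exact hmin' z₀

theorem exists_mem_root_min {Λ : Finset ℝ} (hne : Λ.Nonempty) (hw : ∀ i, i ≠ T.root → 0 ≤ w i)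
    (hf : ∀ i, IsAtomic K (f i)) (hmin : ∃ x, IsMinimizer T w f x)
    (hL : ∀ i, CellConcave (Λ : Set ℝ) (f i)) :
    ∃ x ∈ Λ, ∀ z, nodeMsg T w f T.root x ≤ nodeMsg T w f T.root z := by
  obtain ⟨z, hz⟩ := exists_root_min hw hf hmin
  exact CellConcave.exists_mem_le hne (cellConcave_nodeMsg hw hf hmin hL _) hz

/-- A backward pass over the grid is a backward pass. -/
theorem isBackwardPass_of_grid {Λ : Finset ℝ} (hw : ∀ i, i ≠ T.root → 0 ≤ w i)
    (hf : ∀ i, IsAtomic K (f i)) (hmin : ∃ x, IsMinimizer T w f x)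
    (hL : ∀ i, CellConcave (Λ : Set ℝ) (f i)) {x : Fin n → ℝ} (hx : ∀ i, x i ∈ Λ)
    (hroot : ∀ z ∈ Λ, nodeMsg T w f T.root (x T.root) ≤ nodeMsg T w f T.root z)
    (hedge : ∀ i, i ≠ T.root → ∀ z ∈ Λ,
      nodeMsg T w f i (x i) + tv (w i) (x (T.parent i) - x i) ≤
        nodeMsg T w f i z + tv (w i) (x (T.parent i) - z)) :
    IsBackwardPass T w (nodeMsg T w f) x := by
  refine ⟨fun z => ?_, fun i hi z => ?_⟩
  · obtain ⟨u, hu, h⟩ := exists_mem_root_min ⟨_, hx T.root⟩ hw hf hmin hL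
    exact (hroot u hu).trans (h z)
  · obtain ⟨u, hu, h⟩ := exists_mem_edgeMsg_eq hw hf hmin hL hi (hx (T.parent i))
    refine (hedge i hi u hu).trans ?_
    rw [← h]
    exact ((edgeMsg_spec hw hf hmin hi).2 _).2 ⟨z, rfl⟩

end Messages

/-! ### Hoare triples with time bounds -/

/-- Started in a state that fits in space `s`, the program halts within `X` steps and within space
`s` in a state that satisfies `Q`. -/
def Tr (s : ℕ) (P : Program) (σ : State) (X : ℕ) (Q : State → Prop) : Prop :=
  σ.FitsIn s → ∃ τ ≤ X, ∃ σ', Exec s P σ τ σ' ∧ σ'.FitsIn s ∧ Q σ'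

/-- The side condition under which an operation preserves the space bound `s`. -/
def Op.Ok (s : ℕ) (o : Op) (σ : State) : Prop :=
  match o with
  | .nconst _ c => c < s
  | .nadd _ a b => σ.nreg a + σ.nreg b < s
  | .nmul _ a b => σ.nreg a * σ.nreg b < s
  | _ => True

theorem Op.fitsIn_apply {s : ℕ} {o : Op} {σ : State} (h : σ.FitsIn s) (ho : o.Ok s σ) :
    (o.apply σ).FitsIn s := by
  have upd : ∀ {g : ℕ → ℕ} {d c : ℕ}, (∀ a, g a < s) → c < s →
      ∀ a, Function.update g d c a < s := by
    intro g d c hg hc a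
    by_cases e : a = d
    · rw [e, Function.update_self]; exact hc
    · rw [Function.update_of_ne e]; exact hg a
  obtain ⟨h1, h2, h3, h4⟩ := h
  cases o <;> simp only [Op.apply, Op.Ok] at ho ⊢
  case nstore a b =>
    refine ⟨h1, upd h2 (h1 b), fun c hc => ?_, h4⟩
    exact (Function.update_of_ne (by have := h1 a; omega) _ _).trans (h3 c hc)
  case rstore a b =>
    refine ⟨h1, h2, h3, fun c hc => ?_⟩
    exact (Function.update_of_ne (by have := h1 a; omega) _ _).trans (h4 c hc)
  all_goals first
    | exact ⟨h1, h2, h3, h4⟩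
    | exact ⟨upd h1 (by first | exact ho | exact h1 _ | exact h2 _ |
        exact (Nat.sub_le _ _).trans_lt (h1 _)), h2, h3, h4⟩

/-- A sequence of operations as a program. -/
def blk : List Op → Program
  | [] => .skip
  | o :: l => .seq (.op o) (blk l)

/-- The effect of a sequence of operations. -/
noncomputable def runOps : List Op → State → State
  | [], σ => σ
  | o :: l, σ => runOps l (o.apply σ)

/-- The side condition under which a sequence of operations preserves the space bound `s`. -/
def OpsOk (s : ℕ) : List Op → State → Prop
  | [], _ => True
  | o :: l, σ => o.Ok s σ ∧ OpsOk s l (o.apply σ)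

section Rules

variable {s X Y : ℕ} {σ : State} {P R : Program} {Q Q' : State → Prop}

theorem Tr.weaken (h : Tr s P σ X Q) (hX : X ≤ Y) (hQ : ∀ σ', Q σ' → Q' σ') :
    Tr s P σ Y Q' := by
  intro hσ
  obtain ⟨τ, hτ, σ', h1, h2, h3⟩ := h hσ
  exact ⟨τ, hτ.trans hX, σ', h1, h2, hQ _ h3⟩

theorem Tr.le (h : Tr s P σ X Q) (hX : X ≤ Y) : Tr s P σ Y Q := h.weaken hX fun _ h => h

theorem tr_skip (h : Q σ) : Tr s .skip σ 1 Q := fun hσ => ⟨1, le_rfl, σ, .skip σ, hσ, h⟩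

theorem tr_seq (h : Tr s P σ X fun σ' => Tr s R σ' Y Q) : Tr s (.seq P R) σ (X + Y) Q := by
  intro hσ
  obtain ⟨τ, hτ, σ', h1, h2, h3⟩ := h hσ
  obtain ⟨τ', hτ', σ'', h1', h2', h3'⟩ := h3 h2
  exact ⟨τ + τ', by omega, σ'', .seq h1 h1', h2', h3'⟩

theorem Tr.seq (h : Tr s P σ X Q') (h' : ∀ σ', Q' σ' → Tr s R σ' Y Q) :
    Tr s (.seq P R) σ (X + Y) Q :=
  tr_seq (h.weaken le_rfl h')

theorem tr_blk {l : List Op} (hok : OpsOk s l σ) (hQ : Q (runOps l σ)) :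
    Tr s (blk l) σ (l.length + 1) Q := by
  induction l generalizing σ with
  | nil => exact tr_skip hQ
  | cons o l ih =>
    intro hσ
    have h1 := Op.fitsIn_apply hσ hok.1
    obtain ⟨τ, hτ, σ', h2, h3, h4⟩ := ih hok.2 hQ h1
    exact ⟨1 + τ, by simp; omega, σ', .seq (.op o σ h1) h2, h3, h4⟩

theorem tr_ite {b : Test} (h1 : b.Holds σ → Tr s P σ X Q) (h2 : ¬b.Holds σ → Tr s R σ X Q) :
    Tr s (.ite b P R) σ (X + 1) Q := by
  intro hσ
  by_cases hb : b.Holds σ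
  · obtain ⟨τ, hτ, σ', h3, h4, h5⟩ := h1 hb hσ
    exact ⟨τ + 1, by omega, σ', .iteTrue hb h3, h4, h5⟩
  · obtain ⟨τ, hτ, σ', h3, h4, h5⟩ := h2 hb hσ
    exact ⟨τ + 1, by omega, σ', .iteFalse hb h3, h4, h5⟩

/-- Runs `P` if the integer registers `a` and `b` agree. -/
def ifEq (a b : ℕ) (P : Program) : Program := .ite (.nlt a b) .skip (.ite (.nlt b a) .skip P)

/-- The cost keeps the two outcomes apart, because the passes over the tree run the test `n * n`
times but succeed at most `n` times. -/
theorem tr_ifEq {a b : ℕ} (h1 : σ.nreg a = σ.nreg b → Tr s P σ X Q)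
    (h2 : σ.nreg a ≠ σ.nreg b → Q σ) :
    Tr s (ifEq a b P) σ ((if σ.nreg a = σ.nreg b then X else 1) + 2) Q := by
  by_cases h : σ.nreg a = σ.nreg b
  · rw [if_pos h]
    exact tr_ite (fun hb => absurd h (Nat.ne_of_lt hb)) fun _ =>
      tr_ite (fun hb => absurd h.symm (Nat.ne_of_lt hb)) fun _ => h1 h
  · rw [if_neg h]
    exact tr_ite (fun _ => (tr_skip (h2 h)).le (by omega)) fun _ =>
      (tr_ite (fun _ => tr_skip (h2 h)) fun hb => by
        simp only [Test.Holds] at *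
        omega)

/-- Runs `P` with the integer register `c` counting from `0` to the content of the register `m`;
the register `1` has to hold the number `1`. -/
def forN (c m : ℕ) (P : Program) : Program :=
  .seq (.op (.nconst c 0)) (.loop (.nlt c m) (.seq P (.op (.nadd c c 1))))

/-- The state with the integer register `c` set to `k`. -/
def State.setN (σ : State) (c k : ℕ) : State := { σ with nreg := Function.update σ.nreg c k }

/-- The invariant refers to the state after the counter has been set. Each round adds the increment
and the test to its cost, and the final `2` stands for the initialization and the failing test. -/
theorem tr_forN {c m M : ℕ} {cost : ℕ → ℕ} (I : ℕ → State → Prop) (hMs : M < s)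
    (h0 : I 0 (σ.setN c 0))
    (hreg : ∀ k σ, k ≤ M → I k σ → σ.nreg c = k ∧ σ.nreg m = M)
    (hstep : ∀ k σ, k < M → I k σ →
      Tr s P σ (cost k) fun σ' => σ'.nreg c = k ∧ σ'.nreg 1 = 1 ∧ I (k + 1) (σ'.setN c (k + 1)))
    (hQ : ∀ σ, I M σ → Q σ) :
    Tr s (forN c m P) σ (∑ k ∈ Finset.range M, (cost k + 2) + 2) Q := by
  have main : ∀ j k, k + j = M → ∀ σ, I k σ →
      Tr s (.loop (.nlt c m) (.seq P (.op (.nadd c c 1)))) σ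
        (∑ i ∈ Finset.Ico k M, (cost i + 2) + 1) Q := by
    intro j
    induction j with
    | zero =>
      intro k hk σ hI hσ
      obtain ⟨h1, h2⟩ := hreg k σ (by omega) hI
      refine ⟨1, by omega, σ, .loopFalse ?_, hσ, hQ σ (by rwa [← show k = M by omega])⟩
      simp only [Test.Holds]
      omega
    | succ j ih =>
      intro k hk σ hI hσ
      obtain ⟨h1, h2⟩ := hreg k σ (by omega) hI
      obtain ⟨τ, hτ, σ', h3, h4, h5, h6, h7⟩ := hstep k σ (by omega) hI hσ
      have e : (Op.nadd c c 1).apply σ' = σ'.setN c (k + 1) := by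
        simp [Op.apply, State.setN, h5, h6]
      have hfit : ((Op.nadd c c 1).apply σ').FitsIn s :=
        Op.fitsIn_apply h4 (by simp only [Op.Ok, h5, h6]; omega)
      obtain ⟨τ', hτ', σ'', h8, h9, h10⟩ := ih (k + 1) (by omega) _ h7 (e ▸ hfit)
      refine ⟨(τ + 1) + τ' + 1, ?_, σ'',
        .loopTrue (by simp only [Test.Holds]; omega) (.seq h3 (.op _ _ hfit)) (e ▸ h8), h9, h10⟩
      rw [Finset.sum_eq_sum_Ico_succ_bot (show k < M by omega)]
      omega
  intro hσ
  have hfit : ((Op.nconst c 0).apply σ).FitsIn s :=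
    Op.fitsIn_apply hσ (by simp only [Op.Ok]; omega)
  obtain ⟨τ, hτ, σ', h1, h2, h3⟩ := main M 0 (by omega) _ h0 hfit
  rw [Finset.range_eq_Ico]
  exact ⟨1 + τ, by omega, σ', .seq (.op _ _ hfit) h1, h2, h3⟩

/-- `tr_forN` with a uniform bound on the cost of the iterations. -/
theorem tr_forN' {c m M X : ℕ} (I : ℕ → State → Prop) (hMs : M < s)
    (h0 : I 0 (σ.setN c 0))
    (hreg : ∀ k σ, k ≤ M → I k σ → σ.nreg c = k ∧ σ.nreg m = M)
    (hstep : ∀ k σ, k < M → I k σ →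
      Tr s P σ X fun σ' => σ'.nreg c = k ∧ σ'.nreg 1 = 1 ∧ I (k + 1) (σ'.setN c (k + 1)))
    (hQ : ∀ σ, I M σ → Q σ) :
    Tr s (forN c m P) σ (M * (X + 2) + 2) Q := by
  simpa using tr_forN (cost := fun _ => X) I hMs h0 hreg hstep hQ

end Rules

/-! ### Depths -/

/-- Computes in register `12` the depth of the node in register `11`. -/
def depthWalk : Program :=
  forN 13 0 (.seq (blk [.nload 14 11])
    (.seq (.ite (.nlt 14 11) (blk [.nadd 12 12 1])
      (.ite (.nlt 11 14) (blk [.nadd 12 12 1]) .skip)) (blk [.nmove 11 14])))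

/-- Presents the walk to the root by recursions that match one round of `depthWalk`. A walk of `n`
rounds is harmless, since at the root the parent pointer loops and nothing is counted. -/
theorem RootedTree.exists_count {n : ℕ} (T : RootedTree n) (v : Fin n) :
    ∃ (p : ℕ → Fin n) (cnt : ℕ → ℕ), p 0 = v ∧ (∀ k, p (k + 1) = T.parent (p k)) ∧ cnt 0 = 0 ∧
      (∀ k, cnt (k + 1) = cnt k + if p k = p (k + 1) then 0 else 1) ∧ (∀ k, cnt k ≤ k) ∧
      cnt n = T.depth v := by
  refine ⟨fun k => T.parent^[k] v, fun k =>
    ((Finset.range k).filter fun k => T.parent^[k] v ≠ T.parent^[k + 1] v).card, rfl,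
    fun k => Function.iterate_succ_apply' _ _ _, by rfl, fun k => ?_, fun k =>
    (Finset.card_filter_le (Finset.range k) _).trans_eq (Finset.card_range k), rfl⟩
  simp only [Finset.card_filter, Finset.sum_range_succ, ite_not, ne_eq]

theorem tr_depthWalk {n s i : ℕ} (T : RootedTree n) {σ : State} (v : Fin n) (hs : n + 1 < s)
    (h0 : σ.nreg 0 = n) (h1 : σ.nreg 1 = 1) (h6 : σ.nreg 6 = 0) (h10 : σ.nreg 10 = i)
    (h11 : σ.nreg 11 = v) (h12 : σ.nreg 12 = 0)
    (hpar : ∀ u : Fin n, σ.nmem u = T.parent u) :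
    Tr s depthWalk σ (n * 10 + 2) fun σ' => σ'.nreg 0 = n ∧ σ'.nreg 1 = 1 ∧ σ'.nreg 6 = 0 ∧
      σ'.nreg 10 = i ∧ σ'.nreg 12 = T.depth v ∧ σ'.nmem = σ.nmem ∧ σ'.rmem = σ.rmem ∧ σ'.rreg = σ.rreg := by
  obtain ⟨p, cnt, hp0, hp, hc0, hcnt, hle, hcn⟩ := T.exists_count v
  refine tr_forN' (X := 8) (fun k σ' => σ'.nreg 0 = n ∧ σ'.nreg 1 = 1 ∧ σ'.nreg 6 = 0 ∧
      σ'.nreg 10 = i ∧ σ'.nreg 11 = p k ∧ σ'.nreg 12 = cnt k ∧ σ'.nreg 13 = k ∧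
      σ'.nmem = σ.nmem ∧ σ'.rmem = σ.rmem ∧ σ'.rreg = σ.rreg) (by omega) ?_ ?_ ?_ ?_
  · simp [State.setN, *]
  · rintro k σ' - ⟨a0, a1, a6, a10, a11, a12, a13, an, ar, arr⟩
    exact ⟨a13, a0⟩
  · rintro k σ' hk ⟨a0, a1, a6, a10, a11, a12, a13, an, ar, arr⟩
    have hp' : σ.nmem (p k) = p (k + 1) := by rw [hpar, hp]
    have := hle k
    refine tr_seq (X := 2) (Y := 6) (tr_blk (by simp [OpsOk, Op.Ok]) (Tr.seq (X := 4) (Y := 2)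
      (Q' := fun σ' => σ'.nreg 0 = n ∧ σ'.nreg 1 = 1 ∧ σ'.nreg 6 = 0 ∧
        σ'.nreg 10 = i ∧ σ'.nreg 14 = p (k + 1) ∧ σ'.nreg 12 = cnt (k + 1) ∧
        σ'.nreg 13 = k ∧ σ'.nmem = σ.nmem ∧ σ'.rmem = σ.rmem ∧ σ'.rreg = σ.rreg) ?_ ?_))
    · simp only [runOps, Op.apply]
      refine tr_ite (fun hb => ?_) fun hb => tr_ite (fun hb' => ?_) fun hb' => ?_
      · have hne : p k ≠ p (k + 1) := fun e => by
          simp [Test.Holds, a11, an, hp'] at hb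
          simp [e] at hb
        exact (tr_blk (by simp [OpsOk, Op.Ok, a12, a1]; omega)
          (by simp [runOps, Op.apply, a0, a1, a6, a10, a11, a12, a13, an, ar, arr, hp', hcnt, hne])).le
          (by simp)
      · have hne : p k ≠ p (k + 1) := fun e => by
          simp [Test.Holds, a11, an, hp'] at hb'
          simp [e] at hb'
        exact (tr_blk (by simp [OpsOk, Op.Ok, a12, a1]; omega)
          (by simp [runOps, Op.apply, a0, a1, a6, a10, a11, a12, a13, an, ar, arr, hp', hcnt, hne]))
      · have he : p k = p (k + 1) := by
          simp [Test.Holds, a11, an, hp'] at hb hb'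
          exact Fin.ext (by omega)
        exact (tr_skip (by
          simp [a0, a1, a6, a10, a11, a12, a13, an, ar, arr, hp', hcnt, ← he])).le (by simp)
    · rintro σ' ⟨a0, a1, a6, a10, a11, a12, a13, an, ar, arr⟩
      exact tr_blk (by simp [OpsOk, Op.Ok]) (by simp [runOps, Op.apply, State.setN, *])
  · rintro σ' ⟨a0, a1, a6, a10, a11, a12, a13, an, ar, arr⟩
    exact ⟨a0, a1, a6, a10, a12.trans hcn, an, ar, arr⟩

/-- Stores the depths behind the input in the integer memory, sets the register `1` to `1`, and
overwrites the weight of the root with `0`. -/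
def depthPhase : Program :=
  .seq (blk [.nconst 1 1]) (forN 10 0 (.seq (blk [.nmove 11 10, .nconst 12 0])
    (.seq depthWalk (.seq (blk [.nadd 15 0 0, .nadd 15 15 10, .nstore 15 12])
      (.ite (.nlt 6 12) .skip (blk [.rstore 10 0]))))))

/-- The root is recognized as the node of depth `0`. With weight `0` the rule of the backward pass
for the root is plain minimization of its message, so the root needs no special treatment there. -/
theorem tr_depthPhase {n s : ℕ} (T : RootedTree n) {σ : State} (hs : 3 * n + 1 < s)
    (h0 : σ.nreg 0 = n) (h6 : σ.nreg 6 = 0) (hr : σ.rreg 0 = 0)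
    (hpar : ∀ u : Fin n, σ.nmem u = T.parent u) :
    Tr s depthPhase σ (n * (n * 10 + 14) + 4) fun σ' => σ'.nreg 0 = n ∧ σ'.nreg 1 = 1 ∧
      σ'.nreg 6 = 0 ∧ (∀ a < n + n, σ'.nmem a = σ.nmem a) ∧
      (∀ u : Fin n, σ'.nmem (n + n + u) = T.depth u) ∧
      σ'.rmem = Function.update σ.rmem T.root 0 := by
  have hn : 0 < n := T.root.pos
  refine (tr_seq (X := 2) (Y := n * (n * 10 + 14) + 2) (tr_blk (by simp [OpsOk, Op.Ok]; omega)
    (tr_forN' (X := n * 10 + 12) (fun i σ' => σ'.nreg 0 = n ∧ σ'.nreg 1 = 1 ∧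
      σ'.nreg 6 = 0 ∧ σ'.nreg 10 = i ∧ σ'.rreg 0 = 0 ∧ (∀ a < n + n, σ'.nmem a = σ.nmem a) ∧
      (∀ u : Fin n, u.val < i → σ'.nmem (n + n + u) = T.depth u) ∧
      σ'.rmem = fun a : ℕ => if a = T.root.val ∧ a < i then 0 else σ.rmem a)
      (by omega) ?_ ?_ ?_ ?_))).le (by omega)
  · simp [runOps, Op.apply, State.setN, *]
  · rintro i σ' - ⟨a0, a1, a6, a10, ar0, an, ad, ar⟩
    exact ⟨a10, a0⟩
  · rintro i σ' hi ⟨a0, a1, a6, a10, ar0, an, ad, ar⟩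
    refine (tr_seq (X := 3) (tr_blk (by simp [OpsOk, Op.Ok]; omega)
      (Tr.seq (tr_depthWalk (i := i) T ⟨i, hi⟩ (by omega) ?_ ?_ ?_ ?_ ?_ ?_ ?_)
      (Y := 4 + 3) ?_))).le (Y := n * 10 + 12) (by omega)
    · simp [runOps, Op.apply, *]
    · simp [runOps, Op.apply, *]
    · simp [runOps, Op.apply, *]
    · simp [runOps, Op.apply, *]
    · simp [runOps, Op.apply, *]
    · simp [runOps, Op.apply, *]
    · intro u
      simp only [runOps, Op.apply]
      rw [an u (by omega), hpar]
    · rintro σ₂ ⟨b0, b1, b6, b10, b12, bn, br, brr⟩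
      simp only [runOps, Op.apply] at bn br brr
      refine tr_seq (tr_blk (by simp [OpsOk, Op.Ok, Op.apply, b0, b10]; omega) ?_)
      have hn1 : ∀ a < n + n, Function.update σ₂.nmem (n + n + i) (T.depth ⟨i, hi⟩) a
          = σ.nmem a := by
        intro a ha
        rw [Function.update_of_ne (by omega), bn, an a ha]
      have hd1 : ∀ u : Fin n, u.val < i + 1 →
          Function.update σ₂.nmem (n + n + i) (T.depth ⟨i, hi⟩) (n + n + u) = T.depth u := by
        intro u hu
        by_cases e : u.val = i
        · subst e
          simp
        · rw [Function.update_of_ne (by omega), bn, ad u (by omega)]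
      refine tr_ite (X := 2) (fun hb => ?_) (fun hb => ?_)
      · simp [runOps, Op.apply, Test.Holds, b12, b6] at hb
        have hne : i ≠ T.root := by
          rintro rfl
          rw [Fin.eta, T.depth_root] at hb
          omega
        refine (tr_skip ?_).le (by omega)
        simp [runOps, Op.apply, State.setN, b0, b1, b6, b10, b12]
        refine ⟨by rw [brr, ar0], hn1, fun u hu => hd1 u (by omega), ?_⟩
        rw [br, ar]
        funext a
        congr 1
        apply propext
        omega
      · simp [runOps, Op.apply, Test.Holds, b12, b6] at hb
        have he : i = T.root := by
          by_contra hne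
          have := T.depth_pos (i := ⟨i, hi⟩) fun e => hne (by rw [← e])
          omega
        refine tr_blk (by simp [OpsOk, Op.Ok]) ?_
        simp [runOps, Op.apply, State.setN, b0, b1, b6, b10, b12]
        refine ⟨by rw [brr, ar0], hn1, fun u hu => hd1 u (by omega), ?_⟩
        rw [br, ar, brr, ar0]
        funext a
        by_cases e : a = i
        · rw [e, Function.update_self, if_pos ⟨he, by omega⟩]
        · rw [Function.update_of_ne e]
          congr 1
          apply propext
          omega
  · rintro σ' ⟨a0, a1, a6, a10, ar0, an, ad, ar⟩
    refine ⟨a0, a1, a6, an, fun u => ad u u.isLt, ?_⟩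
    rw [ar]
    funext a
    by_cases e : a = T.root
    · rw [e, Function.update_self, if_pos ⟨rfl, T.root.isLt⟩]
    · rw [Function.update_of_ne e, if_neg fun h => e h.1]

/-! ### The grid -/

/-- The registers that hold the parameters of the memory layout. -/
structure Regs (n N A : ℕ) (σ : State) : Prop where
  r0 : σ.nreg 0 = n
  r1 : σ.nreg 1 = 1
  r2 : σ.nreg 2 = N
  r3 : σ.nreg 3 = A
  r4 : σ.nreg 4 = A + N
  r5 : σ.nreg 5 = A + N + n * N
  r6 : σ.nreg 6 = 0

theorem Regs.of_eq {n N A : ℕ} {σ σ' : State} (h : Regs n N A σ)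
    (e : ∀ r < 7, σ'.nreg r = σ.nreg r) : Regs n N A σ' :=
  ⟨(e 0 (by omega)).trans h.r0, (e 1 (by omega)).trans h.r1, (e 2 (by omega)).trans h.r2,
    (e 3 (by omega)).trans h.r3, (e 4 (by omega)).trans h.r4, (e 5 (by omega)).trans h.r5,
    (e 6 (by omega)).trans h.r6⟩

/-- Sets the registers `2` to `5`. -/
def layoutPhase : Program :=
  .seq (blk [.nconst 20 0])
    (.seq (forN 10 0 (blk [.nadd 11 0 10, .nload 12 11, .nadd 20 20 12]))
      (blk [.nadd 2 20 1, .nadd 3 0 0, .nadd 3 3 20, .nadd 3 3 20, .nadd 4 3 2, .nmul 15 0 2,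
        .nadd 5 4 15]))

/-- The real input ends before `A`. From `A` on follow the grid of `N` cells (all breakpoints and
the origin), the `n` rows of `N` values from `A + N` on, and a scratch row from `A + N + n * N` on.
-/
theorem tr_layoutPhase {n s N A : ℕ} {t : ℕ → ℕ} {σ : State}
    (hN : N = ∑ i ∈ Finset.range n, t i + 1) (hA : A = n + n + 2 * ∑ i ∈ Finset.range n, t i)
    (hs : A + N + n * N < s) (h0 : σ.nreg 0 = n) (h1 : σ.nreg 1 = 1) (h6 : σ.nreg 6 = 0)
    (ht : ∀ i < n, σ.nmem (n + i) = t i) :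
    Tr s layoutPhase σ (n * 6 + 12) fun σ' => Regs n N A σ' ∧ σ'.nmem = σ.nmem ∧
      σ'.rmem = σ.rmem := by
  refine (tr_seq (X := 2) (Y := n * 6 + 2 + 8) (tr_blk (by simp [OpsOk, Op.Ok]; omega)
    (Tr.seq (Q' := fun σ' => σ'.nreg 20 = ∑ i ∈ Finset.range n, t i ∧ σ'.nreg 0 = n ∧
      σ'.nreg 1 = 1 ∧ σ'.nreg 6 = 0 ∧ σ'.nmem = σ.nmem ∧ σ'.rmem = σ.rmem)
    (tr_forN' (X := 4) (fun i σ' => σ'.nreg 20 = ∑ j ∈ Finset.range i, t j ∧ σ'.nreg 10 = i ∧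
      σ'.nreg 0 = n ∧ σ'.nreg 1 = 1 ∧ σ'.nreg 6 = 0 ∧ σ'.nmem = σ.nmem ∧ σ'.rmem = σ.rmem)
      (M := n) (by omega) ?_ ?_ ?_ ?_) ?_))).le (by omega)
  · simp [runOps, Op.apply, State.setN, *]
  · rintro i σ' - ⟨a20, a10, a0, a1, a6, an, ar⟩
    exact ⟨a10, a0⟩
  · rintro i σ' hi ⟨a20, a10, a0, a1, a6, an, ar⟩
    have hle : ∑ j ∈ Finset.range (i + 1), t j ≤ ∑ j ∈ Finset.range n, t j :=
      Finset.sum_le_sum_of_subset (Finset.range_subset_range.2 (by omega))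
    rw [Finset.sum_range_succ] at hle
    refine tr_blk ?_ ?_
    · simp [OpsOk, Op.Ok, Op.apply, a0, a10, a20, an, ht i hi]
      omega
    · simp [runOps, Op.apply, State.setN, a0, a1, a6, a10, a20, an, ar, ht i hi,
        Finset.sum_range_succ]
  · rintro σ' ⟨a20, a10, a0, a1, a6, an, ar⟩
    exact ⟨a20, a0, a1, a6, an, ar⟩
  · rintro σ' ⟨a20, a0, a1, a6, an, ar⟩
    refine tr_blk ?_ ?_
    · simp [OpsOk, Op.Ok, Op.apply, a0, a1, a20, ← hN]
      omega
    · refine ⟨⟨?_, ?_, ?_, ?_, ?_, ?_, ?_⟩, ?_, ?_⟩ <;>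
        simp [runOps, Op.apply, a0, a1, a6, a20, an, ar, ← hN, hA] <;> omega

/-- The cells of `g` from `A` to `A + m - 1` are sorted. -/
def SortedCells (g : ℕ → ℝ) (A m : ℕ) : Prop := ∀ p q, p ≤ q → q < m → g (A + p) ≤ g (A + q)

/-- The number `u` is stored in one of the cells of `g` from `A` to `A + m - 1`. -/
def HasCell (g : ℕ → ℝ) (A m : ℕ) (u : ℝ) : Prop := ∃ p < m, g (A + p) = u

/-- The number `u` is `c` or is stored in one of the cells of `g` from `A` to `A + m - 1`. -/
def HasCellOr (g : ℕ → ℝ) (A m : ℕ) (c u : ℝ) : Prop := u = c ∨ HasCell g A m u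

/-- Merges the real register `1` into a sorted array; the largest entry is left in the register. -/
def insertLoop : Program :=
  forN 14 21 (.seq (blk [.nadd 15 3 14, .rload 2 15])
    (.ite (.rlt 1 2) (blk [.rstore 15 1, .rmove 1 2]) .skip))

theorem tr_insertLoop {s A m : ℕ} {σ : State} (hs : A + m < s) (h1 : σ.nreg 1 = 1)
    (h3 : σ.nreg 3 = A) (h21 : σ.nreg 21 = m) (hsort : SortedCells σ.rmem A m) :
    Tr s insertLoop σ (m * 9 + 2) fun σ' => (∀ r, r ≠ 14 → r ≠ 15 → σ'.nreg r = σ.nreg r) ∧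
      σ'.nmem = σ.nmem ∧ (∀ a < A, σ'.rmem a = σ.rmem a) ∧ SortedCells σ'.rmem A m ∧
      (∀ p < m, σ'.rmem (A + p) ≤ σ'.rreg 1) ∧
      ∀ u, HasCellOr σ.rmem A m (σ.rreg 1) u → HasCellOr σ'.rmem A m (σ'.rreg 1) u := by
  -- The carried number dominates the cells already passed; therefore exchanging it with a larger
  -- cell keeps the array sorted.
  refine tr_forN' (X := 7) (fun k σ' => σ'.nreg 14 = k ∧
      (∀ r, r ≠ 14 → r ≠ 15 → σ'.nreg r = σ.nreg r) ∧
      σ'.nmem = σ.nmem ∧ (∀ a < A, σ'.rmem a = σ.rmem a) ∧ SortedCells σ'.rmem A m ∧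
      (∀ p < k, σ'.rmem (A + p) ≤ σ'.rreg 1) ∧
      ∀ u, HasCellOr σ.rmem A m (σ.rreg 1) u → HasCellOr σ'.rmem A m (σ'.rreg 1) u)
      (by omega) ?_ ?_ ?_ ?_
  · refine ⟨by simp [State.setN], fun r h _ => by simp [State.setN, h], rfl, fun _ _ => rfl, hsort,
      by simp, fun u h => h⟩
  · rintro k σ' - ⟨a14, afr, -⟩
    exact ⟨a14, by simp [afr, h21]⟩
  · rintro k σ' hk ⟨a14, afr, an, ar, asort, amax, acov⟩
    have e3 : σ'.nreg 3 = A := by simp [afr, h3]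
    have e1 : σ'.nreg 1 = 1 := by simp [afr, h1]
    refine tr_seq (X := 3) (Y := 4) (tr_blk (by simp [OpsOk, Op.Ok, e3, a14]; omega)
      (tr_ite (X := 3) (fun hb => ?_) fun hb => ?_))
    · simp [runOps, Op.apply, Test.Holds, e3, a14] at hb
      refine tr_blk (by simp [OpsOk, Op.Ok]) ?_
      simp only [runOps, Op.apply, State.setN]
      simp [e3, a14, e1, an]
      refine ⟨fun r h h' => by simp [h, h', afr], fun a ha => ?_, ?_, ?_, ?_⟩
      · rw [Function.update_of_ne (by omega), ar a ha]
      · intro p q hpq hq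
        by_cases hp : p = k
        · subst hp
          by_cases hq' : q = p
          · rw [hq']
          · rw [Function.update_self, Function.update_of_ne (by omega)]
            exact hb.le.trans (asort _ _ hpq hq)
        · rw [Function.update_of_ne (by omega)]
          by_cases hq' : q = k
          · subst hq'
            rw [Function.update_self]
            exact amax p (by omega)
          · rw [Function.update_of_ne (by omega)]
            exact asort _ _ hpq hq
      · intro p hp
        by_cases hp' : p = k
        · rw [hp', Function.update_self]
          exact hb.le
        · rw [Function.update_of_ne (by omega)]
          exact asort _ _ (by omega) hk
      · intro u hu
        rcases acov u hu with rfl | ⟨p, hp, rfl⟩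
        · exact Or.inr ⟨k, hk, by rw [Function.update_self]⟩
        · by_cases hp' : p = k
          · exact Or.inl (by rw [hp'])
          · exact Or.inr ⟨p, hp, by rw [Function.update_of_ne (by omega)]⟩
    · simp [runOps, Op.apply, Test.Holds, e3, a14] at hb
      refine (tr_skip ?_).le (by omega)
      simp only [runOps, Op.apply, State.setN]
      simp [e3, a14, e1, an]
      refine ⟨fun r h h' => by simp [h, h', afr], ar, asort, fun p hp => ?_, acov⟩
      by_cases hp' : p = k
      · rw [hp']; exact hb
      · exact amax p (by omega)
  · rintro σ' ⟨-, h⟩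
    exact h

/-- Collects the origin and all breakpoints in a sorted array. -/
def gridPhase : Program :=
  .seq (blk [.rconst 1 0, .rstore 3 1, .nconst 21 1, .nmove 22 0])
    (forN 10 0 (.seq (blk [.nadd 11 0 10, .nload 12 11, .nadd 22 22 1])
      (forN 13 12 (.seq (blk [.rload 1 22]) (.seq insertLoop
        (blk [.nadd 15 3 21, .rstore 15 1, .nadd 21 21 1, .nadd 22 22 1, .nadd 22 22 1]))))))

/-- Insertion sort is good enough: each of the at most `K * n` breakpoints is inserted in `O(N)`
steps. The origin keeps the grid nonempty. The term `i` starts behind `n` weights and the `2 * t j +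
1` numbers of each earlier term, with its breakpoints at odd offsets. -/
theorem tr_gridPhase {n s N A K : ℕ} {t : ℕ → ℕ} {σ : State}
    (hN : N = ∑ i ∈ Finset.range n, t i + 1) (hA : A = n + n + 2 * ∑ i ∈ Finset.range n, t i)
    (hs : A + N + n * N < s) (hR : Regs n N A σ) (ht : ∀ i < n, σ.nmem (n + i) = t i)
    (htK : ∀ i < n, t i ≤ K) :
    Tr s gridPhase σ (n * (K * (N * 9 + 12) + 8) + 7) fun σ' => Regs n N A σ' ∧
      σ'.nmem = σ.nmem ∧ (∀ a < A, σ'.rmem a = σ.rmem a) ∧ SortedCells σ'.rmem A N ∧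
      ∀ i < n, ∀ q < t i,
        HasCell σ'.rmem A N (σ.rmem (n + i + 2 * ∑ j ∈ Finset.range i, t j + 1 + 2 * q)) := by
  set off : ℕ → ℕ := fun i => ∑ j ∈ Finset.range i, t j with hoff
  have off_succ : ∀ i, off (i + 1) = off i + t i := fun i => Finset.sum_range_succ _ _
  have hoff0 : off 0 = 0 := by simp [hoff]
  have off_le : ∀ i ≤ n, off i ≤ off n := fun i hi =>
    Finset.sum_le_sum_of_subset (Finset.range_subset_range.2 hi)
  change N = off n + 1 at hN
  change A = n + n + 2 * off n at hA
  change Tr s gridPhase σ _ fun σ' => Regs n N A σ' ∧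
      σ'.nmem = σ.nmem ∧ (∀ a < A, σ'.rmem a = σ.rmem a) ∧ SortedCells σ'.rmem A N ∧
      ∀ i < n, ∀ q < t i, HasCell σ'.rmem A N (σ.rmem (n + i + 2 * off i + 1 + 2 * q))
  clear_value off
  -- All earlier terms and the first `q` breakpoints of term `i` are inserted; the origin accounts
  -- for the `1` in the number of occupied cells.
  let I : ℕ → ℕ → State → Prop := fun i q σ' => Regs n N A σ' ∧ σ'.nreg 10 = i ∧
      σ'.nreg 21 = off i + q + 1 ∧ σ'.nmem = σ.nmem ∧ (∀ a < A, σ'.rmem a = σ.rmem a) ∧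
      SortedCells σ'.rmem A (off i + q + 1) ∧
      ∀ i' q', i' < n → q' < t i' → i' < i ∨ i' = i ∧ q' < q →
        HasCell σ'.rmem A (off i + q + 1) (σ.rmem (n + i' + 2 * off i' + 1 + 2 * q'))
  refine (tr_seq (X := 5) (tr_blk (by simp [OpsOk, Op.Ok]; omega)
    (tr_forN' (M := n) (X := K * (N * 9 + 12) + 6)
      (fun i σ' => I i 0 σ' ∧ σ'.nreg 22 = n + i + 2 * off i) (by omega) ?_ ?_ ?_ ?_))).le
    (show 5 + (n * (K * (N * 9 + 12) + 8) + 2) ≤ _ by omega)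
  · refine ⟨⟨hR.of_eq fun r hr => ?_, ?_, ?_, ?_, ?_, ?_, ?_⟩, ?_⟩
    · simp only [runOps, Op.apply, State.setN]
      simp [Function.update_apply]
      split_ifs <;> omega
    · simp [runOps, Op.apply, State.setN]
    · simp [runOps, Op.apply, State.setN, hoff0]
    · simp [runOps, Op.apply, State.setN]
    · intro a ha
      simp [runOps, Op.apply, State.setN, hR.r3, ha.ne]
    · intro p q hp hq
      rw [show p = q by omega]
    · intro i' q' _ _ h
      omega
    · simp [runOps, Op.apply, State.setN, hR.r0, hoff0]
  · rintro i σ' - ⟨⟨aR, a10, -⟩, -⟩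
    exact ⟨a10, aR.r0⟩
  · rintro i σ' hi ⟨⟨aR, a10, a21, an, ar, asort, acov⟩, a22⟩
    have hti : σ.nmem (n + i) = t i := ht i hi
    have h1 := off_succ i
    have h2 := off_le (i + 1) hi
    refine (tr_seq (X := 4) (Y := t i * (N * 9 + 12) + 2)
      (tr_blk (by simp [OpsOk, Op.Ok, Op.apply, aR.r0, aR.r1, a10, a22]; omega)
      (tr_forN' (M := t i) (X := N * 9 + 10)
        (fun q σ' => I i q σ' ∧ σ'.nreg 12 = t i ∧ σ'.nreg 13 = q ∧
          σ'.nreg 22 = n + i + 2 * off i + 1 + 2 * q) (by omega) ?_ ?_ ?_ ?_))).le ?_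
    · refine ⟨⟨aR.of_eq fun r hr => ?_, ?_, ?_, ?_, ?_, ?_, ?_⟩, ?_, ?_, ?_⟩
      · simp only [runOps, Op.apply, State.setN]
        simp [Function.update_apply]
        split_ifs <;> omega
      · simpa [runOps, Op.apply, State.setN]
      · simpa [runOps, Op.apply, State.setN]
      · simpa [runOps, Op.apply, State.setN]
      · exact ar
      · exact asort
      · exact acov
      · simp [runOps, Op.apply, State.setN, aR.r0, a10, an, hti]
      · simp [runOps, Op.apply, State.setN]
      · simp [runOps, Op.apply, State.setN, aR.r1, a22]
    · rintro q σ' - ⟨-, b12, b13, -⟩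
      exact ⟨b13, b12⟩
    · rintro q σ₂ hq ⟨⟨bR, b10, b21, bn, br, bsort, bcov⟩, b12, b13, b22⟩
      refine (tr_seq (X := 2) (tr_blk (by simp [OpsOk, Op.Ok])
        (Tr.seq (tr_insertLoop (A := A) (m := off i + q + 1) (by omega) ?_ ?_ ?_ ?_)
        (Y := 6) ?_))).le (by omega)
      · simpa [runOps, Op.apply] using bR.r1
      · simpa [runOps, Op.apply] using bR.r3
      · simpa [runOps, Op.apply] using b21
      · exact bsort
      · rintro σ₃ ⟨cfr, cn, cr, csort, cmax, ccov⟩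
        simp only [runOps, Op.apply] at cfr cn cr ccov
        have e1 : σ₃.nreg 1 = 1 := by simp [cfr, bR.r1]
        have e3 : σ₃.nreg 3 = A := by simp [cfr, bR.r3]
        have e21 : σ₃.nreg 21 = off i + q + 1 := by simp [cfr, b21]
        have e22 : σ₃.nreg 22 = n + i + 2 * off i + 1 + 2 * q := by simp [cfr, b22]
        refine tr_blk (by simp [OpsOk, Op.Ok, Op.apply, e1, e3, e21, e22]; omega) ?_
        refine ⟨?_, ?_, ⟨bR.of_eq fun r hr => ?_, ?_, ?_, ?_, ?_, ?_, ?_⟩, ?_, ?_, ?_⟩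
        · simp [runOps, Op.apply, cfr, b13]
        · simp [runOps, Op.apply, e1]
        · simp only [runOps, Op.apply, State.setN]
          rw [← cfr r (by omega) (by omega)]
          simp [Function.update_apply]
          split_ifs <;> omega
        · simp [runOps, Op.apply, State.setN, cfr, b10]
        · simp [runOps, Op.apply, State.setN, e1, e21]
          omega
        · simp [runOps, Op.apply, State.setN, cn, bn]
        · intro a ha
          simp only [runOps, Op.apply, State.setN]
          simp [e3, e21]
          rw [Function.update_of_ne (by omega), cr a ha, br a ha]
        · intro p p' hpp hp'
          simp only [runOps, Op.apply, State.setN]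
          simp [e3, e21]
          by_cases e : p' = off i + q + 1
          · subst e
            rw [Function.update_self]
            by_cases e' : p = off i + q + 1
            · rw [e', Function.update_self]
            · rw [Function.update_of_ne (by omega)]
              exact cmax p (by omega)
          · rw [Function.update_of_ne (by omega), Function.update_of_ne (by omega)]
            exact csort p p' hpp (by omega)
        · intro i' q' hi' hq' h
          have key : HasCell σ₃.rmem A (off i + q + 1)
                (σ.rmem (n + i' + 2 * off i' + 1 + 2 * q')) ∨
              σ.rmem (n + i' + 2 * off i' + 1 + 2 * q') = σ₃.rreg 1 := by
            refine (ccov _ ?_).symm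
            by_cases e : i' = i ∧ q' = q
            · refine Or.inl ?_
              obtain ⟨rfl, rfl⟩ := e
              simp only [Function.update_self, b22]
              rw [br _ (by omega)]
            · exact Or.inr (bcov i' q' hi' hq' (by omega))
          simp only [runOps, Op.apply, State.setN]
          simp [e3, e21]
          rcases key with ⟨p, hp, e⟩ | e
          · exact ⟨p, by omega, by rw [Function.update_of_ne (by omega), e]⟩
          · exact ⟨off i + q + 1, by omega, by rw [Function.update_self, e]⟩
        · simp [runOps, Op.apply, State.setN, cfr, b12]
        · simp [State.setN]
        · simp [runOps, Op.apply, State.setN, e1, e22]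
          omega
    · rintro σ₂ ⟨⟨bR, b10, b21, bn, br, bsort, bcov⟩, b12, b13, b22⟩
      rw [show off i + t i + 1 = off (i + 1) + 0 + 1 by omega] at b21 bsort bcov
      refine ⟨b10, bR.r1, ⟨bR.of_eq fun r hr => ?_, ?_, ?_, ?_, ?_, ?_, ?_⟩, ?_⟩
      · simp only [State.setN]
        rw [Function.update_of_ne (by omega)]
      · simp [State.setN]
      · simpa [State.setN] using b21
      · exact bn
      · exact br
      · exact bsort
      · intro i' q' hi' hq' h
        by_cases e : i' = i
        · exact bcov i' q' hi' hq' (Or.inr ⟨e, e ▸ hq'⟩)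
        · exact bcov i' q' hi' hq' (Or.inl (by omega))
      · simp [State.setN, b22]
        omega
    · have := Nat.mul_le_mul_right (N * 9 + 12) (htK i hi)
      omega
  · rintro σ' ⟨⟨aR, a10, a21, an, ar, asort, acov⟩, a22⟩
    rw [show off n + 0 + 1 = N by omega] at asort acov
    exact ⟨aR, an, ar, asort, fun i hi q hq => acov i q hi hq (Or.inl hi)⟩

/-! ### Evaluation of the unary terms on the grid -/

theorem index_lt {n N i k : ℕ} (hi : i < n) (hk : k < N) : i * N + k < n * N := by
  have := Nat.mul_le_mul_right N (Nat.succ_le_of_lt hi)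
  rw [Nat.succ_mul] at this
  omega

theorem index_inj {N i k i' k' : ℕ} (hk : k < N) (hk' : k' < N)
    (h : i' * N + k' = i * N + k) : i' = i ∧ k' = k := by
  rcases lt_trichotomy i' i with h' | h' | h'
  · have := index_lt h' hk'; omega
  · subst h'; exact ⟨rfl, by omega⟩
  · have := index_lt h' hk; omega

/-- The value at `x` of the function whose `t` breakpoints and slopes are stored from `p` on. -/
noncomputable def evalCells (ρ : ℕ → ℝ) (p t : ℕ) (x : ℝ) : ℝ :=
  ρ p * x + ∑ q ∈ Finset.range t,
    (ρ (p + 2 * q + 2) - ρ (p + 2 * q)) * max (x - ρ (p + 2 * q + 1)) 0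

/-- Adds to the real register `3` the hinges of a unary term at the real register `1`. -/
def evalLoop : Program :=
  forN 14 12 (.seq (blk [.nadd 24 23 1, .rload 4 24, .nadd 25 24 1, .rload 5 25, .rload 2 23,
    .rsub 6 1 4, .rsub 5 5 2, .rmul 5 5 6])
    (.seq (.ite (.rlt 4 1) (blk [.radd 3 3 5]) .skip) (blk [.nmove 23 25])))

theorem tr_evalLoop {s p t : ℕ} {σ : State} (hs : p + 2 * t + 1 < s) (h1 : σ.nreg 1 = 1)
    (h12 : σ.nreg 12 = t) (h23 : σ.nreg 23 = p) (h3 : σ.rreg 3 = σ.rmem p * σ.rreg 1) :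
    Tr s evalLoop σ (t * 16 + 2) fun σ' =>
      (∀ r, r ≠ 14 → r ≠ 23 → r ≠ 24 → r ≠ 25 → σ'.nreg r = σ.nreg r) ∧
      σ'.nmem = σ.nmem ∧ σ'.rmem = σ.rmem ∧ σ'.rreg 3 = evalCells σ.rmem p t (σ.rreg 1) := by
  refine tr_forN' (X := 14) (fun k σ' => σ'.nreg 14 = k ∧ σ'.nreg 23 = p + 2 * k ∧
      σ'.rreg 1 = σ.rreg 1 ∧
      (∀ r, r ≠ 14 → r ≠ 23 → r ≠ 24 → r ≠ 25 → σ'.nreg r = σ.nreg r) ∧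
      σ'.nmem = σ.nmem ∧ σ'.rmem = σ.rmem ∧ σ'.rreg 3 = evalCells σ.rmem p k (σ.rreg 1))
      (by omega) ?_ ?_ ?_ ?_
  · refine ⟨?_, ?_, rfl, fun r h _ _ _ => ?_, rfl, rfl, ?_⟩ <;>
      simp [State.setN, evalCells, *]
  · rintro k σ' - ⟨a14, a23, ar1, afr, -⟩
    exact ⟨a14, by simp [afr, h12]⟩
  · rintro k σ' hk ⟨a14, a23, ar1, afr, an, ar, a3⟩
    have e1 : σ'.nreg 1 = 1 := by simp [afr, h1]
    refine tr_seq (X := 9) (Y := 5)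
      (tr_blk (by simp [OpsOk, Op.Ok, Op.apply, e1, a23]; omega) (Tr.seq (X := 3) (Y := 2)
      (Q' := fun σ₂ => σ₂.nreg 14 = k ∧ σ₂.nreg 25 = p + 2 * k + 2 ∧ σ₂.rreg 1 = σ.rreg 1 ∧
      (∀ r, r ≠ 14 → r ≠ 23 → r ≠ 24 → r ≠ 25 → σ₂.nreg r = σ.nreg r) ∧
      σ₂.nmem = σ.nmem ∧ σ₂.rmem = σ.rmem ∧ σ₂.rreg 3 = evalCells σ.rmem p (k + 1) (σ.rreg 1))
      (tr_ite (X := 2) (fun hb => ?_) fun hb => ?_) ?_))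
    · simp [runOps, Op.apply, Test.Holds, e1, a23, ar, ar1] at hb
      refine tr_blk (by simp [OpsOk, Op.Ok]) ?_
      refine ⟨?_, ?_, ?_, fun r h h' h'' h''' => ?_, ?_, ?_, ?_⟩
      · simp [runOps, Op.apply, a14]
      · simp [runOps, Op.apply, a23, e1]
      · simp [runOps, Op.apply, ar1]
      · simp [runOps, Op.apply, h'', h''', afr r h h' h'' h''']
      · simpa [runOps, Op.apply] using an
      · simpa [runOps, Op.apply] using ar
      · simp [runOps, Op.apply, a23, e1, ar, ar1, a3]
        rw [evalCells, evalCells, Finset.sum_range_succ, max_eq_left (a := _ - _) (by linarith)]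
        ring_nf
    · simp [runOps, Op.apply, Test.Holds, e1, a23, ar, ar1] at hb
      refine (tr_skip ?_).le (by omega)
      refine ⟨?_, ?_, ?_, fun r h h' h'' h''' => ?_, ?_, ?_, ?_⟩
      · simp [runOps, Op.apply, a14]
      · simp [runOps, Op.apply, a23, e1]
      · simp [runOps, Op.apply, ar1]
      · simp [runOps, Op.apply, h'', h''', afr r h h' h'' h''']
      · simpa [runOps, Op.apply] using an
      · simpa [runOps, Op.apply] using ar
      · simp [runOps, Op.apply, a3]
        rw [evalCells, evalCells, Finset.sum_range_succ,
          max_eq_right (a := σ.rreg 1 - σ.rmem (p + 2 * k + 1)) (by linarith)]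
        ring
    · rintro σ₂ ⟨b14, b25, br1, bfr, bn, br, b3⟩
      refine tr_blk (by simp [OpsOk, Op.Ok]) ?_
      refine ⟨?_, ?_, ?_, ?_, ?_, fun r h h' h'' h''' => ?_, ?_, ?_, ?_⟩
      · simp [runOps, Op.apply, b14]
      · simp [runOps, Op.apply, bfr, h1]
      · simp [State.setN]
      · simp [runOps, Op.apply, State.setN, b25]; omega
      · simpa [runOps, Op.apply, State.setN] using br1
      · simp [runOps, Op.apply, State.setN, h, h', bfr r h h' h'' h''']
      · simpa [runOps, Op.apply, State.setN] using bn
      · simpa [runOps, Op.apply, State.setN] using br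
      · simpa [runOps, Op.apply, State.setN] using b3
  · rintro σ' ⟨-, -, -, afr, an, ar, a3⟩
    exact ⟨afr, an, ar, a3⟩

/-- Tabulates all unary terms on the grid. -/
def evalPhase : Program :=
  .seq (blk [.nmove 22 0, .nmove 16 4]) (forN 10 0 (.seq (blk [.nadd 11 0 10, .nload 12 11])
    (.seq (forN 13 2 (.seq (blk [.nadd 15 3 13, .rload 1 15, .rload 2 22, .rmul 3 2 1,
      .nmove 23 22]) (.seq evalLoop (blk [.rstore 16 3, .nadd 16 16 1]))))
      (blk [.nadd 22 22 12, .nadd 22 22 12, .nadd 22 22 1]))))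

/-- Slopes and breakpoints determine a unary term only up to a constant, so the table holds a
normalized version. This suffices because additive constants do not affect minimizers. -/
theorem tr_evalPhase {n s N A K : ℕ} {t : ℕ → ℕ} {σ : State}
    (hA : A = n + n + 2 * ∑ i ∈ Finset.range n, t i) (hN : 0 < N)
    (hs : A + N + n * N < s) (hR : Regs n N A σ) (ht : ∀ i < n, σ.nmem (n + i) = t i)
    (htK : ∀ i < n, t i ≤ K) :
    Tr s evalPhase σ (n * (N * (K * 16 + 13) + 11) + 5) fun σ' => Regs n N A σ' ∧
      σ'.nmem = σ.nmem ∧ (∀ a < A + N, σ'.rmem a = σ.rmem a) ∧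
      ∀ i < n, ∀ k < N, σ'.rmem (A + N + (i * N + k)) =
        evalCells σ.rmem (n + i + 2 * ∑ j ∈ Finset.range i, t j) (t i) (σ.rmem (A + k)) := by
  set off : ℕ → ℕ := fun i => ∑ j ∈ Finset.range i, t j with hoff
  have off_succ : ∀ i, off (i + 1) = off i + t i := fun i => Finset.sum_range_succ _ _
  have hoff0 : off 0 = 0 := by simp [hoff]
  have off_le : ∀ i ≤ n, off i ≤ off n := fun i hi =>
    Finset.sum_le_sum_of_subset (Finset.range_subset_range.2 hi)
  change A = n + n + 2 * off n at hA
  change Tr s evalPhase σ _ fun σ' => Regs n N A σ' ∧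
      σ'.nmem = σ.nmem ∧ (∀ a < A + N, σ'.rmem a = σ.rmem a) ∧
      ∀ i < n, ∀ k < N, σ'.rmem (A + N + (i * N + k)) =
        evalCells σ.rmem (n + i + 2 * off i) (t i) (σ.rmem (A + k))
  clear_value off
  let I : ℕ → ℕ → State → Prop := fun i k σ' => Regs n N A σ' ∧ σ'.nreg 10 = i ∧
      σ'.nreg 16 = A + N + (i * N + k) ∧ σ'.nreg 22 = n + i + 2 * off i ∧
      σ'.nmem = σ.nmem ∧ (∀ a < A + N, σ'.rmem a = σ.rmem a) ∧
      ∀ i' k', i' < n → k' < N → i' * N + k' < i * N + k →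
        σ'.rmem (A + N + (i' * N + k')) =
          evalCells σ.rmem (n + i' + 2 * off i') (t i') (σ.rmem (A + k'))
  refine (tr_seq (X := 3) (tr_blk (by simp [OpsOk, Op.Ok])
    (tr_forN' (M := n) (X := N * (K * 16 + 13) + 9) (fun i σ' => I i 0 σ')
      (by omega) ?_ ?_ ?_ ?_))).le
    (show 3 + (n * (N * (K * 16 + 13) + 11) + 2) ≤ _ by omega)
  · refine ⟨hR.of_eq fun r hr => ?_, ?_, ?_, ?_, rfl, fun _ _ => rfl, ?_⟩
    · simp only [runOps, Op.apply, State.setN]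
      simp [Function.update_apply]
      split_ifs <;> omega
    · simp [State.setN]
    · simp [runOps, Op.apply, State.setN, hR.r4]
    · simp [runOps, Op.apply, State.setN, hR.r0, hoff0]
    · intro i' k' _ _ h
      omega
  · rintro i σ' - ⟨aR, a10, -⟩
    exact ⟨a10, aR.r0⟩
  · rintro i σ' hi ⟨aR, a10, a16, a22, an, ar, av⟩
    have hti : σ.nmem (n + i) = t i := ht i hi
    have h1 := off_succ i
    have h2 := off_le (i + 1) hi
    refine (tr_seq (X := 3)
      (tr_blk (by simp [OpsOk, Op.Ok, aR.r0, a10]; omega)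
      (Tr.seq (X := N * (K * 16 + 13) + 2) (Y := 4)
        (Q' := fun σ' => I i N σ' ∧ σ'.nreg 12 = t i)
        (tr_forN' (M := N) (X := K * 16 + 11)
        (fun k σ' => I i k σ' ∧ σ'.nreg 12 = t i ∧ σ'.nreg 13 = k) (by omega) ?_ ?_ ?_ ?_) ?_))).le
      (by omega)
    · refine ⟨⟨aR.of_eq fun r hr => ?_, ?_, ?_, ?_, ?_, ?_, ?_⟩, ?_, ?_⟩
      · simp only [runOps, Op.apply, State.setN]
        simp [Function.update_apply]
        split_ifs <;> omega
      · simpa [runOps, Op.apply, State.setN]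
      · simpa [runOps, Op.apply, State.setN]
      · simpa [runOps, Op.apply, State.setN]
      · exact an
      · exact ar
      · exact av
      · simp [runOps, Op.apply, State.setN, aR.r0, a10, an, hti]
      · simp [State.setN]
    · rintro k σ' - ⟨⟨bR, -⟩, b12, b13⟩
      exact ⟨b13, bR.r2⟩
    · rintro k σ₂ hk ⟨⟨bR, b10, b16, b22, bn, br, bv⟩, b12, b13⟩
      have hlt := index_lt hi hk
      have hx : σ₂.rmem (A + k) = σ.rmem (A + k) := br _ (by omega)
      refine (tr_seq (X := 6) (tr_blk (by simp [OpsOk, Op.Ok, bR.r3, b13]; omega)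
        (Tr.seq (tr_evalLoop (p := n + i + 2 * off i) (t := t i) (by omega) ?_ ?_ ?_ ?_)
        (Y := 3) ?_))).le (Y := K * 16 + 11)
        (by have := htK i hi; omega)
      · simpa [runOps, Op.apply] using bR.r1
      · simpa [runOps, Op.apply] using b12
      · simpa [runOps, Op.apply] using b22
      · simp [runOps, Op.apply, b22]
      · rintro σ₃ ⟨cfr, cn, cr, c3⟩
        simp [runOps, Op.apply, bR.r3, b13, hx] at cn cr c3
        have hcells : evalCells σ₂.rmem (n + i + 2 * off i) (t i) (σ.rmem (A + k))
            = evalCells σ.rmem (n + i + 2 * off i) (t i) (σ.rmem (A + k)) := by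
          rw [evalCells, evalCells, br _ (by omega)]
          congr 1
          refine Finset.sum_congr rfl fun q hq => ?_
          rw [Finset.mem_range] at hq
          rw [br _ (by omega), br _ (by omega), br _ (by omega)]
        have e1 : σ₃.nreg 1 = 1 := by simp [cfr, runOps, Op.apply, bR.r1]
        have e16 : σ₃.nreg 16 = A + N + (i * N + k) := by simp [cfr, runOps, Op.apply, b16]
        refine tr_blk (by simp [OpsOk, Op.Ok, Op.apply, e1, e16]; omega) ?_
        refine ⟨?_, ?_, ⟨bR.of_eq fun r hr => ?_, ?_, ?_, ?_, ?_, ?_, ?_⟩, ?_, ?_⟩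
        · simp [runOps, Op.apply, cfr, b13]
        · simp [runOps, Op.apply, e1]
        · have := cfr r (by omega) (by omega) (by omega) (by omega)
          simp [runOps, Op.apply,
            show r ≠ 15 by omega, show r ≠ 23 by omega] at this
          rw [← this]
          simp only [runOps, Op.apply, State.setN]
          simp [Function.update_apply]
          split_ifs <;> omega
        · simp [runOps, Op.apply, State.setN, cfr, b10]
        · simp [runOps, Op.apply, State.setN, e1, e16]
          omega
        · simp [runOps, Op.apply, State.setN, cfr, b22]
        · simp [runOps, Op.apply, State.setN, cn, bn]
        · intro a ha
          simp [runOps, Op.apply, State.setN, e16]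
          rw [Function.update_of_ne (by omega), cr, br a ha]
        · intro i' k' hi' hk' h
          simp [runOps, Op.apply, State.setN, e16]
          by_cases e : i' * N + k' = i * N + k
          · obtain ⟨rfl, rfl⟩ := index_inj hk hk' e
            rw [Function.update_self, c3, hcells]
          · rw [Function.update_of_ne (by omega), cr, bv i' k' hi' hk' (by omega)]
        · simp [runOps, Op.apply, State.setN, cfr, b12]
        · simp [State.setN]
    · rintro σ₂ ⟨h, h', -⟩
      exact ⟨h, h'⟩
    · rintro σ₂ ⟨⟨bR, b10, b16, b22, bn, br, bv⟩, b12⟩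
      have e : (i + 1) * N = i * N + N := Nat.succ_mul i N
      refine tr_blk (by simp [OpsOk, Op.Ok, Op.apply, bR.r1, b12, b22]; omega) ?_
      refine ⟨?_, ?_, bR.of_eq fun r hr => ?_, ?_, ?_, ?_, ?_, ?_, ?_⟩
      · simpa [runOps, Op.apply] using b10
      · simpa [runOps, Op.apply] using bR.r1
      · simp only [runOps, Op.apply, State.setN]
        simp [Function.update_apply]
        split_ifs <;> omega
      · simp [State.setN]
      · simp [runOps, Op.apply, State.setN, b16]
        omega
      · simp [runOps, Op.apply, State.setN, bR.r1, b12, b22]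
        omega
      · exact bn
      · exact br
      · intro i' k' hi' hk' h
        exact bv i' k' hi' hk' (by omega)
  · rintro σ' ⟨aR, a10, a16, a22, an, ar, av⟩
    exact ⟨aR, an, ar, fun i hi k hk => av i k hi hk (by have := index_lt hi hk; omega)⟩

/-! ### Messages on the grid -/

/-- Tabulates the running minimum of the row at register `16` with slope at most the register `7`. -/
def relaxUp : Program :=
  forN 13 2 (.seq (blk [.nadd 15 3 13, .rload 3 15, .rsub 4 3 2, .rmul 4 4 7, .radd 1 1 4,
    .rmove 2 3, .nadd 15 16 13, .rload 5 15, .nadd 15 5 13])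
    (.seq (.ite (.rlt 5 1) (blk [.rmove 1 5]) .skip) (blk [.rstore 15 1])))

/-- `m` is the least of the numbers `c j` with `P j`. -/
def IsMinOver (P : ℕ → Prop) (c : ℕ → ℝ) (m : ℝ) : Prop := (∀ j, P j → m ≤ c j) ∧ ∃ j, P j ∧ m = c j

theorem IsMinOver.add {P : ℕ → Prop} {c c' : ℕ → ℝ} {m d : ℝ} (h : IsMinOver P c m)
    (e : ∀ j, P j → c' j = c j + d) : IsMinOver P c' (m + d) := by
  obtain ⟨h1, j, hj, h2⟩ := h
  exact ⟨fun i hi => by rw [e i hi]; linarith [h1 i hi], j, hj, by rw [e j hj, h2]⟩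

theorem IsMinOver.insert {P P' : ℕ → Prop} {c : ℕ → ℝ} {m : ℝ} (h : IsMinOver P c m) {k : ℕ}
    (hP : ∀ j, P' j ↔ P j ∨ j = k) : IsMinOver P' c (if c k < m then c k else m) := by
  obtain ⟨h1, j, hj, h2⟩ := h
  split_ifs with hlt
  · refine ⟨fun i hi => ?_, k, (hP k).2 (Or.inr rfl), rfl⟩
    rcases (hP i).1 hi with h | rfl
    · exact hlt.le.trans (h1 i h)
    · exact le_rfl
  · refine ⟨fun i hi => ?_, j, (hP j).2 (Or.inl hj), h2⟩
    rcases (hP i).1 hi with h | rfl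
    · exact h1 i h
    · exact not_lt.1 hlt

theorem IsMinOver.congr {P P' : ℕ → Prop} {c : ℕ → ℝ} {m : ℝ} (h : IsMinOver P c m)
    (hP : ∀ j, P' j ↔ P j) : IsMinOver P' c m := by
  obtain ⟨h1, j, hj, h2⟩ := h
  exact ⟨fun i hi => h1 i ((hP i).1 hi), j, (hP j).2 hj, h2⟩

theorem IsMinOver.unique {P : ℕ → Prop} {c : ℕ → ℝ} {m m' : ℝ} (h : IsMinOver P c m)
    (h' : IsMinOver P c m') : m = m' := by
  obtain ⟨h1, j, hj, h2⟩ := h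
  obtain ⟨h1', j', hj', h2'⟩ := h'
  exact le_antisymm (h2' ▸ h1 j' hj') (h2 ▸ h1' j hj)

/-- First half of the envelope on the grid: moving on to the next grid point raises all competing
costs by the same amount, so one comparison with the new entry updates the minimum. -/
theorem tr_relaxUp {s n N A b : ℕ} {σ : State} (hs : A + N + n * N + N < s) (hR : Regs n N A σ)
    (hb : b + N ≤ A + N + n * N) (h16 : σ.nreg 16 = b) (h1 : σ.rreg 1 = σ.rmem b)
    (h2 : σ.rreg 2 = σ.rmem A) :
    Tr s relaxUp σ (N * 17 + 2) fun σ' => (∀ r, r ≠ 13 → r ≠ 15 → σ'.nreg r = σ.nreg r) ∧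
      σ'.nmem = σ.nmem ∧ σ'.rreg 7 = σ.rreg 7 ∧
      (∀ a < A + N + n * N, σ'.rmem a = σ.rmem a) ∧
      ∀ k < N, IsMinOver (fun j => j ≤ k)
        (fun j => σ.rmem (b + j) + σ.rreg 7 * (σ.rmem (A + k) - σ.rmem (A + j)))
        (σ'.rmem (A + N + n * N + k)) := by
  refine tr_forN' (X := 15) (fun k σ' => σ'.nreg 13 = k ∧
      (∀ r, r ≠ 13 → r ≠ 15 → σ'.nreg r = σ.nreg r) ∧
      σ'.nmem = σ.nmem ∧ σ'.rreg 7 = σ.rreg 7 ∧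
      (∀ a < A + N + n * N, σ'.rmem a = σ.rmem a) ∧
      -- The alternative `j = 0` accounts for the register being loaded with the first entry before
      -- the loop.
      IsMinOver (fun j => j < k ∨ j = 0)
        (fun j => σ.rmem (b + j) + σ.rreg 7 * (σ'.rreg 2 - σ.rmem (A + j))) (σ'.rreg 1) ∧
      ∀ k' < k, IsMinOver (fun j => j ≤ k')
        (fun j => σ.rmem (b + j) + σ.rreg 7 * (σ.rmem (A + k') - σ.rmem (A + j)))
        (σ'.rmem (A + N + n * N + k'))) (by omega) ?_ ?_ ?_ ?_
  · refine ⟨by simp [State.setN], fun r h h' => by simp [State.setN, h], rfl, rfl,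
      fun _ _ => rfl, ⟨?_, 0, Or.inr rfl, ?_⟩, by simp⟩
    · rintro j (h | rfl)
      · omega
      · simp [State.setN, h1, h2]
    · simp [State.setN, h1, h2]
  · rintro k σ' - ⟨a13, afr, -⟩
    exact ⟨a13, by simp [afr, hR.r2]⟩
  · rintro k σ' hk ⟨a13, afr, an, a7, ar, amin, atab⟩
    have e1 : σ'.nreg 1 = 1 := by simp [afr, hR.r1]
    have e3 : σ'.nreg 3 = A := by simp [afr, hR.r3]
    have e5 : σ'.nreg 5 = A + N + n * N := by simp [afr, hR.r5]
    have e16 : σ'.nreg 16 = b := by simp [afr, h16]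
    have hg : σ'.rmem (A + k) = σ.rmem (A + k) := ar _ (by omega)
    have hv : σ'.rmem (b + k) = σ.rmem (b + k) := ar _ (by omega)
    have amin' := (amin.add (c' := fun j => σ.rmem (b + j) +
      σ.rreg 7 * (σ.rmem (A + k) - σ.rmem (A + j)))
      (d := (σ.rmem (A + k) - σ'.rreg 2) * σ.rreg 7) fun j _ => by ring).insert
      (P' := fun j => j ≤ k) (k := k) fun j => by omega
    simp only [sub_self, mul_zero, add_zero] at amin'
    refine tr_seq (X := 10) (Y := 5)
      (tr_blk (by simp [OpsOk, Op.Ok, Op.apply, e3, e5, e16, a13]; omega) (Tr.seq (X := 3) (Y := 2)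
      (Q' := fun σ₂ => σ₂.nreg 13 = k ∧ σ₂.nreg 15 = A + N + n * N + k ∧
      (∀ r, r ≠ 13 → r ≠ 15 → σ₂.nreg r = σ.nreg r) ∧
      σ₂.nmem = σ.nmem ∧ σ₂.rreg 7 = σ.rreg 7 ∧ σ₂.rmem = σ'.rmem ∧
      σ₂.rreg 2 = σ.rmem (A + k) ∧
      IsMinOver (fun j => j ≤ k)
        (fun j => σ.rmem (b + j) + σ.rreg 7 * (σ.rmem (A + k) - σ.rmem (A + j))) (σ₂.rreg 1))
      (tr_ite (X := 2) (fun hb => ?_) fun hb => ?_) ?_))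
    · simp [runOps, Op.apply, Test.Holds, e3, e5, e16, a13, hg, hv, a7] at hb
      rw [if_pos hb] at amin'
      refine tr_blk (by simp [OpsOk, Op.Ok]) ?_
      refine ⟨?_, ?_, fun r h h' => ?_, ?_, ?_, ?_, ?_, ?_⟩
      · simp [runOps, Op.apply, a13]
      · simp [runOps, Op.apply, a13, e5]
      · simp [runOps, Op.apply, h', afr r h h']
      · simpa [runOps, Op.apply] using an
      · simpa [runOps, Op.apply] using a7
      · simp [runOps, Op.apply]
      · simp [runOps, Op.apply, a13, e3, hg]
      · simpa [runOps, Op.apply, a13, e3, e16, hg, hv] using amin'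
    · simp [runOps, Op.apply, Test.Holds, e3, e5, e16, a13, hg, hv, a7] at hb
      rw [if_neg (not_lt.2 hb)] at amin'
      refine (tr_skip ?_).le (by omega)
      refine ⟨?_, ?_, fun r h h' => ?_, ?_, ?_, ?_, ?_, ?_⟩
      · simp [runOps, Op.apply, a13]
      · simp [runOps, Op.apply, a13, e5]
      · simp [runOps, Op.apply, h', afr r h h']
      · simpa [runOps, Op.apply] using an
      · simpa [runOps, Op.apply] using a7
      · simp [runOps, Op.apply]
      · simp [runOps, Op.apply, a13, e3, hg]
      · simpa [runOps, Op.apply, a13, e3, e16, hg, hv, a7] using amin'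
    · rintro σ₂ ⟨b13, b15, bfr, bn, b7, br, b2, bmin⟩
      refine tr_blk (by simp [OpsOk, Op.Ok]) ?_
      refine ⟨?_, ?_, ?_, fun r h h' => ?_, ?_, ?_, fun a ha => ?_, ?_, fun k' hk' => ?_⟩
      · simpa [runOps, Op.apply] using b13
      · simp [runOps, Op.apply, bfr, hR.r1]
      · simp [State.setN]
      · simp [runOps, Op.apply, State.setN, h, bfr r h h']
      · simpa [runOps, Op.apply, State.setN] using bn
      · simpa [runOps, Op.apply, State.setN] using b7
      · simp [runOps, Op.apply, State.setN, b15, br]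
        rw [Function.update_of_ne (by omega), ar a ha]
      · simp only [runOps, Op.apply, State.setN, b2]
        exact bmin.congr fun j => by omega
      · simp only [runOps, Op.apply, State.setN, b15, br]
        by_cases e : k' = k
        · subst e
          rw [Function.update_self]
          exact bmin
        · rw [Function.update_of_ne (by omega)]
          exact atab k' (by omega)
  · rintro σ' ⟨-, afr, an, a7, ar, -, atab⟩
    exact ⟨afr, an, a7, ar, atab⟩

/-- Adds to the row at register `17` the suffix minimum, with slope at least the negative of the
register `7`, of the table made by `relaxUp`. -/
def relaxDown : Program :=
  forN 13 2 (.seq (blk [.nsub 18 2 13, .nsub 18 18 1, .nadd 15 3 18, .rload 3 15, .rsub 4 2 3,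
    .rmul 4 4 7, .radd 1 1 4, .rmove 2 3, .nadd 15 5 18, .rload 5 15, .nadd 15 17 18,
    .rload 6 15]) (.seq (.ite (.rlt 5 1) (blk [.rmove 1 5]) .skip)
    (blk [.radd 6 6 1, .rstore 15 6])))

theorem tr_relaxDown {s n N A b : ℕ} {σ : State} (hs : A + N + n * N + N < s) (hN : 0 < N)
    (hR : Regs n N A σ) (hA : A + N ≤ b) (hb : b + N ≤ A + N + n * N) (h17 : σ.nreg 17 = b)
    (h1 : σ.rreg 1 = σ.rmem (A + N + n * N + (N - 1))) (h2 : σ.rreg 2 = σ.rmem (A + (N - 1))) :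
    Tr s relaxDown σ (N * 21 + 2) fun σ' =>
      (∀ r, r ≠ 13 → r ≠ 15 → r ≠ 18 → σ'.nreg r = σ.nreg r) ∧ σ'.nmem = σ.nmem ∧
      (∀ a, a < b ∨ b + N ≤ a → σ'.rmem a = σ.rmem a) ∧
      ∀ k < N, ∃ m, σ'.rmem (b + k) = σ.rmem (b + k) + m ∧
        IsMinOver (fun j => k ≤ j ∧ j < N) (fun j => σ.rmem (A + N + n * N + j) +
          σ.rreg 7 * (σ.rmem (A + j) - σ.rmem (A + k))) m := by
  refine tr_forN' (X := 19) (fun k σ' => σ'.nreg 13 = k ∧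
      (∀ r, r ≠ 13 → r ≠ 15 → r ≠ 18 → σ'.nreg r = σ.nreg r) ∧
      σ'.nmem = σ.nmem ∧ σ'.rreg 7 = σ.rreg 7 ∧
      (∀ a, a + k < b + N ∨ b + N ≤ a → σ'.rmem a = σ.rmem a) ∧
      -- Round `k` visits the index `N - k - 1`; the alternative `j + 1 = N` again reflects the
      -- preloaded last entry.
      IsMinOver (fun j => (N ≤ k + j ∨ j + 1 = N) ∧ j < N) (fun j => σ.rmem (A + N + n * N + j) +
        σ.rreg 7 * (σ.rmem (A + j) - σ'.rreg 2)) (σ'.rreg 1) ∧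
      ∀ k' < N, N ≤ k + k' → ∃ m, σ'.rmem (b + k') = σ.rmem (b + k') + m ∧
        IsMinOver (fun j => k' ≤ j ∧ j < N) (fun j => σ.rmem (A + N + n * N + j) +
          σ.rreg 7 * (σ.rmem (A + j) - σ.rmem (A + k'))) m) (by omega) ?_ ?_ ?_ ?_
  · refine ⟨by simp [State.setN], fun r h h' h'' => by simp [State.setN, h], rfl, rfl,
      fun _ _ => rfl, ⟨?_, N - 1, by omega, ?_⟩, fun k' _ _ => by omega⟩
    · rintro j hj
      rw [show j = N - 1 by omega]
      simp [State.setN, h1, h2]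
    · simp [State.setN, h1, h2]
  · rintro k σ' - ⟨a13, afr, -⟩
    exact ⟨a13, by simp [afr, hR.r2]⟩
  · rintro k σ' hk ⟨a13, afr, an, a7, ar, amin, atab⟩
    have e1 : σ'.nreg 1 = 1 := by simp [afr, hR.r1]
    have e2 : σ'.nreg 2 = N := by simp [afr, hR.r2]
    have e3 : σ'.nreg 3 = A := by simp [afr, hR.r3]
    have e5 : σ'.nreg 5 = A + N + n * N := by simp [afr, hR.r5]
    have e17 : σ'.nreg 17 = b := by simp [afr, h17]
    obtain ⟨l, hl⟩ : ∃ l, N - k - 1 = l := ⟨_, rfl⟩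
    have hg : σ'.rmem (A + l) = σ.rmem (A + l) := ar _ (by omega)
    have hv : σ'.rmem (A + N + n * N + l) = σ.rmem (A + N + n * N + l) := ar _ (by omega)
    have hw : σ'.rmem (b + l) = σ.rmem (b + l) := ar _ (by omega)
    have amin' := (amin.add (c' := fun j => σ.rmem (A + N + n * N + j) +
      σ.rreg 7 * (σ.rmem (A + j) - σ.rmem (A + l)))
      (d := (σ'.rreg 2 - σ.rmem (A + l)) * σ.rreg 7) fun j _ => by ring).insert
      (P' := fun j => l ≤ j ∧ j < N) (k := l) fun j => by omega
    simp only [sub_self, mul_zero, add_zero] at amin'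
    refine tr_seq (X := 13) (Y := 6)
      (tr_blk (by simp [OpsOk, Op.Ok, Op.apply, e1, e2, e3, e5, e17, a13, hl]; omega)
      (Tr.seq (X := 3) (Y := 3)
      (Q' := fun σ₂ => σ₂.nreg 13 = k ∧ σ₂.nreg 15 = b + l ∧
      (∀ r, r ≠ 13 → r ≠ 15 → r ≠ 18 → σ₂.nreg r = σ.nreg r) ∧
      σ₂.nmem = σ.nmem ∧ σ₂.rreg 7 = σ.rreg 7 ∧ σ₂.rmem = σ'.rmem ∧
      σ₂.rreg 2 = σ.rmem (A + l) ∧ σ₂.rreg 6 = σ.rmem (b + l) ∧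
      IsMinOver (fun j => l ≤ j ∧ j < N) (fun j => σ.rmem (A + N + n * N + j) +
        σ.rreg 7 * (σ.rmem (A + j) - σ.rmem (A + l))) (σ₂.rreg 1))
      (tr_ite (X := 2) (fun hb => ?_) fun hb => ?_) ?_))
    · simp [runOps, Op.apply, Test.Holds, e1, e2, e3, e5, e17, a13, hl, hg, hv, a7] at hb
      rw [if_pos hb] at amin'
      refine tr_blk (by simp [OpsOk, Op.Ok]) ?_
      refine ⟨?_, ?_, fun r h h' h'' => ?_, ?_, ?_, ?_, ?_, ?_, ?_⟩
      · simp [runOps, Op.apply, a13]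
      · simp [runOps, Op.apply, a13, e1, e2, e17, hl]
      · simp [runOps, Op.apply, h', h'', afr r h h']
      · simpa [runOps, Op.apply] using an
      · simpa [runOps, Op.apply] using a7
      · simp [runOps, Op.apply]
      · simp [runOps, Op.apply, a13, e1, e2, e3, hl, hg]
      · simp [runOps, Op.apply, a13, e1, e2, e17, hl, hw]
      · simpa [runOps, Op.apply, a13, e1, e2, e3, e5, hl, hg, hv] using amin'
    · simp [runOps, Op.apply, Test.Holds, e1, e2, e3, e5, e17, a13, hl, hg, hv, a7] at hb
      rw [if_neg (not_lt.2 hb)] at amin'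
      refine (tr_skip ?_).le (by omega)
      refine ⟨?_, ?_, fun r h h' h'' => ?_, ?_, ?_, ?_, ?_, ?_, ?_⟩
      · simp [runOps, Op.apply, a13]
      · simp [runOps, Op.apply, a13, e1, e2, e17, hl]
      · simp [runOps, Op.apply, h', h'', afr r h h']
      · simpa [runOps, Op.apply] using an
      · simpa [runOps, Op.apply] using a7
      · simp [runOps, Op.apply]
      · simp [runOps, Op.apply, a13, e1, e2, e3, hl, hg]
      · simp [runOps, Op.apply, a13, e1, e2, e17, hl, hw]
      · simpa [runOps, Op.apply, a13, e1, e2, e3, e5, hl, hg, hv, a7] using amin'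
    · rintro σ₂ ⟨b13, b15, bfr, bn, b7, br, b2, b6, bmin⟩
      refine tr_blk (by simp [OpsOk, Op.Ok]) ?_
      refine ⟨?_, ?_, ?_, fun r h h' h'' => ?_, ?_, ?_, fun a ha => ?_, ?_, fun k' hk' hkk => ?_⟩
      · simpa [runOps, Op.apply] using b13
      · simp [runOps, Op.apply, bfr, hR.r1]
      · simp [State.setN]
      · simp [runOps, Op.apply, State.setN, h, bfr r h h' h'']
      · simpa [runOps, Op.apply, State.setN] using bn
      · simpa [runOps, Op.apply, State.setN] using b7
      · simp [runOps, Op.apply, State.setN, b15, br]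
        rw [Function.update_of_ne (by omega), ar a (by omega)]
      · simp [runOps, Op.apply, State.setN, b2]
        exact bmin.congr fun j => by omega
      · simp [runOps, Op.apply, State.setN, b15, br, b6]
        by_cases e : k' = l
        · subst e
          rw [Function.update_self]
          exact ⟨_, rfl, bmin⟩
        · rw [Function.update_of_ne (by omega)]
          exact atab k' hk' (by omega)
  · rintro σ' ⟨-, afr, an, a7, ar, -, atab⟩
    exact ⟨afr, an, fun a ha => ar a (by omega), fun k hk => atab k hk (by omega)⟩

/-- Adds the message of the node in register `10` to the row of its parent. -/
def sendMsg : Program :=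
  .seq (blk [.nload 11 10, .nmul 16 10 2, .nadd 16 16 4, .nmul 17 11 2, .nadd 17 17 4,
    .rload 7 10, .rload 1 16, .rload 2 3]) (.seq relaxUp (.seq (blk [.nsub 18 2 1, .nadd 15 5 18,
    .rload 1 15, .nadd 15 3 18, .rload 2 15]) relaxDown))

/-- The two sweeps compute the minimum over `j' ≤ j` and `k ≤ j` of the cost of going from `j'` up
to `j` and down to `k`. On a sorted grid this detour is never shorter than the direct distance, and
equals it when `j` is the larger of `j'` and `k`. -/
theorem tr_sendMsg {s n N A i p : ℕ} {σ : State} (hs : A + N + n * N + N < s) (hN : 0 < N)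
    (hnA : n ≤ A) (hR : Regs n N A σ) (hi : i < n) (hp : p < n) (h10 : σ.nreg 10 = i)
    (hpar : σ.nmem i = p) (hsort : SortedCells σ.rmem A N) (hw : 0 ≤ σ.rmem i) :
    Tr s sendMsg σ (N * 38 + 19) fun σ' =>
      (∀ r, r ≤ 10 → σ'.nreg r = σ.nreg r) ∧ σ'.nmem = σ.nmem ∧
      (∀ a < A + N + n * N, a < A + N + p * N ∨ A + N + p * N + N ≤ a → σ'.rmem a = σ.rmem a) ∧
      ∀ k < N, ∃ m, σ'.rmem (A + N + (p * N + k)) = σ.rmem (A + N + (p * N + k)) + m ∧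
        IsMinOver (fun j => j < N) (fun j => σ.rmem (A + N + (i * N + j)) +
          σ.rmem i * |σ.rmem (A + k) - σ.rmem (A + j)|) m := by
  have hiN : i * N + N ≤ n * N := by
    have := Nat.mul_le_mul_right N (Nat.succ_le_of_lt hi)
    rwa [Nat.succ_mul] at this
  have hpN : p * N + N ≤ n * N := by
    have := Nat.mul_le_mul_right N (Nat.succ_le_of_lt hp)
    rwa [Nat.succ_mul] at this
  refine (tr_seq (X := 9)
    (tr_blk (by
      simp [OpsOk, Op.Ok, Op.apply, hR.r2, hR.r4, h10, hpar]
      refine ⟨?_, ?_, ?_, ?_⟩ <;> omega)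
    (Tr.seq (tr_relaxUp (b := A + N + i * N) hs (hR.of_eq fun r hr => ?_) (by omega) ?_ ?_ ?_)
    (Y := 6 + (N * 21 + 2)) ?_))).le (by omega)
  · simp only [runOps, Op.apply]
    simp [Function.update_apply]
    split_ifs <;> omega
  · simp [runOps, Op.apply, hR.r2, hR.r4, h10]; omega
  · simp [runOps, Op.apply, hR.r2, hR.r4, h10]; congr 1; omega
  · simp [runOps, Op.apply, hR.r3]
  rintro σ₂ ⟨bfr, bn, b7, br, btab⟩
  have bR : Regs n N A σ₂ := hR.of_eq fun r hr => by
    rw [bfr r (by omega) (by omega)]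
    simp only [runOps, Op.apply]
    simp [Function.update_apply]
    split_ifs <;> omega
  have b17 : σ₂.nreg 17 = A + N + p * N := by
    simp [bfr, runOps, Op.apply, hR.r2, hR.r4, h10, hpar]; omega
  simp [runOps, Op.apply, hR.r2, hR.r4, h10] at bn b7 br btab
  refine tr_seq (tr_blk (by simp [OpsOk, Op.Ok, Op.apply, bR.r1, bR.r2, bR.r3, bR.r5]; omega)
    ((tr_relaxDown (b := A + N + p * N) hs hN (bR.of_eq fun r hr => ?_) (by omega) (by omega)
      ?_ ?_ ?_).weaken le_rfl ?_))
  · simp only [runOps, Op.apply]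
    simp [Function.update_apply]
    split_ifs <;> omega
  · simpa [runOps, Op.apply] using b17
  · simp [runOps, Op.apply, bR.r1, bR.r2, bR.r5]
  · simp [runOps, Op.apply, bR.r1, bR.r2, bR.r3]
  rintro σ₃ ⟨cfr, cn, cr, ctab⟩
  simp [runOps, Op.apply, b7] at cn cr ctab
  refine ⟨fun r hr => ?_, cn.trans bn, fun a ha ha' => ?_, fun k hk => ?_⟩
  · rw [cfr r (by omega) (by omega) (by omega)]
    simp only [runOps, Op.apply]
    simp [show r ≠ 15 by omega, show r ≠ 18 by omega]
    rw [bfr r (by omega) (by omega)]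
    simp [runOps, Op.apply, Function.update_apply]
    split_ifs <;> omega
  · rw [cr a (by omega), br a ha]
  · obtain ⟨m, e, hm⟩ := ctab k hk
    refine ⟨m, ?_, ?_⟩
    · rw [← add_assoc, e, br _ (by omega)]
    have hg : ∀ j < N, σ₂.rmem (A + j) = σ.rmem (A + j) := fun j hj => br _ (by omega)
    obtain ⟨hm1, j, hj, hm2⟩ := hm
    simp only [hg j hj.2, hg k hk] at hm2
    -- The turning point is the larger of `j` and `k`, where the detour is direct.
    have lower : ∀ j < N, m ≤ σ.rmem (A + N + (i * N + j)) +
        σ.rmem i * |σ.rmem (A + k) - σ.rmem (A + j)| := by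
      intro j hj
      have ea : i * N + (A + N) + j = A + N + (i * N + j) := by omega
      have eb : A + N + i * N + j = A + N + (i * N + j) := by omega
      rcases le_total k j with h | h
      · have h1 := hm1 j ⟨h, hj⟩
        have h2 := (btab j hj).1 j le_rfl
        simp only [hg j hj, hg k hk] at h1
        rw [abs_of_nonpos (by linarith [hsort k j h hj])]
        simp only [sub_self, mul_zero, add_zero, eb] at h2
        linarith
      · have h1 := hm1 k ⟨le_rfl, hk⟩
        have h2 := (btab k hk).1 j h
        rw [abs_of_nonneg (by linarith [hsort j k h hk])]
        simp only [sub_self, mul_zero, add_zero, eb] at h1 h2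
        linarith
    refine ⟨lower, ?_⟩
    -- Conversely, the optimal detour starts at some `j'`, and the triangle inequality bounds its
    -- length from below by the distance of `j'` and `k`.
    obtain ⟨-, j', hj', e'⟩ := btab j hj.2
    have hj'N : j' < N := by omega
    refine ⟨j', hj'N, le_antisymm (lower j' hj'N) ?_⟩
    have eb : A + N + i * N + j' = A + N + (i * N + j') := by omega
    simp only [eb] at e'
    rw [hm2, e']
    have h1 := hsort k j hj.1 hj.2
    have h2 := hsort j' j hj' hj.2
    have h3 : |σ.rmem (A + k) - σ.rmem (A + j')| ≤
        (σ.rmem (A + j) - σ.rmem (A + j')) + (σ.rmem (A + j) - σ.rmem (A + k)) :=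
      abs_le.2 ⟨by linarith, by linarith⟩
    nlinarith [mul_le_mul_of_nonneg_left h3 hw]

/-! ### The forward pass -/

/-- As `h` is injective, each node `i` is selected in at most one round `e`, so the expensive branch
is taken at most `n` times in all. -/
theorem sum_cost_le {n X c : ℕ} (d h : ℕ → ℕ) (hh : Set.InjOn h (Finset.range n)) :
    ∑ e ∈ Finset.range n, (∑ i ∈ Finset.range n, ((if d i = h e then X else 1) + 8) + c) ≤
      n * (n * 9 + c) + n * X := by
  have h1 : ∀ i, ∑ e ∈ Finset.range n, (if d i = h e then X else 0) ≤ X := by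
    intro i
    rw [← Finset.sum_filter, Finset.sum_const, smul_eq_mul]
    have : ((Finset.range n).filter fun e => d i = h e).card ≤ 1 := by
      refine Finset.card_le_one.2 fun a ha b hb => ?_
      rw [Finset.mem_filter] at ha hb
      exact hh (Finset.mem_coe.2 ha.1) (Finset.mem_coe.2 hb.1) (ha.2.symm.trans hb.2)
    nlinarith
  calc ∑ e ∈ Finset.range n, (∑ i ∈ Finset.range n, ((if d i = h e then X else 1) + 8) + c)
      ≤ ∑ e ∈ Finset.range n,
          (∑ i ∈ Finset.range n, ((if d i = h e then X else 0) + 9) + c) := by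
        refine Finset.sum_le_sum fun e _ => Nat.add_le_add_right (Finset.sum_le_sum fun i _ => ?_) c
        split_ifs <;> omega
    _ = ∑ i ∈ Finset.range n, ∑ e ∈ Finset.range n, (if d i = h e then X else 0)
          + n * (n * 9 + c) := by
        rw [Finset.sum_comm]
        simp only [Finset.sum_add_distrib, Finset.sum_const, Finset.card_range, smul_eq_mul]
        ring
    _ ≤ ∑ i ∈ Finset.range n, X + n * (n * 9 + c) :=
        Nat.add_le_add_right (Finset.sum_le_sum fun i _ => h1 i) _
    _ = n * (n * 9 + c) + n * X := by simp; ring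

/-- Sends the messages of all nodes, in the order of decreasing depth. -/
def forwardPhase : Program :=
  forN 8 0 (.seq (blk [.nsub 9 0 8]) (forN 10 0 (.seq (blk [.nadd 11 0 0, .nadd 11 11 10,
    .nload 11 11]) (ifEq 11 9 sendMsg))))

section Forward

variable {n : ℕ} (T : RootedTree n) (w : Fin n → ℝ) (f : Fin n → ℝ → ℝ)

/-- The message of the node `v` without the contributions of the children that come after the
position `(d, i)` in the forward pass. -/
noncomputable def partialMsg (d i : ℕ) (v : Fin n) (z : ℝ) : ℝ :=
  f v z + ∑ c ∈ T.children v,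
    if d < T.depth c ∨ T.depth c = d ∧ c.val < i then edgeMsg T w f c z else 0

/-- Up to additive constants, the rows from address `V` on hold the values of `F` at the points of
the grid at address `A`. -/
def HasRows (ρ : ℕ → ℝ) (V A N : ℕ) (F : Fin n → ℝ → ℝ) : Prop :=
  ∀ v : Fin n, ∃ C, ∀ k < N, ρ (V + (v * N + k)) = F v (ρ (A + k)) + C

variable {T w f}

theorem partialMsg_succ {d i : ℕ} (u : Fin n) (hu : u.val = i) (v : Fin n) (z : ℝ) :
    partialMsg T w f d (i + 1) v z = partialMsg T w f d i v z +
      if T.depth u = d ∧ u ∈ T.children v then edgeMsg T w f u z else 0 := by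
  rw [partialMsg, partialMsg, add_assoc]
  congr 1
  have h : (if T.depth u = d ∧ u ∈ T.children v then edgeMsg T w f u z else 0) =
      ∑ c ∈ T.children v, if c = u then (if T.depth u = d then edgeMsg T w f u z else 0) else 0 := by
    rw [Finset.sum_ite_eq' (T.children v) u]
    split_ifs <;> simp_all
  rw [h, ← Finset.sum_add_distrib]
  refine Finset.sum_congr rfl fun c _ => ?_
  by_cases hc : c = u
  · subst hc
    by_cases hd : T.depth c = d
    · rw [if_pos (Or.inr ⟨hd, by omega⟩), if_neg (by omega), if_pos rfl, if_pos hd, zero_add]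
    · rw [if_pos rfl, if_neg hd, add_zero]
      congr 1
      apply propext
      omega
  · have : c.val ≠ i := fun e => hc (Fin.ext (e.trans hu.symm))
    rw [if_neg hc, add_zero]
    congr 1
    apply propext
    omega

theorem partialMsg_next {d : ℕ} : partialMsg T w f (d + 1) n = partialMsg T w f d 0 := by
  funext v z
  rw [partialMsg, partialMsg]
  congr 1
  refine Finset.sum_congr rfl fun c _ => ?_
  congr 1
  apply propext
  have := c.isLt
  omega

theorem partialMsg_start : partialMsg T w f n 0 = f := by
  funext v z
  rw [partialMsg, Finset.sum_eq_zero, add_zero]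
  intro c _
  have := T.depth_le c
  rw [if_neg (by omega)]

/-- The children of `v` lie one level deeper and have all been handled, so the row of `v` is
complete when `v` sends its message. -/
theorem partialMsg_depth {i : ℕ} (v : Fin n) :
    partialMsg T w f (T.depth v) i v = nodeMsg T w f v := by
  funext z
  rw [partialMsg, nodeMsg]
  congr 1
  refine Finset.sum_congr rfl fun c hc => ?_
  have := T.depth_child hc
  rw [if_pos (by omega)]

theorem partialMsg_end : partialMsg T w f 0 0 = nodeMsg T w f := by
  funext v z
  rw [partialMsg, nodeMsg]
  congr 1
  refine Finset.sum_congr rfl fun c hc => ?_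
  have := T.depth_child hc
  rw [if_pos (by omega)]

/-- The hypothesis `hmin` is the interface to the concavity argument: at grid points the envelope
over the line is a minimum over grid points, which is what `sendMsg` computes. -/
theorem tr_forwardPhase {s N A : ℕ} {σ : State} (hs : A + N + n * N + N + 3 * n < s) (hN : 0 < N)
    (hnA : n ≤ A) (hR : Regs n N A σ) (hpar : ∀ u : Fin n, σ.nmem u = T.parent u)
    (hdep : ∀ u : Fin n, σ.nmem (n + n + u) = T.depth u)
    (hw : ∀ u, u ≠ T.root → 0 ≤ w u) (hW : ∀ u : Fin n, u ≠ T.root → σ.rmem u = w u)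
    (hsort : SortedCells σ.rmem A N) (hrows : HasRows σ.rmem (A + N) A N f)
    (hmin : ∀ u, u ≠ T.root → ∀ k < N, IsMinOver (fun j => j < N)
      (fun j => nodeMsg T w f u (σ.rmem (A + j)) + w u * |σ.rmem (A + k) - σ.rmem (A + j)|)
      (edgeMsg T w f u (σ.rmem (A + k)))) :
    Tr s forwardPhase σ (n * (n * 9 + 6) + n * (N * 38 + 19) + 2) fun σ' => Regs n N A σ' ∧
      σ'.nmem = σ.nmem ∧ (∀ a < A + N, σ'.rmem a = σ.rmem a) ∧
      HasRows σ'.rmem (A + N) A N (nodeMsg T w f) := by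
  let dep : ℕ → ℕ := fun i => if h : i < n then T.depth ⟨i, h⟩ else 0
  let I : ℕ → ℕ → State → Prop := fun d i σ' => Regs n N A σ' ∧ σ'.nmem = σ.nmem ∧
    (∀ a < A + N, σ'.rmem a = σ.rmem a) ∧ HasRows σ'.rmem (A + N) A N (partialMsg T w f d i)
  -- Round `e` treats the depth `n - e`, which never becomes `0`; hence the root sends no message.
  refine (tr_forN (M := n) (cost := fun e =>
      2 + (∑ i ∈ Finset.range n, ((4 + ((if dep i = n - e then N * 38 + 19 else 1) + 2)) + 2) + 2))
    (fun e σ' => I (n - e) 0 σ' ∧ σ'.nreg 8 = e) (by omega) ?_ ?_ ?_ ?_).le ?_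
  · refine ⟨⟨hR.of_eq fun r hr => ?_, rfl, fun _ _ => rfl, ?_⟩, by simp [State.setN]⟩
    · simp only [State.setN]
      rw [Function.update_of_ne (by omega)]
    · rw [Nat.sub_zero, partialMsg_start]
      exact hrows
  · rintro e σ' - ⟨⟨aR, -⟩, a8⟩
    exact ⟨a8, aR.r0⟩
  · rintro e σ' he ⟨⟨aR, an, ar, arow⟩, a8⟩
    refine tr_seq (tr_blk (by simp [OpsOk, Op.Ok]) (tr_forN (M := n)
      (fun i σ' => I (n - e) i σ' ∧ σ'.nreg 8 = e ∧ σ'.nreg 9 = n - e ∧ σ'.nreg 10 = i)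
      (by omega) ?_ ?_ ?_ ?_))
    · refine ⟨⟨aR.of_eq fun r hr => ?_, an, ar, arow⟩, ?_, ?_, ?_⟩
      · simp only [runOps, Op.apply, State.setN]
        simp [Function.update_apply]
        split_ifs <;> omega
      · simp [runOps, Op.apply, State.setN, a8]
      · simp [runOps, Op.apply, State.setN, a8, aR.r0]
      · simp [State.setN]
    · rintro i σ₂ - ⟨⟨bR, -⟩, -, -, b10⟩
      exact ⟨b10, bR.r0⟩
    · rintro i σ₂ hi ⟨⟨bR, bn, br, brow⟩, b8, b9, b10⟩
      obtain ⟨u, hu⟩ : ∃ u : Fin n, u.val = i := ⟨⟨i, hi⟩, rfl⟩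
      have hdi : dep i = T.depth u := by simp [dep, ← hu]
      have hload : σ₂.nmem (n + n + i) = T.depth u := by rw [bn, ← hu, hdep]
      refine tr_seq (tr_blk (by simp [OpsOk, Op.Ok, Op.apply, bR.r0, b10]; omega)
        (tr_ifEq (Q := fun σ' => σ'.nreg 10 = i ∧ σ'.nreg 1 = 1 ∧
          I (n - e) (i + 1) (σ'.setN 10 (i + 1)) ∧ (σ'.setN 10 (i + 1)).nreg 8 = e ∧
          (σ'.setN 10 (i + 1)).nreg 9 = n - e ∧ (σ'.setN 10 (i + 1)).nreg 10 = i + 1)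
          (X := N * 38 + 19) ?_ ?_ |>.le ?_))
      · intro heq
        simp [runOps, Op.apply, bR.r0, b10, b9, hload] at heq
        have hroot : u ≠ T.root := fun h => by
          rw [h, T.depth_root] at heq
          omega
        refine (tr_sendMsg (i := i) (p := T.parent u) (by omega) hN hnA
          (bR.of_eq fun r hr => ?_) hi (T.parent u).isLt ?_ ?_ ?_ ?_).weaken le_rfl ?_
        · simp only [runOps, Op.apply]
          simp [Function.update_apply]
          split_ifs <;> omega
        · simp [runOps, Op.apply, b10]
        · simp only [runOps, Op.apply]
          rw [bn, ← hu, hpar]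
        · intro p q hpq hq
          simp only [runOps, Op.apply]
          rw [br _ (by omega), br _ (by omega)]
          exact hsort p q hpq hq
        · simp only [runOps, Op.apply]
          rw [br _ (by omega), ← hu, hW u hroot]
          exact hw u hroot
        rintro σ₃ ⟨cfr, cn, cr, crow⟩
        simp only [runOps, Op.apply] at cn cr crow
        have cg : ∀ a < A + N, σ₃.rmem a = σ₂.rmem a := fun a ha =>
          cr a (by omega) (Or.inl (by omega))
        refine ⟨?_, ?_, ⟨bR.of_eq fun r hr => ?_, cn.trans bn, fun a ha => ?_, ?_⟩, ?_, ?_, ?_⟩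
        · simp [cfr, runOps, Op.apply, b10]
        · simp [cfr, runOps, Op.apply, bR.r1]
        · simp only [State.setN]
          rw [Function.update_of_ne (by omega), cfr r (by omega)]
          simp only [runOps, Op.apply]
          simp [Function.update_apply]
          split_ifs <;> omega
        · simp only [State.setN]
          rw [cg a ha, br a ha]
        · intro v
          simp only [State.setN]
          obtain ⟨Cu, hCu⟩ := brow u
          obtain ⟨Cv, hCv⟩ := brow v
          by_cases hv : v = T.parent u
          · refine ⟨Cv + Cu, fun k hk => ?_⟩
            obtain ⟨m, hm, hmin'⟩ := crow k hk
            have hvc : u ∈ T.children v := T.mem_children.2 ⟨hroot, hv.symm⟩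
            -- The row of `u` is the complete message shifted by `Cu`, so the minimum computed from
            -- it is shifted by the same constant.
            have hm' : m = edgeMsg T w f u (σ.rmem (A + k)) + Cu := by
              refine hmin'.unique ((hmin u hroot k hk).add fun j hj => ?_)
              rw [← hu, hCu j hj, br (A + j) (by omega), br (A + k) (by omega),
                br u (by omega), hW u hroot, ← heq, partialMsg_depth]
              ring
            rw [hv, hm, hm', ← hv, hCv k hk, partialMsg_succ u hu, if_pos ⟨heq, hvc⟩,
              cg (A + k) (by omega), br (A + k) (by omega)]
            ring
          · refine ⟨Cv, fun k hk => ?_⟩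
            have hne : v.val ≠ (T.parent u).val := fun h => hv (Fin.ext h)
            have h1 := index_lt v.isLt hk
            rw [cr _ (by omega) ?_, hCv k hk, partialMsg_succ u hu, if_neg, add_zero,
              cg (A + k) (by omega)]
            · rintro ⟨-, h⟩
              exact hv (T.mem_children.1 h).2.symm
            · rcases lt_or_gt_of_ne hne with h | h
              · have := index_lt h hk
                omega
              · have := index_lt h (show N - 1 < N by omega)
                omega
        · simp [cfr, runOps, Op.apply, State.setN, b8]
        · simp [cfr, runOps, Op.apply, State.setN, b9]
        · simp [State.setN]
      · intro hne
        simp [runOps, Op.apply, bR.r0, b10, b9, hload] at hne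
        refine ⟨?_, ?_, ⟨bR.of_eq fun r hr => ?_, bn, br, ?_⟩, ?_, ?_, ?_⟩
        · simp [runOps, Op.apply, b10]
        · simp [runOps, Op.apply, bR.r1]
        · simp only [runOps, Op.apply, State.setN]
          simp [Function.update_apply]
          split_ifs <;> omega
        · intro v
          obtain ⟨C, hC⟩ := brow v
          refine ⟨C, fun k hk => ?_⟩
          rw [partialMsg_succ u hu, if_neg fun h => hne h.1, add_zero]
          exact hC k hk
        · simp [runOps, Op.apply, State.setN, b8]
        · simp [runOps, Op.apply, State.setN, b9]
        · simp [State.setN]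
      · simp [runOps, Op.apply, bR.r0, b10, b9, hload, hdi]
    · rintro σ₂ ⟨⟨bR, bn, br, brow⟩, b8, b9, b10⟩
      refine ⟨b8, bR.r1, ⟨bR.of_eq fun r hr => ?_, bn, br, ?_⟩, by simp [State.setN]⟩
      · simp only [State.setN]
        rw [Function.update_of_ne (by omega)]
      · rw [← partialMsg_next, show n - (e + 1) + 1 = n - e by omega]
        exact brow
  · rintro σ' ⟨⟨aR, an, ar, arow⟩, -⟩
    rw [Nat.sub_self, partialMsg_end] at arow
    exact ⟨aR, an, ar, arow⟩
  · refine Nat.add_le_add_right (le_trans (le_of_eq (Finset.sum_congr rfl fun e _ => ?_))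
      (sum_cost_le (c := 6) dep (fun e => n - e) ?_)) 2
    · have : ∀ i, 4 + ((if dep i = n - e then N * 38 + 19 else 1) + 2) + 2 =
          (if dep i = n - e then N * 38 + 19 else 1) + 8 := fun i => by omega
      simp only [this]
      omega
    · intro a ha b hb h
      simp only [Finset.coe_range, Set.mem_Iio] at ha hb h
      omega

end Forward

/-! ### The backward pass -/

/-- Replaces the real register `4` by the product of its absolute value and the register `7`. -/
def absMul : Program :=
  .seq (.ite (.rlt 4 0) (blk [.rsub 4 0 4]) .skip) (blk [.rmul 4 4 7])

theorem tr_absMul {s : ℕ} {σ : State} (h0 : σ.rreg 0 = 0) :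
    Tr s absMul σ 5 fun σ' => σ'.nreg = σ.nreg ∧ σ'.nmem = σ.nmem ∧ σ'.rmem = σ.rmem ∧
      σ'.rreg = Function.update σ.rreg 4 (|σ.rreg 4| * σ.rreg 7) := by
  refine Tr.seq (X := 3) (Y := 2) (Q' := fun σ' => σ'.nreg = σ.nreg ∧ σ'.nmem = σ.nmem ∧
    σ'.rmem = σ.rmem ∧ σ'.rreg = Function.update σ.rreg 4 |σ.rreg 4|)
    (tr_ite (X := 2) (fun hb => ?_) fun hb => ?_) ?_
  · simp only [Test.Holds, h0] at hb
    refine tr_blk (by simp [OpsOk, Op.Ok]) ?_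
    simp [runOps, Op.apply, h0, abs_of_neg hb]
  · simp only [Test.Holds, h0, not_lt] at hb
    refine (tr_skip ?_).le (by omega)
    simp [abs_of_nonneg hb]
  · rintro σ' ⟨h1, h2, h3, h4⟩
    refine tr_blk (by simp [OpsOk, Op.Ok]) ?_
    simp [runOps, Op.apply, h1, h2, h3, h4]

/-- Improves the point in the real register `1`, whose cost is in the register `3`. -/
def pickLoop : Program :=
  forN 13 2 (.seq (blk [.nadd 15 3 13, .rload 5 15, .rsub 4 2 5]) (.seq absMul
    (.seq (blk [.nadd 15 16 13, .rload 6 15, .radd 6 6 4])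
      (.ite (.rlt 6 3) (blk [.rmove 3 6, .rmove 1 5]) .skip))))

/-- The cost of the `j`-th point of the grid at address `A`, with the row at address `b`. -/
noncomputable def pickCost (ρ : ℕ → ℝ) (A b : ℕ) (y W : ℝ) (j : ℕ) : ℝ :=
  ρ (b + j) + |y - ρ (A + j)| * W

theorem tr_pickLoop {s n N A b : ℕ} {σ : State} (hs : A + N + n * N + N < s) (hR : Regs n N A σ)
    (hb : b + N ≤ A + N + n * N) (h16 : σ.nreg 16 = b) (h0 : σ.rreg 0 = 0) (hN : 0 < N)
    (h1 : σ.rreg 1 = σ.rmem A) (h3 : σ.rreg 3 = pickCost σ.rmem A b (σ.rreg 2) (σ.rreg 7) 0) :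
    Tr s pickLoop σ (N * 19 + 2) fun σ' => (∀ r, r ≠ 13 → r ≠ 15 → σ'.nreg r = σ.nreg r) ∧
      σ'.nmem = σ.nmem ∧ σ'.rmem = σ.rmem ∧ ∃ j < N, σ'.rreg 1 = σ.rmem (A + j) ∧
        ∀ k < N, pickCost σ.rmem A b (σ.rreg 2) (σ.rreg 7) j ≤
          pickCost σ.rmem A b (σ.rreg 2) (σ.rreg 7) k := by
  refine tr_forN' (X := 17) (fun k σ' => σ'.nreg 13 = k ∧
      (∀ r, r ≠ 13 → r ≠ 15 → σ'.nreg r = σ.nreg r) ∧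
      σ'.nmem = σ.nmem ∧ σ'.rmem = σ.rmem ∧ σ'.rreg 0 = 0 ∧ σ'.rreg 2 = σ.rreg 2 ∧
      σ'.rreg 7 = σ.rreg 7 ∧ ∃ j < N, σ'.rreg 1 = σ.rmem (A + j) ∧
        σ'.rreg 3 = pickCost σ.rmem A b (σ.rreg 2) (σ.rreg 7) j ∧
        ∀ i < k, σ'.rreg 3 ≤ pickCost σ.rmem A b (σ.rreg 2) (σ.rreg 7) i) (by omega) ?_ ?_ ?_ ?_
  · exact ⟨by simp [State.setN], fun r h h' => by simp [State.setN, h], rfl, rfl, h0, rfl, rfl,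
      0, hN, h1, h3, by simp⟩
  · rintro k σ' - ⟨a13, afr, -⟩
    exact ⟨a13, by simp [afr, hR.r2]⟩
  · rintro k σ' hk ⟨a13, afr, an, ar, a0, a2, a7, j, hj, a1, a3, amin⟩
    have e1 : σ'.nreg 1 = 1 := by simp [afr, hR.r1]
    have e3 : σ'.nreg 3 = A := by simp [afr, hR.r3]
    have e16 : σ'.nreg 16 = b := by simp [afr, h16]
    refine tr_seq (X := 4) (Y := 13) (tr_blk (by simp [OpsOk, Op.Ok, e3, a13]; omega)
      (Tr.seq (X := 5) (Y := 8) (tr_absMul (by simpa [runOps, Op.apply] using a0)) ?_))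
    rintro σ₂ ⟨bn, bm, br, brr⟩
    simp [runOps, Op.apply, e3, a13, a2, ar] at bn bm br brr
    refine tr_seq (X := 4) (Y := 4)
      (tr_blk (by simp [OpsOk, Op.Ok, bn, e16, a13]; omega)
      (tr_ite (X := 3) (fun hb' => ?_) fun hb' => ?_))
    · simp [runOps, Op.apply, Test.Holds, bn, br, brr, e16, a13, a7] at hb'
      change pickCost σ.rmem A b (σ.rreg 2) (σ.rreg 7) k < _ at hb'
      refine tr_blk (by simp [OpsOk, Op.Ok]) ?_
      refine ⟨?_, ?_, ?_, fun r h h' => ?_, ?_, ?_, ?_, ?_, ?_, k, hk, ?_, ?_, fun i hi => ?_⟩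
      · simp [runOps, Op.apply, bn, a13]
      · simp [runOps, Op.apply, bn, e1]
      · simp [State.setN]
      · simp [runOps, Op.apply, State.setN, bn, h, h', afr r h h']
      · simp [runOps, Op.apply, State.setN, bm, an]
      · simp [runOps, Op.apply, State.setN, br]
      · simp [runOps, Op.apply, State.setN, brr, a0]
      · simp [runOps, Op.apply, State.setN, brr, a2]
      · simp [runOps, Op.apply, State.setN, brr, a7]
      · simp [runOps, Op.apply, State.setN, brr]
      · simp [runOps, Op.apply, State.setN, bn, br, brr, e16, a13, a7, pickCost]
      · have e : pickCost σ.rmem A b (σ.rreg 2) (σ.rreg 7) k ≤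
            pickCost σ.rmem A b (σ.rreg 2) (σ.rreg 7) i := by
          by_cases h : i = k
          · rw [h]
          · exact hb'.le.trans (amin i (by omega))
        simpa [runOps, Op.apply, State.setN, bn, br, brr, e16, a13, a7, pickCost] using e
    · simp [runOps, Op.apply, Test.Holds, bn, br, brr, e16, a13, a7] at hb'
      change _ ≤ pickCost σ.rmem A b (σ.rreg 2) (σ.rreg 7) k at hb'
      refine (tr_skip ?_).le (by omega)
      refine ⟨?_, ?_, ?_, fun r h h' => ?_, ?_, ?_, ?_, ?_, ?_, j, hj, ?_, ?_, fun i hi => ?_⟩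
      · simp [runOps, Op.apply, bn, a13]
      · simp [runOps, Op.apply, bn, e1]
      · simp [State.setN]
      · simp [runOps, Op.apply, State.setN, bn, h, h', afr r h h']
      · simp [runOps, Op.apply, State.setN, bm, an]
      · simp [runOps, Op.apply, State.setN, br]
      · simp [runOps, Op.apply, State.setN, brr, a0]
      · simp [runOps, Op.apply, State.setN, brr, a2]
      · simp [runOps, Op.apply, State.setN, brr, a7]
      · simp [runOps, Op.apply, State.setN, brr, a1]
      · simp [runOps, Op.apply, State.setN, brr, a3]
      · have e : σ'.rreg 3 ≤ pickCost σ.rmem A b (σ.rreg 2) (σ.rreg 7) i := by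
          by_cases h : i = k
          · rw [h]; exact hb'
          · exact amin i (by omega)
        simpa [runOps, Op.apply, State.setN, brr] using e
  · rintro σ' ⟨-, afr, an, ar, -, -, -, j, hj, a1, a3, amin⟩
    exact ⟨afr, an, ar, j, hj, a1, fun k hk => a3 ▸ amin k hk⟩

/-- Computes the coordinate of the node in register `10` from the one of its parent. -/
def pick : Program :=
  .seq (blk [.rconst 0 0, .nload 11 10, .rload 2 11, .rload 7 10, .nmul 16 10 2, .nadd 16 16 4,
    .rload 1 3, .rload 3 16, .rsub 4 2 1]) (.seq absMul (.seq (blk [.radd 3 3 4])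
    (.seq pickLoop (blk [.rstore 10 1]))))

theorem tr_pick {s n N A i p : ℕ} {σ : State} (hs : A + N + n * N + N < s) (hN : 0 < N)
    (hR : Regs n N A σ) (hi : i < n) (h10 : σ.nreg 10 = i) (hpar : σ.nmem i = p) :
    Tr s pick σ (N * 19 + 21) fun σ' =>
      (∀ r, r ≤ 10 → σ'.nreg r = σ.nreg r) ∧ σ'.nmem = σ.nmem ∧
      ∃ j < N, σ'.rmem = Function.update σ.rmem i (σ.rmem (A + j)) ∧
        ∀ k < N, pickCost σ.rmem A (A + N + i * N) (σ.rmem p) (σ.rmem i) j ≤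
          pickCost σ.rmem A (A + N + i * N) (σ.rmem p) (σ.rmem i) k := by
  have hiN : i * N + N ≤ n * N := by
    have := Nat.mul_le_mul_right N (Nat.succ_le_of_lt hi)
    rwa [Nat.succ_mul] at this
  refine (tr_seq (X := 10) (tr_blk (by
      simp [OpsOk, Op.Ok, Op.apply, hR.r2, hR.r4, h10]
      constructor <;> omega)
    (Tr.seq (X := 5) (Y := 2 + ((N * 19 + 2) + 2)) (tr_absMul ?_) ?_))).le (by omega)
  · simp [runOps, Op.apply]
  rintro σ₂ ⟨bn, bm, br, brr⟩
  simp [runOps, Op.apply, hR.r2, hR.r3, hR.r4, h10, hpar] at bn bm br brr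
  have ea : i * N + (A + N) = A + N + i * N := by omega
  refine tr_seq (tr_blk (by simp [OpsOk, Op.Ok]) (Tr.seq
    (tr_pickLoop (b := A + N + i * N) hs (hR.of_eq fun r hr => ?_) (by omega) ?_ ?_ hN ?_ ?_) ?_))
  · simp only [runOps, Op.apply]
    simp [bn, show r ≠ 16 by omega, show r ≠ 11 by omega]
  · simp [runOps, Op.apply, bn, ea]
  · simp [runOps, Op.apply, brr]
  · simp [runOps, Op.apply, brr, br]
  · simp [runOps, Op.apply, brr, br, pickCost, ea]
  · rintro σ₃ ⟨cfr, cn, cr, j, hj, c1, cmin⟩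
    simp [runOps, Op.apply, brr, br] at cn cr c1 cmin
    refine tr_blk (by simp [OpsOk, Op.Ok]) ?_
    refine ⟨fun r hr => ?_, cn.trans bm, j, hj, ?_, cmin⟩
    · simp only [runOps, Op.apply]
      rw [cfr r (by omega) (by omega)]
      simp [runOps, Op.apply, bn, show r ≠ 16 by omega,
        show r ≠ 11 by omega]
    · simp [runOps, Op.apply, cr, c1, cfr, bn, h10]

/-- Computes the coordinates of all nodes, in the order of increasing depth. -/
def backwardPhase : Program :=
  forN 8 0 (forN 10 0 (.seq (blk [.nadd 11 0 0, .nadd 11 11 10, .nload 11 11]) (ifEq 11 8 pick)))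

/-- The coordinates overwrite the weights: cell `u` holds the weight of `u` until `u` is treated and
its coordinate afterwards. In the order of increasing depth, the parent's coordinate is available
when a node other than the root is treated. -/
theorem tr_backwardPhase {n s N A : ℕ} (T : RootedTree n) {F : Fin n → ℝ → ℝ} {σ : State}
    (hs : A + N + n * N + N + 3 * n < s) (hN : 0 < N)
    (hnA : n ≤ A) (hR : Regs n N A σ) (hpar : ∀ u : Fin n, σ.nmem u = T.parent u)
    (hdep : ∀ u : Fin n, σ.nmem (n + n + u) = T.depth u) (hroot : σ.rmem T.root = 0)
    (hrows : HasRows σ.rmem (A + N) A N F) :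
    Tr s backwardPhase σ (n * (n * 9 + 4) + n * (N * 19 + 21) + 2) fun σ' =>
      ∀ u : Fin n, ∃ j < N, σ'.rmem u = σ.rmem (A + j) ∧ ∀ k < N,
        F u (σ.rmem (A + j)) + σ.rmem u * |σ'.rmem (T.parent u) - σ.rmem (A + j)| ≤
          F u (σ.rmem (A + k)) + σ.rmem u * |σ'.rmem (T.parent u) - σ.rmem (A + k)| := by
  let dep : ℕ → ℕ := fun i => if h : i < n then T.depth ⟨i, h⟩ else 0
  let I : ℕ → ℕ → State → Prop := fun d i σ' => Regs n N A σ' ∧ σ'.nmem = σ.nmem ∧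
    (∀ a, n ≤ a → σ'.rmem a = σ.rmem a) ∧ ∀ u : Fin n,
    (¬(T.depth u < d ∨ T.depth u = d ∧ u.val < i) → σ'.rmem u = σ.rmem u) ∧
    ((T.depth u < d ∨ T.depth u = d ∧ u.val < i) → ∃ j < N, σ'.rmem u = σ.rmem (A + j) ∧
      ∀ k < N, F u (σ.rmem (A + j)) + σ.rmem u * |σ'.rmem (T.parent u) - σ.rmem (A + j)| ≤
          F u (σ.rmem (A + k)) + σ.rmem u * |σ'.rmem (T.parent u) - σ.rmem (A + k)|)
  refine (tr_forN (M := n) (cost := fun d =>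
      ∑ i ∈ Finset.range n, ((4 + ((if dep i = d then N * 19 + 21 else 1) + 2)) + 2) + 2)
    (fun d σ' => I d 0 σ' ∧ σ'.nreg 8 = d) (by omega) ?_ ?_ ?_ ?_).le ?_
  · refine ⟨⟨hR.of_eq fun r hr => ?_, rfl, fun _ _ => rfl, fun u => ⟨fun _ => rfl, ?_⟩⟩,
      by simp [State.setN]⟩
    · simp only [State.setN]
      rw [Function.update_of_ne (by omega)]
    · intro h
      omega
  · rintro d σ' - ⟨⟨aR, -⟩, a8⟩
    exact ⟨a8, aR.r0⟩
  · rintro d σ' hd ⟨⟨aR, an, ar, acond⟩, a8⟩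
    refine tr_forN (M := n)
      (fun i σ' => I d i σ' ∧ σ'.nreg 8 = d ∧ σ'.nreg 10 = i) (by omega) ?_ ?_ ?_ ?_
    · refine ⟨⟨aR.of_eq fun r hr => ?_, an, ar, acond⟩, ?_, ?_⟩
      · simp only [State.setN]
        rw [Function.update_of_ne (by omega)]
      · simp [State.setN, a8]
      · simp [State.setN]
    · rintro i σ₂ - ⟨⟨bR, -⟩, -, b10⟩
      exact ⟨b10, bR.r0⟩
    · rintro i σ₂ hi ⟨⟨bR, bn, br, bcond⟩, b8, b10⟩
      obtain ⟨u, hu⟩ : ∃ u : Fin n, u.val = i := ⟨⟨i, hi⟩, rfl⟩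
      have hdi : dep i = T.depth u := by simp [dep, ← hu]
      have hload : σ₂.nmem (n + n + i) = T.depth u := by rw [bn, ← hu, hdep]
      have hval : ∀ v : Fin n, v ≠ u → v.val ≠ i := fun v hv e => hv (Fin.ext (e.trans hu.symm))
      refine tr_seq (tr_blk (by simp [OpsOk, Op.Ok, Op.apply, bR.r0, b10]; omega)
        (tr_ifEq (Q := fun σ' => σ'.nreg 10 = i ∧ σ'.nreg 1 = 1 ∧
          I d (i + 1) (σ'.setN 10 (i + 1)) ∧ (σ'.setN 10 (i + 1)).nreg 8 = d ∧
          (σ'.setN 10 (i + 1)).nreg 10 = i + 1) (X := N * 19 + 21) ?_ ?_ |>.le ?_))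
      · intro heq
        simp [runOps, Op.apply, bR.r0, b10, b8, hload] at heq
        refine (tr_pick (i := i) (p := T.parent u) (by omega) hN
          (bR.of_eq fun r hr => ?_) hi ?_ ?_).weaken le_rfl ?_
        · simp only [runOps, Op.apply]
          simp [Function.update_apply]
          split_ifs <;> omega
        · simp [runOps, Op.apply, b10]
        · simp only [runOps, Op.apply]
          rw [bn, ← hu, hpar]
        rintro σ₃ ⟨cfr, cn, j, hj, cr, cmin⟩
        simp only [runOps, Op.apply] at cn cr cmin
        have hg : ∀ k, σ₂.rmem (A + k) = σ.rmem (A + k) := fun k => br _ (by omega)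
        refine ⟨?_, ?_, ⟨bR.of_eq fun r hr => ?_, cn.trans bn, fun a ha => ?_, fun v => ?_⟩, ?_, ?_⟩
        · simp [cfr, runOps, Op.apply, b10]
        · simp [cfr, runOps, Op.apply, bR.r1]
        · simp only [State.setN]
          rw [Function.update_of_ne (by omega), cfr r (by omega)]
          simp only [runOps, Op.apply]
          simp [Function.update_apply]
          split_ifs <;> omega
        · simp only [State.setN]
          rw [cr, Function.update_of_ne (by omega), br a ha]
        · simp only [State.setN, cr, hg]
          by_cases hv : v = u
          · refine ⟨fun h => absurd (Or.inr ⟨hv ▸ heq, by rw [hv, hu]; omega⟩) h, fun _ => ?_⟩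
            subst hv
            have hWv : σ₂.rmem i = σ.rmem i := by
              have := (bcond v).1 (by omega)
              rwa [hu] at this
            -- The search used the parent's cell before the write to cell `i`. For the root, which
            -- is its own parent, that cell changes, but the weight `0` removes the term; for the
            -- other nodes the parent's cell is a different one.
            have hρ : σ.rmem i * |Function.update σ₂.rmem i (σ.rmem (A + j)) (T.parent v) -
                σ.rmem (A + j)| = σ.rmem i * |σ₂.rmem (T.parent v) - σ.rmem (A + j)| ∧
                ∀ k, σ.rmem i * |Function.update σ₂.rmem i (σ.rmem (A + j)) (T.parent v) -
                σ.rmem (A + k)| = σ.rmem i * |σ₂.rmem (T.parent v) - σ.rmem (A + k)| := by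
              by_cases hvr : v = T.root
              · rw [← hu, hvr, hroot]; simp
              · rw [Function.update_of_ne (hval _ fun e => hvr (T.parent_eq_self_iff.1 e))]
                exact ⟨rfl, fun _ => rfl⟩
            refine ⟨j, hj, by rw [hu, Function.update_self], fun k hk => ?_⟩
            obtain ⟨C, hC⟩ := hrows v
            have h1 := cmin k hk
            have h2 : ∀ l < N, pickCost σ₂.rmem A (A + N + i * N) (σ₂.rmem (T.parent v))
                (σ₂.rmem i) l = F v (σ.rmem (A + l)) +
                  σ.rmem i * |σ₂.rmem (T.parent v) - σ.rmem (A + l)| + C := by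
              intro l hl
              rw [pickCost, hg, hWv, br _ (by omega), ← hu, add_assoc, hC l hl]
              ring
            rw [h2 j hj, h2 k hk] at h1
            rw [hu, hρ.1, hρ.2 k]
            linarith
          · have hne := hval v hv
            rw [Function.update_of_ne hne]
            refine ⟨fun h => (bcond v).1 (by omega), fun h => ?_⟩
            -- A node treated before is not a child of `u`, as those have depth `d + 1`; so writing
            -- the coordinate of `u` does not disturb its optimality.
            have hpv : (T.parent v).val ≠ i := by
              refine hval _ fun e => ?_
              by_cases hvr : v = T.root
              · rw [hvr, T.parent_root] at e
                exact hv (hvr.trans e)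
              · have := T.depth_eq hvr
                rw [e] at this
                omega
            rw [Function.update_of_ne hpv]
            exact (bcond v).2 (by omega)
        · simp [cfr, runOps, Op.apply, State.setN, b8]
        · simp [State.setN]
      · intro hne
        simp [runOps, Op.apply, bR.r0, b10, b8, hload] at hne
        refine ⟨?_, ?_, ⟨bR.of_eq fun r hr => ?_, bn, br, fun v => ?_⟩, ?_, ?_⟩
        · simp [runOps, Op.apply, b10]
        · simp [runOps, Op.apply, bR.r1]
        · simp only [runOps, Op.apply, State.setN]
          simp [Function.update_apply]
          split_ifs <;> omega
        · have : v.val = i → T.depth v ≠ d := fun e => by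
            rw [show v = u from Fin.ext (e.trans hu.symm)]
            exact hne
          exact ⟨fun h => (bcond v).1 (by omega), fun h => (bcond v).2 (by omega)⟩
        · simp [runOps, Op.apply, State.setN, b8]
        · simp [State.setN]
      · simp [runOps, Op.apply, bR.r0, b10, b8, hload, hdi]
    · rintro σ₂ ⟨⟨bR, bn, br, bcond⟩, b8, b10⟩
      refine ⟨b8, bR.r1, ⟨bR.of_eq fun r hr => ?_, bn, br, fun v => ?_⟩, by simp [State.setN]⟩
      · simp only [State.setN]
        rw [Function.update_of_ne (by omega)]
      · have := v.isLt
        exact ⟨fun h => (bcond v).1 (by omega), fun h => (bcond v).2 (by omega)⟩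
  · rintro σ' ⟨⟨aR, an, ar, acond⟩, -⟩ u
    exact (acond u).2 (Or.inl (T.depth_lt u))
  · refine Nat.add_le_add_right (le_trans (le_of_eq (Finset.sum_congr rfl fun e _ => ?_))
      (sum_cost_le (c := 4) dep (fun e => e) fun _ _ _ _ h => h)) 2
    have : ∀ i, 4 + ((if dep i = e then N * 19 + 21 else 1) + 2) + 2 =
        (if dep i = e then N * 19 + 21 else 1) + 8 := fun i => by omega
    simp only [this]

/-! ### The input -/

theorem getD_flatten_ofFn {n : ℕ} (G : Fin n → List ℝ) (len : ℕ → ℕ)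
    (h : ∀ u, (G u).length = len u) (u : Fin n) {j : ℕ} (hj : j < len u) :
    (List.ofFn G).flatten.getD (∑ i ∈ Finset.range u, len i + j) 0 = (G u).getD j 0 := by
  induction n generalizing len with
  | zero => exact u.elim0
  | succ n ih =>
    rw [List.ofFn_succ, List.flatten_cons]
    induction u using Fin.cases with
    | zero => rw [Fin.val_zero, Finset.sum_range_zero, zero_add,
        List.getD_append _ _ _ _ (by rw [h]; exact hj)]
    | succ u =>
      have h0 := h 0
      rw [Fin.val_zero] at h0
      rw [Fin.val_succ, Finset.sum_range_succ', List.getD_append_right _ _ _ _ (by omega),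
        ← ih (fun u => G u.succ) (fun i => len (i + 1)) (fun u => h u.succ) u hj, h0]
      congr 1
      omega

theorem length_flatten_ofFn {n : ℕ} (G : Fin n → List ℝ) (len : ℕ → ℕ)
    (h : ∀ u, (G u).length = len u) :
    (List.ofFn G).flatten.length = ∑ i ∈ Finset.range n, len i := by
  rw [List.length_flatten, List.map_ofFn, List.sum_ofFn, Finset.sum_range]
  exact Finset.sum_congr rfl fun u _ => h u

namespace PLSeq

theorem length_toList (S : PLSeq) : S.toList.length = 2 * S.t + 1 := by
  rw [toList, List.length_cons, length_flatten_ofFn _ (fun _ => 2) fun _ => rfl]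
  simp [mul_comm]

theorem getD_toList_bp (S : PLSeq) (q : Fin S.t) : S.toList.getD (2 * q + 1) 0 = S.bp q := by
  rw [toList, List.getD_cons_succ]
  have := getD_flatten_ofFn (fun q : Fin S.t => [S.bp q, S.slope q.succ]) (fun _ => 2)
    (fun _ => rfl) q (j := 0) (by omega)
  simpa [mul_comm] using this

theorem getD_toList_slope (S : PLSeq) (p : Fin (S.t + 1)) :
    S.toList.getD (2 * p) 0 = S.slope p := by
  induction p using Fin.cases with
  | zero => rfl
  | succ q =>
    rw [toList, Fin.val_succ, show 2 * (q.val + 1) = (2 * q + 1) + 1 by ring, List.getD_cons_succ]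
    have := getD_flatten_ofFn (fun q : Fin S.t => [S.bp q, S.slope q.succ]) (fun _ => 2)
      (fun _ => rfl) q (j := 1) (by omega)
    simpa [mul_comm] using this

end PLSeq

section Input

variable {n : ℕ} (T : RootedTree n) (w : Fin n → ℝ) (S : Fin n → PLSeq)

/-- The number of breakpoints of the `i`-th unary term. -/
def termSize (i : ℕ) : ℕ := if h : i < n then (S ⟨i, h⟩).t else 0

theorem termSize_fin (u : Fin n) : termSize S u = (S u).t := by simp [termSize]

theorem getD_ofFn_append {α : Type*} (G : Fin n → α) (l : List α) (d : α) (u : Fin n) :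
    (List.ofFn G ++ l).getD u d = G u := by
  rw [List.getD_append _ _ _ _ (by simp)]
  simp

theorem inputState_parent (u : Fin n) : (inputState T w S).nmem u = T.parent u :=
  getD_ofFn_append _ _ _ u

theorem inputState_size (u : Fin n) : (inputState T w S).nmem (n + u) = termSize S u := by
  rw [termSize_fin]
  simp only [inputState]
  rw [List.getD_append_right _ _ _ _ (by simp)]
  simp

theorem inputState_nmem_blank {a : ℕ} (ha : n + n ≤ a) : (inputState T w S).nmem a = 0 := by
  simp only [inputState]
  exact List.getD_eq_default _ _ (by simpa using ha)

theorem inputState_weight (u : Fin n) : (inputState T w S).rmem u = w u :=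
  getD_ofFn_append _ _ _ u

theorem sum_size (i : ℕ) : ∑ j ∈ Finset.range i, (2 * termSize S j + 1) =
    i + 2 * ∑ j ∈ Finset.range i, termSize S j := by
  rw [Finset.sum_add_distrib, ← Finset.mul_sum]
  simp
  omega

theorem inputState_term (u : Fin n) {j : ℕ} (hj : j < 2 * (S u).t + 1) :
    (inputState T w S).rmem (n + u + 2 * ∑ i ∈ Finset.range u, termSize S i + j) =
      (S u).toList.getD j 0 := by
  simp only [inputState]
  rw [List.getD_append_right _ _ _ _ (by simp; omega)]
  have := getD_flatten_ofFn (fun i => (S i).toList) (fun i => 2 * termSize S i + 1)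
    (fun u => by rw [PLSeq.length_toList, termSize_fin]) u (j := j) (by rwa [termSize_fin])
  rw [sum_size] at this
  rw [← this, List.length_ofFn]
  congr 1
  omega

theorem inputState_rmem_blank {a : ℕ}
    (ha : n + n + 2 * ∑ i ∈ Finset.range n, termSize S i ≤ a) :
    (inputState T w S).rmem a = 0 := by
  simp only [inputState]
  refine List.getD_eq_default _ _ ?_
  rw [List.length_append, length_flatten_ofFn _ (fun i => 2 * termSize S i + 1)
    (fun u => by rw [PLSeq.length_toList, termSize_fin]), sum_size, List.length_ofFn]
  omega

theorem inputState_fitsIn {s K : ℕ} (hK : ∀ i, (S i).t ≤ K) (hs : n + K < s)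
    (hs' : n + n + 2 * ∑ i ∈ Finset.range n, termSize S i ≤ s) :
    (inputState T w S).FitsIn s := by
  refine ⟨fun a => ?_, fun a => ?_, fun a ha => inputState_nmem_blank T w S (by omega),
    fun a ha => inputState_rmem_blank T w S (hs'.trans ha)⟩
  · simp only [inputState, Function.update_apply]
    split_ifs <;> omega
  · by_cases h1 : a < n
    · have := inputState_parent T w S ⟨a, h1⟩
      have h2 := (T.parent ⟨a, h1⟩).isLt
      simp only at this
      omega
    · by_cases h2 : a < n + n
      · have h3 := inputState_size T w S ⟨a - n, by omega⟩
        rw [termSize_fin] at h3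
        have h4 := hK ⟨a - n, by omega⟩
        simp only [show n + (a - n) = a by omega] at h3
        omega
      · rw [inputState_nmem_blank T w S (by omega)]
        omega

theorem evalCells_eq_eval {ρ : ℕ → ℝ} {p : ℕ} {R : PLSeq}
    (h : ∀ j < 2 * R.t + 1, ρ (p + j) = R.toList.getD j 0) (x : ℝ) :
    evalCells ρ p R.t x = R.eval x := by
  have hs : ∀ q : Fin (R.t + 1), ρ (p + 2 * q) = R.slope q := fun q => by
    rw [h _ (by omega), R.getD_toList_slope]
  have hb : ∀ q : Fin R.t, ρ (p + 2 * q + 1) = R.bp q := fun q => by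
    rw [add_assoc, h _ (by omega), R.getD_toList_bp]
  rw [evalCells, PLSeq.eval, Finset.sum_range, ← hs 0]
  congr 1
  refine Finset.sum_congr rfl fun q _ => ?_
  rw [hb q, ← hs q.succ, ← hs q.castSucc, Fin.val_succ, Fin.val_castSucc, mul_add, add_assoc]

end Input

/-! ### The program -/

/-- The minimization program. -/
def minimizeTV : Program :=
  .seq depthPhase (.seq layoutPhase (.seq gridPhase (.seq evalPhase (.seq forwardPhase
    backwardPhase))))

theorem tr_minimizeTV {n s N A K : ℕ} (T : RootedTree n) {w : Fin n → ℝ} {S : Fin n → PLSeq}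
    {f : Fin n → ℝ → ℝ} (hw : ∀ i, i ≠ T.root → 0 ≤ w i) (hK : ∀ i, (S i).t ≤ K)
    (hf : ∀ i, (S i).Represents (f i)) (hmin : ∃ x, IsMinimizer T w f x)
    (hN : N = ∑ i ∈ Finset.range n, termSize S i + 1)
    (hA : A = n + n + 2 * ∑ i ∈ Finset.range n, termSize S i)
    (hs : A + N + n * N + N + 3 * n + 1 < s) :
    Tr s minimizeTV (inputState T w S)
      ((n * (n * 10 + 14) + 4) + ((n * 6 + 12) + ((n * (K * (N * 9 + 12) + 8) + 7) +
        ((n * (N * (K * 16 + 13) + 11) + 5) + ((n * (n * 9 + 6) + n * (N * 38 + 19) + 2) +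
        (n * (n * 9 + 4) + n * (N * 19 + 21) + 2))))))
      fun σ' => IsBackwardPass T w (nodeMsg T w f) fun i => σ'.rmem i := by
  set ρ := (inputState T w S).rmem with hρ
  have hfa : ∀ i, IsAtomic K (f i) := fun i => (hf i).isAtomic.mono (hK i)
  have htK : ∀ i < n, termSize S i ≤ K := fun i hi => by
    have := termSize_fin S ⟨i, hi⟩
    simp only at this
    rw [this]
    exact hK _
  have hterm : ∀ u : Fin n, n + u + 2 * ∑ i ∈ Finset.range u, termSize S i +
      (2 * (S u).t + 1) ≤ A := by
    intro u
    have : ∑ j ∈ Finset.range (u + 1), termSize S j ≤ ∑ j ∈ Finset.range n, termSize S j :=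
      Finset.sum_le_sum_of_subset (Finset.range_subset_range.2 u.isLt)
    rw [Finset.sum_range_succ, termSize_fin] at this
    omega
  refine (tr_depthPhase T (by omega) (by simp [inputState]) (by simp [inputState]) rfl
    (inputState_parent T w S)).seq ?_
  rintro σ₁ ⟨a0, a1, a6, an, ad, ar⟩
  have hsize : ∀ i < n, σ₁.nmem (n + i) = termSize S i := fun i hi => by
    rw [an _ (by omega)]
    exact inputState_size T w S ⟨i, hi⟩
  have hpar : ∀ u : Fin n, σ₁.nmem u = T.parent u := fun u => by
    rw [an _ (by omega), inputState_parent]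
  refine (tr_layoutPhase hN hA (by omega) a0 a1 a6 hsize).seq ?_
  rintro σ₂ ⟨bR, bn, br⟩
  refine (tr_gridPhase hN hA (by omega) bR (by rw [bn]; exact hsize) htK).seq ?_
  rintro σ₃ ⟨cR, cn, cr, csort, ccell⟩
  have hmem : ∀ a < A, n ≤ a → σ₃.rmem a = ρ a := fun a ha hna => by
    rw [cr a ha, br, ar, Function.update_of_ne (by omega)]
  refine (tr_evalPhase hA (by omega) (by omega) cR (by rw [cn, bn]; exact hsize) htK).seq ?_
  rintro σ₄ ⟨dR, dn, dr, drow⟩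
  have hgrid : ∀ k < N, σ₄.rmem (A + k) = σ₃.rmem (A + k) := fun k hk => dr _ (by omega)
  have hweight : ∀ u : Fin n, u ≠ T.root → σ₄.rmem u = w u := fun u hu => by
    rw [dr _ (by omega), cr _ (by omega), br, ar,
      Function.update_of_ne fun e => hu (Fin.ext e)]
    exact inputState_weight T w S u
  have hroot : σ₄.rmem T.root = 0 := by
    rw [dr _ (by omega), cr _ (by omega), br, ar, Function.update_self]
  have hrows : HasRows σ₄.rmem (A + N) A N f := by
    intro v
    obtain ⟨c, hc⟩ := (hf v).exists_eq_eval
    refine ⟨-c, fun k hk => ?_⟩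
    rw [drow v v.isLt k hk, termSize_fin, hgrid k hk, hc, evalCells_eq_eval]
    · ring
    · intro j hj
      have := hterm v
      rw [hmem _ (by omega) (by omega)]
      exact inputState_term T w S v hj
  set Λ := (Finset.range N).image fun k => σ₄.rmem (A + k) with hΛ
  have mem_Λ : ∀ k < N, σ₄.rmem (A + k) ∈ Λ := fun k hk =>
    Finset.mem_image_of_mem _ (Finset.mem_range.2 hk)
  have hconc : ∀ i, CellConcave (Λ : Set ℝ) (f i) := by
    intro i
    obtain ⟨c, hc⟩ := (hf i).exists_eq_eval
    have h : CellConcave (Λ : Set ℝ) (S i).eval := by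
      refine CellConcave.eval _ fun q => ?_
      obtain ⟨k, hk, e⟩ := ccell i i.isLt q (by rw [termSize_fin]; exact q.isLt)
      have h1 := hterm i
      have h2 : σ₂.rmem (n + i + 2 * ∑ j ∈ Finset.range i, termSize S j + 1 + 2 * q) =
          (S i).bp q := by
        rw [← cr _ (by omega), hmem _ (by omega) (by omega), ← (S i).getD_toList_bp q,
          ← inputState_term T w S i (by omega), hρ]
        congr 1
        omega
      rw [← h2, ← e, ← hgrid k hk]
      exact mem_Λ k hk
    have := h.add (CellConcave.affine c 0)
    simp only [zero_mul, add_zero, ← hc] at this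
    exact this
  refine (tr_forwardPhase (T := T) (w := w) (f := f) (by omega) (by omega) (by omega) dR
    (by rw [dn, cn, bn]; exact hpar) (by rw [dn, cn, bn]; exact ad) hw hweight
    (fun p q hpq hq => by
      rw [hgrid _ (by omega), hgrid _ hq]
      exact csort p q hpq hq) hrows ?_).seq ?_
  · intro u hu k hk
    -- The message is a lower bound as a minimum over the line; that it is attained on the grid is
    -- the point of `exists_mem_edgeMsg_eq`.
    refine ⟨fun j _ => ((edgeMsg_spec hw hfa hmin hu).2 _).2 ⟨_, rfl⟩, ?_⟩
    obtain ⟨z, hz, e⟩ := exists_mem_edgeMsg_eq hw hfa hmin hconc hu (mem_Λ k hk)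
    obtain ⟨j, hj, rfl⟩ := Finset.mem_image.1 hz
    exact ⟨j, Finset.mem_range.1 hj, e⟩
  rintro σ₅ ⟨eR, en, er, erow⟩
  have hgrid' : ∀ k < N, σ₅.rmem (A + k) = σ₄.rmem (A + k) := fun k hk => er _ (by omega)
  refine (tr_backwardPhase T (F := nodeMsg T w f) (by omega) (by omega) (by omega) eR
    (by rw [en, dn, cn, bn]; exact hpar) (by rw [en, dn, cn, bn]; exact ad)
    (by rw [er _ (by omega), hroot]) erow).weaken le_rfl ?_
  intro σ₆ h
  have key : ∀ u : Fin n, σ₆.rmem u ∈ Λ ∧ ∀ z ∈ Λ,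
      nodeMsg T w f u (σ₆.rmem u) + σ₄.rmem u * |σ₆.rmem (T.parent u) - σ₆.rmem u| ≤
        nodeMsg T w f u z + σ₄.rmem u * |σ₆.rmem (T.parent u) - z| := by
    intro u
    obtain ⟨j, hj, e, hle⟩ := h u
    rw [e]
    refine ⟨?_, fun z hz => ?_⟩
    · rw [hgrid' j hj]
      exact mem_Λ j hj
    · obtain ⟨k, hk, rfl⟩ := Finset.mem_image.1 hz
      have h1 := hle k (Finset.mem_range.1 hk)
      rw [hgrid' k (Finset.mem_range.1 hk), er u (by omega)] at h1
      exact h1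
  refine isBackwardPass_of_grid hw hfa hmin hconc (fun i => (key i).1) (fun z hz => ?_)
    fun i hi z hz => ?_
  -- The zero stored as the root's weight removes the distance term.
  · have := (key T.root).2 z hz
    rw [hroot] at this
    simpa using this
  · have := (key i).2 z hz
    rw [hweight i hi] at this
    exact this

/-- The count is at most `(25 * K * K + 107 * K + 219) * n ^ 2`; it is rounded up to a constant that
serves the space bound and the numbers of breakpoints as well. -/
theorem time_bound {n N K : ℕ} (hn : 1 ≤ n) (hN : N ≤ (K + 1) * n) :
    (n * (n * 10 + 14) + 4) + ((n * 6 + 12) + ((n * (K * (N * 9 + 12) + 8) + 7) +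
      ((n * (N * (K * 16 + 13) + 11) + 5) + ((n * (n * 9 + 6) + n * (N * 38 + 19) + 2) +
      (n * (n * 9 + 4) + n * (N * 19 + 21) + 2))))) ≤
    (25 * K * K + 200 * K + 300) * n ^ 2 := by
  have h1 : n ≤ n ^ 2 := Nat.le_self_pow (by omega) n
  have h2 : n * N ≤ (K + 1) * n ^ 2 := by
    calc n * N ≤ n * ((K + 1) * n) := Nat.mul_le_mul_left _ hN
      _ = (K + 1) * n ^ 2 := by ring
  calc _ = 28 * n ^ 2 + 89 * n + 12 * K * n + (25 * K + 70) * (n * N) + 32 := by ring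
    _ ≤ 28 * n ^ 2 + 89 * n ^ 2 + 12 * K * n ^ 2 + (25 * K + 70) * ((K + 1) * n ^ 2)
        + 32 * n ^ 2 := by gcongr; omega
    _ = (25 * K * K + 107 * K + 219) * n ^ 2 := by ring
    _ ≤ _ := by gcongr <;> omega

theorem space_bound {n N B K : ℕ} (hn : 1 ≤ n) (hN : N = B + 1) (hB : B ≤ K * n) :
    n + n + 2 * B + N + n * N + N + 3 * n + 1 + K < (25 * K * K + 200 * K + 300) * n ^ 2 := by
  have h1 : n ≤ n ^ 2 := Nat.le_self_pow (by omega) n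
  calc n + n + 2 * B + N + n * N + N + 3 * n + 1 + K
      = 5 * n + 4 * B + 3 + n * B + n + K := by rw [hN]; ring
    _ ≤ 5 * n + 4 * (K * n) + 3 + n * (K * n) + n + K := by gcongr
    _ = 6 * n + 4 * K * n + K * n ^ 2 + 3 + K := by ring
    _ ≤ 6 * n ^ 2 + 4 * K * n ^ 2 + K * n ^ 2 + 3 * n ^ 2 + K * n ^ 2 := by
        gcongr
        · omega
        · exact Nat.le_mul_of_pos_right _ (by omega)
    _ = (6 * K + 9) * n ^ 2 := by ring
    _ < _ := by
        refine Nat.mul_lt_mul_of_pos_right ?_ (by omega)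
        have : 0 ≤ 25 * K * K := Nat.zero_le _
        omega

end TVTree
-- Assembly of the theorem
theorem mainTheorem1 :
    ∃ P : TVTree.Program, ∀ K : ℕ, ∃ c : ℕ,
      ∀ (n : ℕ) (T : TVTree.RootedTree n) (w : Fin n → ℝ) (S : Fin n → TVTree.PLSeq)
        (f : Fin n → ℝ → ℝ),
        (∀ i, i ≠ T.root → 0 ≤ w i) →
        (∀ i, (S i).t ≤ K) →
        (∀ i, (S i).Represents (f i)) →
        (∃ x, TVTree.IsMinimizer T w f x) →
        ∃ x : Fin n → ℝ,
          TVTree.Computes P (c * n ^ 2) (c * n ^ 2) T w S x ∧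
          TVTree.IsMinimizer T w f x ∧
          ∃ Mhat M : Fin n → ℝ → ℝ,
            TVTree.IsMessages T w f Mhat M ∧
            (∀ i, TVTree.IsPLWith (c * (T.subtree i).card) (Mhat i)) ∧
            (∀ i, i ≠ T.root → TVTree.IsPLWith (c * (T.subtree i).card) (M i)) ∧
            TVTree.IsBackwardPass T w Mhat x := by
  refine ⟨TVTree.minimizeTV, fun K => ⟨25 * K * K + 200 * K + 300, ?_⟩⟩
  intro n T w S f hw hK hf hmin
  have hfa : ∀ i, TVTree.IsAtomic K (f i) := fun i => (hf i).isAtomic.mono (hK i)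
  have hn : 1 ≤ n := T.root.pos
  have hB : ∑ i ∈ Finset.range n, TVTree.termSize S i ≤ K * n := by
    refine (Finset.sum_le_card_nsmul _ _ K fun i hi => ?_).trans_eq (by simp [mul_comm])
    have := TVTree.termSize_fin S ⟨i, Finset.mem_range.1 hi⟩
    simp only at this
    rw [this]
    exact hK _
  have hN : ∑ i ∈ Finset.range n, TVTree.termSize S i + 1 ≤ (K + 1) * n := by
    rw [Nat.succ_mul]
    omega
  have hspace := TVTree.space_bound hn rfl hB
  have htime := TVTree.time_bound hn hN
  have hfit := TVTree.inputState_fitsIn (s := (25 * K * K + 200 * K + 300) * n ^ 2) T w S hK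
    (by omega) (by omega)
  obtain ⟨τ, hτ, σ, hexec, -, hback⟩ :=
    TVTree.tr_minimizeTV T hw hK hf hmin rfl rfl (by omega) hfit
  have hc : ∀ m, K * m ≤ (25 * K * K + 200 * K + 300) * m := fun m =>
    Nat.mul_le_mul_right m (by have := Nat.zero_le (25 * K * K); omega)
  exact ⟨fun i => σ.rmem i, ⟨hfit, τ, hτ.trans htime, σ, hexec, fun _ => rfl⟩,
    hback.isMinimizer hw hfa hmin, TVTree.nodeMsg T w f, TVTree.edgeMsg T w f,
    TVTree.isMessages hw hfa hmin,
    fun i => ((TVTree.isAtomic_nodeMsg' hw hfa hmin i).mono (hc _)).isPLWith,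
    fun i hi => ((TVTree.edgeMsg_spec hw hfa hmin hi).1.mono (hc _)).isPLWith, hback⟩
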